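/- Let $\beta\in\{1,2,4\}$ and let $\mathbb F_\beta=\mathbb R,\mathbb C,\mathbb H$ (real quaternions) respectively. Let $d\ge 1$, let $\Sigma$ be a fixed positive definite Hermitian $d\times d$ matrix with entries in $\mathbb F_\beta$, and let $y_1,\dots,y_d>0$ be the eigenvalues of $\Sigma^{-1}$, listed with multiplicity (not necessarily distinct; for $\beta=4$ each eigenvalue of the corresponding $2d\times 2d$ complex matrix, which has doubly degenerate spectrum, is counted with half its multiplicity). Let $G_1,G_2,\dots$ be independent standard Gaussian $d\times d$ matrices over $\mathbb F_\beta$: the $\beta$ real components of all entries are independent normal variables with mean $0$ and variance $1/\beta$. Put $A_i=\Sigma^{1/2}G_i$, $P_N=A_NA_{N-1}\cdots A_1$, and let $\mu_1(N)$ be the largest finite-$N$ Lyapunov exponent, that is, the largest eigenvalue of $P_N^\dagger P_N$ is $e^{2N\mu_1(N)}$. Let $\sigma_1^2=\operatorname{Var}(\mu_1(N))$. For $0<\epsilon<\min_i y_i$, $\eta>0$ and $R>\max_i y_i$ let $\mathcal C_R$ be the contour that starts at $R$, runs to the left above the real axis at height $\eta$ as far as $\epsilon$, crosses to the lower side of the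 real axis, and returns to $R$ at height $-\eta$ (the boundary of $[\epsilon,R]\times[-\eta,\eta]$, traversed anticlockwise). With principal branches of the logarithm and the powers, put $$J_p=\lim_{R\to\infty}\frac1{2\pi i}\int_{\mathcal C_R}(\log z)^p\prod_{i=1}^d\Big(1-\frac z{y_i}\Big)^{-\beta/2}\frac{dz}z\qquad(p=0,1,2,\dots).$$ This limit exists, is real, and does not depend on $\epsilon$ and $\eta$; if $\beta d$ is even, the integral already equals $J_p$ for every finite $R>\max_i y_i$. Then $\mu_1(N)$ is square integrable for every $N\ge1$ and, to leading order for large $N$, $$\sigma_1^2=\frac1{4N}\Big(\frac{\pi^2}6-J_2-J_1^2\Big),\qquad\text{that is,}\qquad \lim_{N\to\infty}N\operatorname{Var}(\mu_1(N))=\frac14\Big(\frac{\pi^2}6-J_2-J_1^2\Big).$$ Moreover, if $g$ is any column of a factor $G_i$, then $\log(g^\dagger\Sigma g)^{1/2}$ is square integrable and its variance is exactly $\frac14\big(\frac{\pi^2}6-J_2-J_1^2\big)$. Finally, with $\chi_{x\in(0,1)}$ equal to $1$ for $x\in(0,1)$ and to $0$ otherwise, $$J_1=\int_0^\infty\Big(\chi_{x\in(0,1)}-\prod_{i=1}^d\Big(1+\frac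 x{y_i}\Big)^{-\beta/2}\Big)\frac{dx}x,$$ $$J_2=2\int_0^\infty\Big(\chi_{x\in(0,1)}-\prod_{i=1}^d\Big(1+\frac x{y_i}\Big)^{-\beta/2}\Big)\frac{\log x}x\,dx+\frac{\pi^2}3,$$ where both integrals converge absolutely. -/

import Mathlib

open MeasureTheory ProbabilityTheory Filter Topology
open scoped Matrix NNReal

noncomputable section

/-- The three Gaussian symmetry classes: real, complex and real quaternion entries. -/
inductive GaussClass where
  | real
  | complex
  | quaternion

namespace GaussClass

/-- The index `β = 1, 2, 4`. -/
def beta : GaussClass → ℕ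
  | real => 1
  | complex => 2
  | quaternion => 4

/-- The scalars `ℝ`, `ℂ`, `ℍ` of the class. -/
def Scalar : GaussClass → Type
  | real => ℝ
  | complex => ℂ
  | quaternion => Quaternion ℝ

instance (b : GaussClass) : Ring b.Scalar :=
  match b with
  | real => inferInstanceAs (Ring ℝ)
  | complex => inferInstanceAs (Ring ℂ)
  | quaternion => inferInstanceAs (Ring (Quaternion ℝ))

/-- The star operation is the usual conjugation of `ℝ` (trivial), `ℂ` and `ℍ`. -/
instance (b : GaussClass) : StarRing b.Scalar :=
  match b with
  | real => inferInstanceAs (StarRing ℝ)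
  | complex => inferInstanceAs (StarRing ℂ)
  | quaternion => inferInstanceAs (StarRing (Quaternion ℝ))

instance (b : GaussClass) : Algebra ℝ b.Scalar :=
  match b with
  | real => inferInstanceAs (Algebra ℝ ℝ)
  | complex => inferInstanceAs (Algebra ℝ ℂ)
  | quaternion => inferInstanceAs (Algebra ℝ (Quaternion ℝ))

/-- The real part of a scalar. -/
def re : (b : GaussClass) → b.Scalar → ℝ
  | real => fun x : ℝ => x
  | complex => fun z : ℂ => z.re
  | quaternion => fun q : Quaternion ℝ => q.re

/-- The scalar with given real components: `c₀`, `c₀ + c₁ i`, or `c₀ + c₁ i + c₂ j + c₃ k`. -/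
def ofComponents : (b : GaussClass) → (Fin b.beta → ℝ) → b.Scalar
  | real => fun c : Fin 1 → ℝ => c 0
  | complex => fun c : Fin 2 → ℝ => (⟨c 0, c 1⟩ : ℂ)
  | quaternion => fun c : Fin 4 → ℝ => (⟨c 0, c 1, c 2, c 3⟩ : Quaternion ℝ)

variable {b : GaussClass} {d : ℕ}

/-- The quadratic form `v† M v` (its real part; for Hermitian `M` the value is real). -/
def quadForm (M : Matrix (Fin d) (Fin d) b.Scalar) (v : Fin d → b.Scalar) : ℝ :=
  b.re (star v ⬝ᵥ (M *ᵥ v))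

/-- Positive definite matrices with entries in `ℝ`, `ℂ` or `ℍ`. -/
def PosDef (M : Matrix (Fin d) (Fin d) b.Scalar) : Prop :=
  M.IsHermitian ∧ ∀ v : Fin d → b.Scalar, v ≠ 0 → 0 < quadForm M v

/-- The eigenspace `{v | M v = t v}` for a real number `t`, as a real vector space. -/
def eigenspace (M : Matrix (Fin d) (Fin d) b.Scalar) (t : ℝ) :
    Submodule ℝ (Fin d → b.Scalar) where
  carrier := {v | M *ᵥ v = t • v}
  add_mem' := by
    intro v w hv hw
    simp only [Set.mem_ofPred_eq] at *
    rw [Matrix.mulVec_add, hv, hw, smul_add]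
  zero_mem' := by simp
  smul_mem' := by
    intro c v hv
    simp only [Set.mem_ofPred_eq] at *
    rw [Matrix.mulVec_smul, hv, smul_comm]

/-- `y` lists the eigenvalues, with multiplicity, of the Hermitian matrix `M`: every real `t` has
multiplicity `#{i | y i = t}`, which is the dimension of its eigenspace over the scalars, that is,
the real dimension divided by `β`. (All eigenvalues of a Hermitian matrix are real.) -/
def HasEigenvalues (M : Matrix (Fin d) (Fin d) b.Scalar) (y : Fin d → ℝ) : Prop :=
  ∀ t : ℝ, Module.finrank ℝ (eigenspace M t) = b.beta * Nat.card {i : Fin d // y i = t}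

/-- The largest real eigenvalue of `M`. -/
def maxEigenvalue (M : Matrix (Fin d) (Fin d) b.Scalar) : ℝ :=
  sSup {t : ℝ | ∃ v : Fin d → b.Scalar, v ≠ 0 ∧ M *ᵥ v = t • v}

variable {Ω : Type*}

/-- The matrix `Gₙ` with real components `g (n, i, j, c)`. -/
def gaussMatrix (g : ℕ × Fin d × Fin d × Fin b.beta → Ω → ℝ) (n : ℕ) (ω : Ω) :
    Matrix (Fin d) (Fin d) b.Scalar :=
  Matrix.of fun i j => b.ofComponents fun c => g (n, i, j, c) ω

/-- The product `P_N = A_N ⋯ A_1` with factors `A = S G` (indices shifted by one). -/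
def prodMatrix (S : Matrix (Fin d) (Fin d) b.Scalar)
    (g : ℕ × Fin d × Fin d × Fin b.beta → Ω → ℝ) : ℕ → Ω → Matrix (Fin d) (Fin d) b.Scalar
  | 0, _ => 1
  | N + 1, ω => (S * gaussMatrix g N ω) * prodMatrix S g N ω

/-- The largest finite-`N` Lyapunov exponent `μ₁`: the largest eigenvalue of `P_N† P_N`
is `exp (2 N μ₁)`. -/
def lyapunov₁ (S : Matrix (Fin d) (Fin d) b.Scalar)
    (g : ℕ × Fin d × Fin d × Fin b.beta → Ω → ℝ) (N : ℕ) (ω : Ω) : ℝ :=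
  1 / (2 * (N : ℝ)) * Real.log (maxEigenvalue ((prodMatrix S g N ω)ᴴ * prodMatrix S g N ω))

/-- The family `g` consists of independent real Gaussians of mean `0` and variance `1 / β`.
Equivalently, the `Gₙ` are independent with density proportional to `exp (-(β / 2) Tr G† G)`. -/
def IsStandardGaussian [MeasurableSpace Ω] (P : Measure Ω)
    (g : ℕ × Fin d × Fin d × Fin b.beta → Ω → ℝ) : Prop :=
  iIndepFun g P ∧ ∀ k, HasLaw (g k) (gaussianReal 0 (1 / (b.beta : ℝ≥0))) P

end GaussClass

/-- The integrand `(log z)ᵖ ∏ (1 - z / yᵢ) ^ (-β / 2) / z`, with principal branches. -/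
def keyholeIntegrand (β : ℕ) {d : ℕ} (y : Fin d → ℝ) (p : ℕ) (z : ℂ) : ℂ :=
  Complex.log z ^ p * (∏ i, (1 - z / (y i : ℂ)) ^ (-(β : ℂ) / 2)) / z

/-- `(2 π i)⁻¹` times the integral of the integrand along the contour that starts at `R`, runs to
the left at height `η` above the real axis as far as `ε`, crosses the axis there, and returns to
`R` at height `η` below the axis (the boundary of `[ε, R] × [-η, η]`, anticlockwise). -/
def keyholeIntegral (β : ℕ) {d : ℕ} (y : Fin d → ℝ) (p : ℕ) (ε η R : ℝ) : ℂ :=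
  1 / (2 * (Real.pi : ℂ) * Complex.I) *
    (Complex.I * (∫ t in (0 : ℝ)..η, keyholeIntegrand β y p (R + t * Complex.I))
      - (∫ x in ε..R, keyholeIntegrand β y p (x + η * Complex.I))
      - Complex.I * (∫ t in (-η)..η, keyholeIntegrand β y p (ε + t * Complex.I))
      + (∫ x in ε..R, keyholeIntegrand β y p (x - η * Complex.I))
      + Complex.I * (∫ t in (-η)..(0 : ℝ), keyholeIntegrand β y p (R + t * Complex.I)))

/-- The function `χ_{x ∈ (0,1)} - ∏ (1 + x / yᵢ) ^ (-β / 2)`. -/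
def cutoffDiff (β : ℕ) {d : ℕ} (y : Fin d → ℝ) (x : ℝ) : ℝ :=
  (Set.Ioo (0 : ℝ) 1).indicator 1 x - ∏ i, (1 + x / y i) ^ (-(β : ℝ) / 2)

end

/-! Reduction to one Gaussian vector. Regard matrices as operators on the real Euclidean space of
dimension `β d` (`toOp`); the largest eigenvalue of `P† P` is then a squared operator norm. A
standard Gaussian matrix sends every unit vector to a standard Gaussian vector
(`isGaussianOp_arrayOp`). Hence along the orbit of a fixed unit vector `e` the increments of `log
‖P_N e‖` are copies of `log ‖S x‖`, `x` Gaussian, each independent of the past, and the variance of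
`log ‖P_N e‖` is exactly `N` times that of `log ‖S x‖` (`variance_log_orbit`).

The operator norm is not far from the orbit. Write `P_N = M G` with `G` the first factor and `M`
independent of it. Then `‖P_N‖ ≤ ‖M‖ ‖G‖`, while `‖P_N e‖ ≥ ‖M‖ |⟨u, G e⟩| / 2` for a unit vector
`u` depending only on `M`, and `⟨u, G e⟩` is a scalar Gaussian whatever `M` is. So the two
logarithms differ by an amount bounded in mean square uniformly in `N`
(`exists_bound_log_norm_sub_orbit`), which does not affect the limit (`tendsto_variance_div`).

The variance of one increment. In an eigenbasis of the inverse covariance, `‖S x‖ ^ 2` is, up to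
scale, a variable `X` with Laplace transform `∏ (1 + x / yᵢ) ^ (-β / 2)`. A Mellin transform gives
`Γ(1 + s) E[X ^ (-s)] = 1 - s F(s)` for small `s > 0`, where `F` is the Mellin transform of
`cutoffDiff`. Comparing one-sided expansions to second order, with the Gamma coefficients tied by
the reflection formula, yields the variance of `log X` through the two real integrals
(`variance_log_of_laplace`).

The contour integrals. Conjugation symmetry reduces the keyhole integral to the imaginary part of
its upper half. The integral over a full horizontal line vanishes, so the contour can be swung from
the right to the left end of the line and lowered onto the negative axis, where `log z = log t + π
i` (`tendsto_keyholeIntegral`, `keyholeValue_one`, `keyholeValue_two`). For `β d` even, the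
integrand continued from above is real on the axis beyond all `yᵢ`, so the tail adds nothing
(`keyholeIntegral_eq_of_even`). -/

/-! ### One-sided second-order Taylor expansions -/

/-- Right-sided second-order Taylor expansion at the origin. -/
def HasTaylorTwo (f : ℝ → ℝ) (a b c : ℝ) : Prop :=
  (fun s => f s - (a + b * s + c * s ^ 2)) =o[𝓝[>] 0] (fun s => s ^ 2)

namespace HasTaylorTwo

variable {f g : ℝ → ℝ} {a b c a' b' c' : ℝ}

lemma congr (hf : HasTaylorTwo f a b c) (h : f =ᶠ[𝓝[>] 0] g) : HasTaylorTwo g a b c :=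
  Asymptotics.IsLittleO.congr' hf (h.mono fun s hs => by simp only [hs]) EventuallyEq.rfl

lemma of_isBigO (h : (fun s => f s - (a + b * s + c * s ^ 2)) =O[𝓝[>] 0] fun s => s ^ 3) :
    HasTaylorTwo f a b c := by
  refine h.trans_isLittleO ?_
  exact ((Asymptotics.isLittleO_pow_pow (𝕜 := ℝ) (by norm_num : 2 < 3))).mono nhdsWithin_le_nhds

lemma unique (hf : HasTaylorTwo f a b c) (hg : HasTaylorTwo f a' b' c') :
    a = a' ∧ b = b' ∧ c = c' := by
  have h : (fun s : ℝ => (a' - a) + (b' - b) * s + (c' - c) * s ^ 2) =o[𝓝[>] 0]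
      (fun s => s ^ 2) := by
    refine (Asymptotics.IsLittleO.sub hf hg).congr_left fun s => by ring
  have id0 : Tendsto (fun s : ℝ => s) (𝓝[>] 0) (𝓝 0) :=
    tendsto_nhdsWithin_of_tendsto_nhds tendsto_id
  have ha : a' - a = 0 := by
    have h1 : Tendsto (fun s : ℝ => (a' - a) + (b' - b) * s + (c' - c) * s ^ 2) (𝓝[>] 0) (𝓝 0) :=
      h.trans_tendsto (by simpa using id0.pow 2)
    have h2 : Tendsto (fun s : ℝ => (a' - a) + (b' - b) * s + (c' - c) * s ^ 2) (𝓝[>] 0)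
        (𝓝 ((a' - a) + (b' - b) * 0 + (c' - c) * 0 ^ 2)) :=
      (tendsto_const_nhds.add (id0.const_mul _)).add ((id0.pow 2).const_mul _)
    have := tendsto_nhds_unique h1 h2
    simp at this; linarith
  have hb : b' - b = 0 := by
    have h1 : Tendsto (fun s : ℝ => (b' - b) + (c' - c) * s) (𝓝[>] 0) (𝓝 0) := by
      have h3 : Tendsto (fun s : ℝ => s * (((a' - a) + (b' - b) * s + (c' - c) * s ^ 2) / s ^ 2))
          (𝓝[>] 0) (𝓝 (0 * 0)) := id0.mul h.tendsto_div_nhds_zero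
      rw [mul_zero] at h3
      refine h3.congr' ?_
      filter_upwards [self_mem_nhdsWithin] with s hs
      have : s ≠ 0 := ne_of_gt hs
      rw [ha]; field_simp; ring
    have h2 : Tendsto (fun s : ℝ => (b' - b) + (c' - c) * s) (𝓝[>] 0)
        (𝓝 ((b' - b) + (c' - c) * 0)) := tendsto_const_nhds.add (id0.const_mul _)
    have := tendsto_nhds_unique h1 h2
    simp at this; linarith
  have hc : c' - c = 0 := by
    have h1 : Tendsto (fun _ : ℝ => c' - c) (𝓝[>] (0 : ℝ)) (𝓝 0) := by
      refine h.tendsto_div_nhds_zero.congr' ?_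
      filter_upwards [self_mem_nhdsWithin] with s hs
      have : s ≠ 0 := ne_of_gt hs
      rw [ha, hb]; field_simp; ring
    exact tendsto_nhds_unique tendsto_const_nhds h1
  exact ⟨by linarith, by linarith, by linarith⟩

lemma mul (hf : HasTaylorTwo f a b c) (hg : HasTaylorTwo g a' b' c') :
    HasTaylorTwo (fun s => f s * g s) (a * a') (a * b' + b * a') (a * c' + b * b' + c * a') := by
  have id0 : Tendsto (fun s : ℝ => s) (𝓝[>] 0) (𝓝 0) :=
    tendsto_nhdsWithin_of_tendsto_nhds tendsto_id
  have hp : ∀ x y z : ℝ, (fun s : ℝ => x + y * s + z * s ^ 2) =O[𝓝[>] 0] (fun _ => (1 : ℝ)) := by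
    intro x y z
    have h2 : Tendsto (fun s : ℝ => x + y * s + z * s ^ 2) (𝓝[>] 0) (𝓝 (x + y * 0 + z * 0 ^ 2)) :=
      (tendsto_const_nhds.add (id0.const_mul _)).add ((id0.pow 2).const_mul _)
    exact h2.isBigO_one ℝ
  have hg1 : g =O[𝓝[>] 0] (fun _ => (1 : ℝ)) := by
    have h3 : (fun s : ℝ => s ^ 2) =O[𝓝[>] 0] (fun _ => (1 : ℝ)) := by
      simpa using hp 0 0 1
    have := (hg.isBigO.trans h3).add (hp a' b' c')
    exact this.congr_left fun s => by ring
  have h1 := Asymptotics.IsLittleO.mul_isBigO hf hg1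
  have h2 := (hp a b c).mul_isLittleO hg
  -- These are the cubic and quartic terms of the product of the two Taylor polynomials.
  have h3 : (fun s : ℝ => (b * c' + c * b') * s ^ 3 + c * c' * s ^ 4) =o[𝓝[>] 0]
      (fun s => s ^ 2) := by
    refine Asymptotics.IsLittleO.add ?_ ?_
    · exact ((Asymptotics.isLittleO_pow_pow (𝕜 := ℝ) (by norm_num : 2 < 3)).const_mul_left _).mono
        nhdsWithin_le_nhds
    · exact ((Asymptotics.isLittleO_pow_pow (𝕜 := ℝ) (by norm_num : 2 < 4)).const_mul_left _).mono
        nhdsWithin_le_nhds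
  simp only [mul_one, one_mul] at h1 h2
  refine ((h1.add h2).add h3).congr_left fun s => by ring

end HasTaylorTwo

/-- Both signs are needed because the reflection formula pairs `Γ(1 + s)` with `Γ(1 - s)`. -/
lemma HasFPowerSeriesAt.hasTaylorTwo {f : ℝ → ℝ} {p : FormalMultilinearSeries ℝ ℝ ℝ} {x : ℝ}
    (h : HasFPowerSeriesAt f p x) :
    HasTaylorTwo (fun s => f (x + s)) (p.coeff 0) (p.coeff 1) (p.coeff 2) ∧
      HasTaylorTwo (fun s => f (x - s)) (p.coeff 0) (-p.coeff 1) (p.coeff 2) := by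
  have h3 := h.isBigO_sub_partialSum_pow 3
  have hps : ∀ y : ℝ, p.partialSum 3 y = p.coeff 0 + p.coeff 1 * y + p.coeff 2 * y ^ 2 := by
    intro y
    simp [FormalMultilinearSeries.partialSum, Finset.sum_range_succ]
    ring
  simp only [hps, ← norm_pow] at h3
  rw [Asymptotics.isBigO_norm_right] at h3
  constructor
  · exact HasTaylorTwo.of_isBigO (h3.mono nhdsWithin_le_nhds)
  · refine HasTaylorTwo.of_isBigO ?_
    have hneg : Tendsto (fun s : ℝ => -s) (𝓝[>] 0) (𝓝 0) := by
      have : Tendsto (fun s : ℝ => -s) (𝓝 0) (𝓝 (-0)) := tendsto_id.neg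
      rw [neg_zero] at this
      exact this.mono_left nhdsWithin_le_nhds
    have h4 := h3.comp_tendsto hneg
    have h5 : (fun s : ℝ => (-s) ^ 3) =O[𝓝[>] 0] fun s : ℝ => s ^ 3 := by
      refine Asymptotics.isBigO_of_le _ fun s => by simp
    refine (h4.trans h5).congr_left fun s => ?_
    simp only [Function.comp]
    ring_nf

/-! ### The Gamma function near 1 -/

lemma Real.analyticAt_Gamma_one : AnalyticAt ℝ Real.Gamma 1 := by
  have h : AnalyticAt ℂ Complex.Gamma ((1 : ℝ) : ℂ) := by
    rw [Complex.analyticAt_iff_eventually_differentiableAt]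
    have : ∀ᶠ z : ℂ in 𝓝 ((1 : ℝ) : ℂ), 0 < z.re :=
      (Complex.continuous_re.isOpen_preimage _ isOpen_Ioi).mem_nhds (by simp)
    filter_upwards [this] with z hz
    refine Complex.differentiableAt_Gamma z fun m hm => ?_
    rw [hm] at hz; simp at hz
    exact absurd hz (not_lt.mpr (by positivity))
  have := h.re_ofReal
  refine this.congr (Eventually.of_forall fun x => ?_)
  simp [Complex.Gamma_ofReal]

lemma hasTaylorTwo_sinc_pi :
    HasTaylorTwo (fun s => Real.sin (Real.pi * s) / (Real.pi * s)) 1 0 (-(Real.pi ^ 2 / 6)) := by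
  refine HasTaylorTwo.of_isBigO ?_
  -- The quintic remainder of the sine, divided by `π s`, is `π ^ 4 s ^ 4 / 100`; one factor `s ≤ 1`
  -- is dropped.
  refine Asymptotics.IsBigO.of_bound (Real.pi ^ 4 / 100) ?_
  have : ∀ᶠ s : ℝ in 𝓝[>] 0, s < 1 / Real.pi :=
    nhdsWithin_le_nhds (Iio_mem_nhds (by positivity))
  filter_upwards [this, self_mem_nhdsWithin] with s hs hs0
  have hs0 : 0 < s := hs0
  have hpi := Real.pi_pos
  have h1 : Real.pi * s ≤ 1 := by
    rw [lt_div_iff₀ hpi] at hs; linarith [mul_comm s Real.pi]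
  have h0 : 0 < Real.pi * s := by positivity
  have hb := Real.sin_bound (x := Real.pi * s) (by rw [abs_of_pos h0]; exact h1)
  have e : Real.sin (Real.pi * s) / (Real.pi * s) - (1 + 0 * s + -(Real.pi ^ 2 / 6) * s ^ 2)
      = (Real.sin (Real.pi * s) - (Real.pi * s - (Real.pi * s) ^ 3 / 6)) / (Real.pi * s) := by
    field_simp; ring
  rw [e, norm_div, Real.norm_eq_abs, Real.norm_eq_abs, abs_of_pos h0, div_le_iff₀ h0]
  refine hb.trans ?_
  rw [abs_of_pos h0, Real.norm_eq_abs, abs_of_pos (by positivity : 0 < s ^ 3)]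
  have : (Real.pi * s) ^ 5 / 100 = Real.pi ^ 4 / 100 * s ^ 3 * (Real.pi * s) * s := by ring
  rw [this]
  have hs1 : s ≤ 1 := by nlinarith [Real.pi_gt_three]
  exact mul_le_of_le_one_right (by positivity) hs1

/-- Second order expansion of `Γ (1 + s)`; the coefficients are tied by the reflection formula. -/
lemma exists_hasTaylorTwo_Gamma : ∃ g₁ g₂ : ℝ,
    HasTaylorTwo (fun s => Real.Gamma (1 + s)) 1 g₁ g₂ ∧ 2 * g₂ - g₁ ^ 2 = Real.pi ^ 2 / 6 := by
  obtain ⟨p, hp⟩ := Real.analyticAt_Gamma_one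
  obtain ⟨h1, h2⟩ := hp.hasTaylorTwo
  have h0 : p.coeff 0 = 1 := by
    rw [← Real.Gamma_one]; exact hp.coeff_zero _
  rw [h0] at h1 h2
  refine ⟨_, _, h1, ?_⟩
  -- The product `Γ(1 + s) Γ(1 - s) sin(π s) / (π s)` is constantly 1, so its second coefficient `2
  -- g₂ - g₁ ^ 2 - π ^ 2 / 6` vanishes.
  have h3 := (h1.mul h2).mul hasTaylorTwo_sinc_pi
  have h4 : HasTaylorTwo (fun _ => 1) 1 0 0 := by
    unfold HasTaylorTwo; simp
  have h5 : (fun s => Real.Gamma (1 + s) * Real.Gamma (1 - s) *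
      (Real.sin (Real.pi * s) / (Real.pi * s))) =ᶠ[𝓝[>] 0] fun _ => 1 := by
    have : ∀ᶠ s : ℝ in 𝓝[>] 0, s < 1 := nhdsWithin_le_nhds (Iio_mem_nhds one_pos)
    filter_upwards [this, self_mem_nhdsWithin] with s hs hs0
    have hs0 : 0 < s := hs0
    have hsin : 0 < Real.sin (Real.pi * s) :=
      Real.sin_pos_of_pos_of_lt_pi (by positivity) (by nlinarith [Real.pi_pos])
    rw [add_comm 1 s, Real.Gamma_add_one hs0.ne', mul_assoc s, Real.Gamma_mul_Gamma_one_sub]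
    field_simp
    rw [mul_comm s Real.pi]
    exact div_self hsin.ne'
  have := (h3.congr h5).unique h4
  linarith [this.2.2]

/-! ### Behaviour of the cutoff difference at zero and infinity -/

section cutoff

variable {β d : ℕ} {y : Fin d → ℝ}

lemma prod_one_add_div_rpow_nonneg (hy : ∀ i, 0 < y i) {x : ℝ} (hx : 0 ≤ x) :
    0 ≤ ∏ i, (1 + x / y i) ^ (-(β : ℝ) / 2) :=
  Finset.prod_nonneg fun i _ => Real.rpow_nonneg (by have := hy i; positivity) _

/-- All factors are at most 1, so a single one supplies the decay, and `β ≥ 1` makes the exponent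
`-1/2` available in every class. This decay sets the right end `s < 1/2` of the Mellin strip. -/
lemma prod_one_add_div_rpow_le (hβ : 1 ≤ β) (hy : ∀ i, 0 < y i) (i : Fin d) {x : ℝ} (hx : 0 < x) :
    ∏ j, (1 + x / y j) ^ (-(β : ℝ) / 2) ≤ y i ^ (1 / 2 : ℝ) * x ^ (-(1 / 2) : ℝ) := by
  have hβ' : (1 : ℝ) ≤ β := by exact_mod_cast hβ
  have h1 : ∏ j, (1 + x / y j) ^ (-(β : ℝ) / 2) ≤ (1 + x / y i) ^ (-(β : ℝ) / 2) := by
    rw [← Finset.mul_prod_erase _ _ (Finset.mem_univ i)]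
    refine mul_le_of_le_one_right (Real.rpow_nonneg (by have := hy i; positivity) _) ?_
    refine Finset.prod_le_one (fun j _ => Real.rpow_nonneg (by have := hy j; positivity) _)
      fun j _ => ?_
    refine Real.rpow_le_one_of_one_le_of_nonpos ?_ (by linarith)
    have := hy j
    have : 0 < x / y j := by positivity
    linarith
  refine h1.trans ?_
  have hxy : 0 < x / y i := div_pos hx (hy i)
  calc (1 + x / y i) ^ (-(β : ℝ) / 2) ≤ (1 + x / y i) ^ (-(1 / 2) : ℝ) :=
        Real.rpow_le_rpow_of_exponent_le (by linarith) (by linarith)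
    _ ≤ (x / y i) ^ (-(1 / 2) : ℝ) :=
        Real.rpow_le_rpow_of_nonpos hxy (by linarith) (by norm_num)
    _ = y i ^ (1 / 2 : ℝ) * x ^ (-(1 / 2) : ℝ) := by
        rw [Real.div_rpow hx.le (hy i).le, Real.rpow_neg (hy i).le, div_inv_eq_mul, mul_comm]

lemma continuousOn_prod_one_add_div_rpow (hy : ∀ i, 0 < y i) :
    ContinuousOn (fun x : ℝ => ∏ i, (1 + x / y i) ^ (-(β : ℝ) / 2)) (Set.Ici 0) := by
  refine continuousOn_finsetProd _ fun i _ => ?_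
  refine ContinuousOn.rpow_const (by fun_prop) fun x hx => Or.inl ?_
  have := hy i
  have hx : 0 ≤ x := hx
  positivity

lemma locallyIntegrableOn_cutoffDiff (hy : ∀ i, 0 < y i) :
    LocallyIntegrableOn (cutoffDiff β y) (Set.Ioi 0) := by
  refine LocallyIntegrableOn.sub ?_ ?_
  · have : Integrable ((Set.Ioo (0 : ℝ) 1).indicator (1 : ℝ → ℝ)) volume := by
      rw [integrable_indicator_iff measurableSet_Ioo]
      exact integrableOn_const (by simp)
    exact this.locallyIntegrable.locallyIntegrableOn _
  · exact ((continuousOn_prod_one_add_div_rpow hy).mono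
      Set.Ioi_subset_Ici_self).locallyIntegrableOn measurableSet_Ioi

lemma cutoffDiff_isBigO_atTop (hβ : 1 ≤ β) (hd : 1 ≤ d) (hy : ∀ i, 0 < y i) :
    cutoffDiff β y =O[atTop] fun x : ℝ => x ^ (-(1 / 2) : ℝ) := by
  refine Asymptotics.IsBigO.of_bound (y ⟨0, hd⟩ ^ (1 / 2 : ℝ)) ?_
  filter_upwards [eventually_ge_atTop 1] with x hx
  have h0 : (0 : ℝ) < x := by linarith
  rw [cutoffDiff, Set.indicator_of_notMem (by simp [hx]), zero_sub, norm_neg, Real.norm_eq_abs,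
    Real.norm_eq_abs, abs_of_nonneg (prod_one_add_div_rpow_nonneg hy h0.le),
    abs_of_nonneg (Real.rpow_nonneg h0.le _)]
  exact prod_one_add_div_rpow_le hβ hy _ h0

/-- The product is differentiable at 0 with value 1 there, which the indicator cancels. This pushes
the left end of the Mellin strip to `-1`, so that the strip contains 0. -/
lemma cutoffDiff_isBigO_zero :
    cutoffDiff β y =O[𝓝[>] 0] fun x : ℝ => x ^ (-(-1) : ℝ) := by
  have h1 : DifferentiableAt ℝ (fun x : ℝ => ∏ i, (1 + x / y i) ^ (-(β : ℝ) / 2)) 0 := by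
    refine DifferentiableAt.fun_finsetProd fun i _ => ?_
    exact DifferentiableAt.rpow_const (by fun_prop) (Or.inl (by simp))
  have h2 := (h1.isBigO_sub.mono (nhdsWithin_le_nhds (s := Set.Ioi 0))).neg_left
  refine h2.congr' ?_ ?_
  · filter_upwards [Ioo_mem_nhdsGT (one_pos (α := ℝ))] with x hx
    rw [cutoffDiff, Set.indicator_of_mem hx]
    simp
  · filter_upwards with x
    simp

end cutoff

/-! ### The Mellin transform of the cutoff difference -/

/-- The real Mellin-type integral `∫ x ^ (s - 1) * f x`. -/
noncomputable def cutoffMellin (β : ℕ) {d : ℕ} (y : Fin d → ℝ) (s : ℝ) : ℝ :=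
  (mellin (fun x => (cutoffDiff β y x : ℂ)) (s : ℂ)).re

section mellin

variable {β d : ℕ} {y : Fin d → ℝ}

lemma mellin_ofReal_eq (f : ℝ → ℝ) (s : ℝ) :
    mellin (fun x => (f x : ℂ)) (s : ℂ) =
      ((∫ x in Set.Ioi (0 : ℝ), x ^ (s - 1) * f x : ℝ) : ℂ) := by
  rw [mellin, ← integral_complex_ofReal]
  refine setIntegral_congr_fun measurableSet_Ioi fun x hx => ?_
  have hx : 0 < x := hx
  simp only [smul_eq_mul]
  rw [Complex.ofReal_mul, Complex.ofReal_cpow hx.le]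
  push_cast; rfl

lemma integrableOn_of_mellinConvergent {f : ℝ → ℝ} {s : ℝ}
    (h : MellinConvergent (fun x => (f x : ℂ)) (s : ℂ)) :
    IntegrableOn (fun x => x ^ (s - 1) * f x) (Set.Ioi 0) := by
  have h2 : IntegrableOn (fun x : ℝ => ((x : ℂ) ^ ((s : ℂ) - 1) • (f x : ℂ)).re) (Set.Ioi 0) :=
    Integrable.re h
  refine h2.congr_fun (fun x hx => ?_) measurableSet_Ioi
  have hx : 0 < x := hx
  have : (x : ℂ) ^ ((s : ℂ) - 1) = ((x ^ (s - 1) : ℝ) : ℂ) := by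
    rw [Complex.ofReal_cpow hx.le]; push_cast; rfl
  simp only [this, smul_eq_mul, ← Complex.ofReal_mul, Complex.ofReal_re]

/-- The bounds `O(x)` at 0 and `O(x ^ (-1/2))` at infinity give holomorphy in the strip;
differentiating under the integral inserts the logarithm. -/
lemma cutoffDiff_mellin_facts (hβ : 1 ≤ β) (hd : 1 ≤ d) (hy : ∀ i, 0 < y i) {s : ℝ} (hs1 : -1 < s)
    (hs2 : s < 1 / 2) :
    MellinConvergent (fun x => (cutoffDiff β y x : ℂ)) (s : ℂ) ∧
    MellinConvergent (fun x => ((Real.log x * cutoffDiff β y x : ℝ) : ℂ)) (s : ℂ) ∧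
      HasDerivAt (cutoffMellin β y)
        (∫ x in Set.Ioi (0 : ℝ), x ^ (s - 1) * (Real.log x * cutoffDiff β y x)) s := by
  have hloc : LocallyIntegrableOn (fun x => (cutoffDiff β y x : ℂ)) (Set.Ioi 0) := by
    intro x hx
    obtain ⟨t, ht, h⟩ := locallyIntegrableOn_cutoffDiff (β := β) hy x hx
    exact ⟨t, ht, h.ofReal⟩
  have htop : (fun x => (cutoffDiff β y x : ℂ)) =O[atTop] fun x : ℝ => x ^ (-(1 / 2) : ℝ) := by
    refine (cutoffDiff_isBigO_atTop hβ hd hy).norm_left.congr_left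
      (fun x => ?_) |>.of_norm_left
    simp
  have hbot : (fun x => (cutoffDiff β y x : ℂ)) =O[𝓝[>] 0] fun x : ℝ => x ^ (-(-1) : ℝ) := by
    refine (cutoffDiff_isBigO_zero (β := β) (y := y)).norm_left.congr_left
      (fun x => ?_) |>.of_norm_left
    simp
  refine ⟨mellinConvergent_of_isBigO_rpow hloc htop (by simpa using hs2) hbot
    (by simpa using hs1), ?_⟩
  obtain ⟨h1, h2⟩ := mellin_hasDerivAt_of_isBigO_rpow (s := (s : ℂ)) hloc htop
    (by simpa using hs2) hbot (by simpa using hs1)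
  have e : (fun x : ℝ => Real.log x • (cutoffDiff β y x : ℂ)) =
      fun x => ((Real.log x * cutoffDiff β y x : ℝ) : ℂ) := by
    funext x; simp
  rw [e] at h1 h2
  refine ⟨h1, ?_⟩
  rw [mellin_ofReal_eq] at h2
  have := h2.real_of_complex
  simp only [Complex.ofReal_re] at this
  exact this

lemma integrableOn_cutoffDiff_div (hβ : 1 ≤ β) (hd : 1 ≤ d) (hy : ∀ i, 0 < y i) :
    IntegrableOn (fun x => cutoffDiff β y x / x) (Set.Ioi 0) := by
  refine (integrableOn_of_mellinConvergent
    (cutoffDiff_mellin_facts (s := 0) hβ hd hy (by norm_num) (by norm_num)).1).congr_fun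
    (fun x hx => ?_) measurableSet_Ioi
  simp only [zero_sub, Real.rpow_neg_one]; rw [div_eq_inv_mul]

lemma integrableOn_cutoffDiff_mul_log_div (hβ : 1 ≤ β) (hd : 1 ≤ d) (hy : ∀ i, 0 < y i) :
    IntegrableOn (fun x => cutoffDiff β y x * (Real.log x / x)) (Set.Ioi 0) := by
  refine (integrableOn_of_mellinConvergent
    (cutoffDiff_mellin_facts (s := 0) hβ hd hy (by norm_num) (by norm_num)).2.1).congr_fun
    (fun x hx => ?_) measurableSet_Ioi
  simp only [zero_sub, Real.rpow_neg_one]; rw [div_eq_inv_mul]; ring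

/-- The factor `s` turns a first derivative of the transform at 0 into a second-order expansion. -/
lemma hasTaylorTwo_one_sub_mul_cutoffMellin (hβ : 1 ≤ β) (hd : 1 ≤ d) (hy : ∀ i, 0 < y i) :
    HasTaylorTwo (fun s => 1 - s * cutoffMellin β y s) 1
      (-∫ x in Set.Ioi (0 : ℝ), cutoffDiff β y x / x)
      (-∫ x in Set.Ioi (0 : ℝ), cutoffDiff β y x * (Real.log x / x)) := by
  have h := (cutoffDiff_mellin_facts (s := 0) hβ hd hy (by norm_num) (by norm_num)).2.2
  have e0 : cutoffMellin β y 0 = ∫ x in Set.Ioi (0 : ℝ), cutoffDiff β y x / x := by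
    rw [cutoffMellin, mellin_ofReal_eq, Complex.ofReal_re]
    congr 1; funext x
    simp only [zero_sub, Real.rpow_neg_one]; rw [div_eq_inv_mul]
  have e1 : (∫ x in Set.Ioi (0 : ℝ), x ^ ((0 : ℝ) - 1) * (Real.log x * cutoffDiff β y x)) =
      ∫ x in Set.Ioi (0 : ℝ), cutoffDiff β y x * (Real.log x / x) := by
    congr 1; funext x
    simp only [zero_sub, Real.rpow_neg_one]; rw [div_eq_inv_mul]; ring
  rw [e1] at h
  rw [hasDerivAt_iff_isLittleO, e0] at h
  have h2 := ((Asymptotics.isBigO_refl (fun s : ℝ => s) (𝓝 0)).mul_isLittleO h).neg_left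
  refine (h2.mono nhdsWithin_le_nhds).congr (fun s => ?_) fun s => ?_
  · simp only [sub_zero, smul_eq_mul]; ring
  · simp only [sub_zero]; ring

end mellin

/-! ### Variance of a logarithm from a Laplace transform -/

section laplace

variable {β d : ℕ} {y : Fin d → ℝ} {Ω : Type*} [MeasurableSpace Ω] {P : Measure Ω}
  [IsProbabilityMeasure P] {X : Ω → ℝ}

/-- For `s > 0` the cutoff can be undone: the indicator contributes `∫ x ^ (s - 1)` over `(0,1)`,
which is `1 / s`. -/
lemma integrableOn_rpow_mul_prod (hβ : 1 ≤ β) (hd : 1 ≤ d) (hy : ∀ i, 0 < y i) {s : ℝ}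
    (hs1 : 0 < s) (hs2 : s < 1 / 2) :
    IntegrableOn (fun x => x ^ (s - 1) * ∏ i, (1 + x / y i) ^ (-(β : ℝ) / 2)) (Set.Ioi 0) ∧
      ∫ x in Set.Ioi (0 : ℝ), x ^ (s - 1) * ∏ i, (1 + x / y i) ^ (-(β : ℝ) / 2) =
        1 / s - cutoffMellin β y s := by
  have h1 := integrableOn_of_mellinConvergent
    (cutoffDiff_mellin_facts (s := s) hβ hd hy (by linarith) hs2).1
  have h2 : IntegrableOn (fun x : ℝ => (Set.Ioo (0 : ℝ) 1).indicator (fun x => x ^ (s - 1)) x)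
      (Set.Ioi 0) := by
    refine Integrable.integrableOn ?_
    rw [integrable_indicator_iff measurableSet_Ioo]
    rw [intervalIntegral.integrableOn_Ioo_rpow_iff one_pos]
    linarith
  have e : ∀ x : ℝ, x ^ (s - 1) * ∏ i, (1 + x / y i) ^ (-(β : ℝ) / 2) =
      (Set.Ioo (0 : ℝ) 1).indicator (fun x => x ^ (s - 1)) x - x ^ (s - 1) * cutoffDiff β y x := by
    intro x
    by_cases hx : x ∈ Set.Ioo (0 : ℝ) 1
    · simp only [cutoffDiff, Set.indicator_of_mem hx, Pi.one_apply]; ring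
    · simp only [cutoffDiff, Set.indicator_of_notMem hx]; ring
  simp only [e]
  refine ⟨h2.sub h1, ?_⟩
  rw [integral_sub h2 h1]
  congr 1
  · rw [setIntegral_indicator measurableSet_Ioo,
      Set.inter_eq_self_of_subset_right (fun x hx => hx.1), ← integral_Ioc_eq_integral_Ioo,
      ← intervalIntegral.integral_of_le zero_le_one, integral_rpow (Or.inl (by linarith))]
    rw [sub_add_cancel, Real.zero_rpow hs1.ne']; simp
  · rw [cutoffMellin, mellin_ofReal_eq, Complex.ofReal_re]

/-- Average `Γ(s) X ^ (-s) = ∫ x ^ (s - 1) exp (-X x) dx` over `X` and exchange the integrals.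
Working with lower integrals first makes Tonelli deliver the integrability of `X ^ (-s)` as well. -/
lemma integrable_rpow_neg_of_laplace (hβ : 1 ≤ β) (hd : 1 ≤ d) (hy : ∀ i, 0 < y i)
    (hXm : Measurable X) (hpos : ∀ᵐ ω ∂P, 0 < X ω)
    (hL : ∀ x, 0 < x → ∫ ω, Real.exp (-(X ω * x)) ∂P = ∏ i, (1 + x / y i) ^ (-(β : ℝ) / 2))
    {s : ℝ} (hs1 : 0 < s) (hs2 : s < 1 / 2) :
    Integrable (fun ω => X ω ^ (-s)) P ∧
      Real.Gamma (1 + s) * ∫ ω, X ω ^ (-s) ∂P = 1 - s * cutoffMellin β y s := by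
  obtain ⟨h1, h2⟩ := integrableOn_rpow_mul_prod (β := β) hβ hd hy hs1 hs2
  have hΓ := Real.Gamma_pos_of_pos hs1
  have hswap : ∫⁻ x in Set.Ioi (0 : ℝ),
      ENNReal.ofReal (x ^ (s - 1) * ∏ i, (1 + x / y i) ^ (-(β : ℝ) / 2)) =
        ∫⁻ ω, ENNReal.ofReal (Real.Gamma s * X ω ^ (-s)) ∂P := by
    have e1 : ∀ x ∈ Set.Ioi (0 : ℝ),
        ENNReal.ofReal (x ^ (s - 1) * ∏ i, (1 + x / y i) ^ (-(β : ℝ) / 2)) =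
        ∫⁻ ω, ENNReal.ofReal (x ^ (s - 1) * Real.exp (-(X ω * x))) ∂P := by
      intro x hx
      have hx : 0 < x := hx
      rw [← hL x hx, ← integral_const_mul, ofReal_integral_eq_lintegral_ofReal]
      · refine Integrable.const_mul ?_ _
        refine Integrable.of_bound (by fun_prop) 1 ?_
        filter_upwards [hpos] with ω hω
        rw [Real.norm_eq_abs, abs_of_pos (Real.exp_pos _), Real.exp_le_one_iff]
        have : 0 < X ω * x := by positivity
        linarith
      · filter_upwards with ω
        have := Real.rpow_nonneg hx.le (s - 1)
        positivity
    rw [setLIntegral_congr_fun measurableSet_Ioi e1, lintegral_lintegral_swap]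
    · refine lintegral_congr_ae ?_
      filter_upwards [hpos] with ω hω
      rw [← ofReal_integral_eq_lintegral_ofReal]
      · rw [Real.integral_rpow_mul_exp_neg_mul_Ioi hs1 hω, Real.rpow_neg hω.le, one_div,
          Real.inv_rpow hω.le, mul_comm]
      -- A non-integrable function would have integral 0, but the known value is positive.
      · have := Real.integral_rpow_mul_exp_neg_mul_Ioi hs1 hω
        by_contra hcon
        rw [integral_undef hcon] at this
        have h0 : 0 < (1 / X ω) ^ s * Real.Gamma s := by positivity
        linarith
      · refine (ae_restrict_mem measurableSet_Ioi).mono fun x hx => ?_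
        have := Real.rpow_nonneg (le_of_lt (Set.mem_Ioi.1 hx)) (s - 1)
        simp only [Pi.zero_apply]
        positivity
    · refine Measurable.aemeasurable ?_
      refine ENNReal.measurable_ofReal.comp ?_
      refine Measurable.mul ((measurable_fst).pow_const _) ?_
      exact Real.measurable_exp.comp ((hXm.comp measurable_snd).mul measurable_fst).neg
  have hnn : 0 ≤ᵐ[P] fun ω => Real.Gamma s * X ω ^ (-s) := by
    filter_upwards [hpos] with ω hω
    simp only [Pi.zero_apply]; positivity
  have hmeas : AEStronglyMeasurable (fun ω => Real.Gamma s * X ω ^ (-s)) P :=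
    ((hXm.pow_const _).const_mul _).aestronglyMeasurable
  have hnn1 : 0 ≤ᵐ[volume.restrict (Set.Ioi (0 : ℝ))]
      fun x => x ^ (s - 1) * ∏ i, (1 + x / y i) ^ (-(β : ℝ) / 2) := by
    refine (ae_restrict_mem measurableSet_Ioi).mono fun x hx => ?_
    have hx : 0 < x := hx
    exact mul_nonneg (Real.rpow_nonneg hx.le _) (prod_one_add_div_rpow_nonneg hy hx.le)
  have hint : Integrable (fun ω => Real.Gamma s * X ω ^ (-s)) P := by
    refine ⟨hmeas, ?_⟩
    rw [hasFiniteIntegral_iff_ofReal hnn, ← hswap]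
    exact (hasFiniteIntegral_iff_ofReal hnn1).1 h1.2
  have hint' : Integrable (fun ω => X ω ^ (-s)) P := by
    have := hint.const_mul (Real.Gamma s)⁻¹
    refine this.congr (Eventually.of_forall fun ω => ?_)
    simp only; rw [inv_mul_cancel_left₀ hΓ.ne']
  refine ⟨hint', ?_⟩
  have h3 : ∫ ω, Real.Gamma s * X ω ^ (-s) ∂P = 1 / s - cutoffMellin β y s := by
    rw [integral_eq_lintegral_of_nonneg_ae hnn hmeas, ← hswap,
      ← integral_eq_lintegral_of_nonneg_ae hnn1 h1.1, h2]
  rw [integral_const_mul] at h3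
  rw [add_comm, Real.Gamma_add_one hs1.ne', mul_assoc, h3]
  field_simp

/-- A positive variable with Laplace transform `∏ (1 + x / yᵢ) ^ (-β / 2)` and finite mean has a
logarithm with exponential moments, whose variance is given by the cutoff integrals. -/
theorem variance_log_of_laplace (hβ : 1 ≤ β) (hd : 1 ≤ d) (hy : ∀ i, 0 < y i)
    (hXm : Measurable X) (hpos : ∀ᵐ ω ∂P, 0 < X ω) (hXi : Integrable X P)
    (hL : ∀ x, 0 < x → ∫ ω, Real.exp (-(X ω * x)) ∂P = ∏ i, (1 + x / y i) ^ (-(β : ℝ) / 2)) :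
    MemLp (fun ω => Real.log (X ω)) 2 P ∧
      Var[fun ω => Real.log (X ω); P] =
        -2 * (∫ x in Set.Ioi (0 : ℝ), cutoffDiff β y x * (Real.log x / x))
          - (∫ x in Set.Ioi (0 : ℝ), cutoffDiff β y x / x) ^ 2 - Real.pi ^ 2 / 6 := by
  -- With this sign the moment generating function of `Y` at `s` is `E[X ^ (-s)]`.
  set Y : Ω → ℝ := fun ω => -Real.log (X ω) with hY
  have hexp : ∀ s : ℝ, (fun ω => Real.exp (s * Y ω)) =ᵐ[P] fun ω => X ω ^ (-s) := by
    intro s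
    filter_upwards [hpos] with ω hω
    rw [Real.rpow_def_of_pos hω, hY]; congr 1; ring
  -- The finite mean handles `-1` and the negative moment handles `1/4`; by convexity 0 is interior,
  -- so the moment generating function is analytic there.
  have hmem1 : (-1 : ℝ) ∈ integrableExpSet Y P := by
    refine (integrable_congr (hexp (-1))).2 ?_
    simpa using hXi
  have hmem2 : (1 / 4 : ℝ) ∈ integrableExpSet Y P :=
    (integrable_congr (hexp (1 / 4))).2
      (integrable_rpow_neg_of_laplace hβ hd hy hXm hpos hL (by norm_num) (by norm_num)).1
  have hint : (0 : ℝ) ∈ interior (integrableExpSet Y P) := by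
    rw [mem_interior_iff_mem_nhds]
    refine mem_of_superset (Icc_mem_nhds (by norm_num : (-1 : ℝ) < 0)
      (by norm_num : (0 : ℝ) < 1 / 4)) ?_
    exact convex_integrableExpSet.ordConnected.out hmem1 hmem2
  have hLp : MemLp Y 2 P := by exact_mod_cast memLp_of_mem_interior_integrableExpSet hint 2
  have hLp' : MemLp (fun ω => Real.log (X ω)) 2 P := by
    simpa [hY, Pi.neg_def] using hLp.neg
  refine ⟨hLp', ?_⟩
  have hvar : Var[fun ω => Real.log (X ω); P] = Var[Y; P] := by
    have : (fun ω => Real.log (X ω)) = -Y := by funext ω; simp [hY]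
    rw [this, variance_neg]
  rw [hvar, variance_eq_sub hLp]
  obtain ⟨g₁, g₂, hG, hg⟩ := exists_hasTaylorTwo_Gamma
  have hM := (hasFPowerSeriesAt_mgf hint).hasTaylorTwo.1
  simp only [FormalMultilinearSeries.coeff_ofScalars, zero_mul, Real.exp_zero, mul_one, zero_add,
    pow_zero, Nat.factorial, pow_one, Nat.cast_one, div_one] at hM
  have h1 := hG.mul hM
  have h2 := (hasTaylorTwo_one_sub_mul_cutoffMellin (β := β) hβ hd hy)
  have h3 : (fun s => Real.Gamma (1 + s) * mgf Y P s) =ᶠ[𝓝[>] 0]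
      fun s => 1 - s * cutoffMellin β y s := by
    filter_upwards [Ioo_mem_nhdsGT (by norm_num : (0 : ℝ) < 1 / 2)] with s hs
    rw [← (integrable_rpow_neg_of_laplace hβ hd hy hXm hpos hL hs.1 hs.2).2, mgf,
      integral_congr_ae (hexp s)]
  -- With `m₁, m₂` the moments of `Y`: `g₁ + m₁ = -I1` and `g₂ + g₁ m₁ + m₂ / 2 = -I2`. Hence `m₂ -
  -- m₁ ^ 2 = -2 I2 - I1 ^ 2 - (2 g₂ - g₁ ^ 2)`.
  obtain ⟨-, e1, e2⟩ := (h1.congr h3).unique h2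
  simp at e1 e2
  set I1 := ∫ x in Set.Ioi (0 : ℝ), cutoffDiff β y x / x
  set I2 := ∫ x in Set.Ioi (0 : ℝ), cutoffDiff β y x * (Real.log x / x)
  have e3 : I1 = -(∫ ω, Y ω ∂P) - g₁ := by linarith
  have e4 : ∫ ω, (Y ^ 2) ω ∂P = ∫ ω, Y ω ^ 2 ∂P := rfl
  rw [e3, e4]
  nlinarith
end laplace

/-! ### Powers of the logarithm against small powers -/

section bounds

lemma exists_abs_log_add_pi_pow_le (p : ℕ) : ∃ C : ℝ, 0 < C ∧ ∀ t : ℝ, 0 < t →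
    (|Real.log t| + Real.pi) ^ p ≤ C * (t ^ (1 / 4 : ℝ) + t ^ (-(1 / 4) : ℝ)) := by
  -- The constant comes from `u ^ p ≤ p! exp u` at `u = (|log t| + π) / 4`.
  refine ⟨p.factorial * 4 ^ p * Real.exp (Real.pi / 4), by positivity, fun t ht => ?_⟩
  have hpi := Real.pi_pos
  have h1 := Real.pow_div_factorial_le_exp (x := (|Real.log t| + Real.pi) / 4) (by positivity) p
  rw [div_pow, div_div, div_le_iff₀ (by positivity)] at h1
  have h2 : Real.exp (|Real.log t| / 4) ≤ t ^ (1 / 4 : ℝ) + t ^ (-(1 / 4) : ℝ) := by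
    rw [Real.rpow_def_of_pos ht, Real.rpow_def_of_pos ht]
    rcases abs_cases (Real.log t) with ⟨h, -⟩ | ⟨h, -⟩ <;> rw [h]
    · have : Real.log t / 4 = Real.log t * (1 / 4) := by ring
      rw [this]; linarith [Real.exp_pos (Real.log t * -(1 / 4))]
    · have : -Real.log t / 4 = Real.log t * -(1 / 4) := by ring
      rw [this]; linarith [Real.exp_pos (Real.log t * (1 / 4))]
  calc (|Real.log t| + Real.pi) ^ p
      ≤ Real.exp ((|Real.log t| + Real.pi) / 4) * (4 ^ p * p.factorial) := h1
    _ = p.factorial * 4 ^ p * Real.exp (Real.pi / 4) * Real.exp (|Real.log t| / 4) := by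
        rw [add_div, Real.exp_add]; ring
    _ ≤ _ := by gcongr

lemma Complex.norm_log_le_abs_log_norm (z : ℂ) : ‖Complex.log z‖ ≤ |Real.log ‖z‖| + Real.pi := by
  refine (Complex.norm_le_abs_re_add_abs_im _).trans ?_
  rw [Complex.log_re, Complex.log_im]
  gcongr
  exact Complex.abs_arg_le_pi z

lemma exists_norm_log_pow_le_of_le_norm (p : ℕ) {r : ℝ} (hr : 0 < r) : ∃ C : ℝ, 0 < C ∧ ∀ z : ℂ,
    r ≤ ‖z‖ → ‖Complex.log z‖ ^ p ≤ C * ‖z‖ ^ (1 / 4 : ℝ) := by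
  obtain ⟨C, hC, h⟩ := exists_abs_log_add_pi_pow_le p
  refine ⟨C * (1 + r ^ (-(1 / 2) : ℝ)), by positivity, fun z hz => ?_⟩
  have hz0 : 0 < ‖z‖ := hr.trans_le hz
  refine (pow_le_pow_left₀ (norm_nonneg _) (Complex.norm_log_le_abs_log_norm z) p).trans ?_
  refine (h _ hz0).trans ?_
  rw [mul_assoc, add_mul, one_mul]
  gcongr
  calc ‖z‖ ^ (-(1 / 4) : ℝ) = ‖z‖ ^ (-(1 / 2) : ℝ) * ‖z‖ ^ (1 / 4 : ℝ) := by
        rw [← Real.rpow_add hz0]; norm_num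
    _ ≤ r ^ (-(1 / 2) : ℝ) * ‖z‖ ^ (1 / 4 : ℝ) := by
        gcongr ?_ * _
        exact Real.rpow_le_rpow_of_nonpos hr hz (by norm_num)

lemma exists_norm_log_pow_le_of_norm_le (p : ℕ) {r : ℝ} (hr : 0 < r) : ∃ C : ℝ, 0 < C ∧ ∀ z : ℂ,
    z ≠ 0 → ‖z‖ ≤ r → ‖Complex.log z‖ ^ p ≤ C * ‖z‖ ^ (-(1 / 4) : ℝ) := by
  obtain ⟨C, hC, h⟩ := exists_abs_log_add_pi_pow_le p
  refine ⟨C * (r ^ (1 / 2 : ℝ) + 1), by positivity, fun z hz0 hz => ?_⟩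
  have hz0 : 0 < ‖z‖ := norm_pos_iff.2 hz0
  refine (pow_le_pow_left₀ (norm_nonneg _) (Complex.norm_log_le_abs_log_norm z) p).trans ?_
  refine (h _ hz0).trans ?_
  rw [mul_assoc, add_mul, one_mul]
  gcongr
  calc ‖z‖ ^ (1 / 4 : ℝ) = ‖z‖ ^ (1 / 2 : ℝ) * ‖z‖ ^ (-(1 / 4) : ℝ) := by
        rw [← Real.rpow_add hz0]; norm_num
    _ ≤ r ^ (1 / 2 : ℝ) * ‖z‖ ^ (-(1 / 4) : ℝ) := by
        gcongr

end bounds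

/-! ### Decay, holomorphy and conjugation symmetry of the integrand -/

section keyhole

variable {β d : ℕ} {y : Fin d → ℝ}

/-- The product `∏ (1 - z / yᵢ) ^ (-β / 2)`. -/
noncomputable def keyholeProd (β : ℕ) {d : ℕ} (y : Fin d → ℝ) (z : ℂ) : ℂ :=
  ∏ i, (1 - z / (y i : ℂ)) ^ (-(β : ℂ) / 2)

lemma keyholeIntegrand_eq (p : ℕ) (z : ℂ) :
    keyholeIntegrand β y p z = Complex.log z ^ p * keyholeProd β y z / z := rfl

lemma norm_keyholeProd (z : ℂ) :
    ‖keyholeProd β y z‖ = ∏ i, ‖1 - z / (y i : ℂ)‖ ^ (-(β : ℝ) / 2) := by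
  rw [keyholeProd, norm_prod]
  refine Finset.prod_congr rfl fun i _ => ?_
  rw [← Complex.norm_cpow_real]
  push_cast; rfl

lemma exists_norm_keyholeProd_le (hβ : 1 ≤ β) (hd : 1 ≤ d) {c r : ℝ} (hc : 0 < c) (hr : 0 < r) :
    ∃ C : ℝ, 0 < C ∧ ∀ z : ℂ, r ≤ ‖z‖ → (∀ i, c * ‖z‖ ≤ ‖1 - z / (y i : ℂ)‖) →
      ‖keyholeProd β y z‖ ≤ C * ‖z‖ ^ (-(1 / 2) : ℝ) := by
  have hβ' : (1 : ℝ) ≤ β := by exact_mod_cast hβ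
  refine ⟨((c * r) ^ (-(β : ℝ) / 2)) ^ d * r ^ (1 / 2 : ℝ), by positivity, fun z hz h => ?_⟩
  have hz0 : 0 < ‖z‖ := hr.trans_le hz
  -- Rescaling by `r` gives a base at least 1, so the total exponent `-β d / 2` may be weakened to
  -- `-1/2`.
  have ht : 1 ≤ ‖z‖ / r := (one_le_div hr).2 hz
  rw [norm_keyholeProd]
  calc ∏ i, ‖1 - z / (y i : ℂ)‖ ^ (-(β : ℝ) / 2)
      ≤ ∏ _i : Fin d, (c * ‖z‖) ^ (-(β : ℝ) / 2) := by
        refine Finset.prod_le_prod (fun i _ => by positivity) fun i _ => ?_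
        exact Real.rpow_le_rpow_of_nonpos (by positivity) (h i) (by linarith)
    _ = ((c * r) ^ (-(β : ℝ) / 2)) ^ d * ((‖z‖ / r) ^ (-(β : ℝ) / 2)) ^ d := by
        rw [Finset.prod_const, Finset.card_univ, Fintype.card_fin, ← mul_pow,
          ← Real.mul_rpow (by positivity) (by positivity)]
        have e : c * r * (‖z‖ / r) = c * ‖z‖ := by field_simp
        rw [e]
    _ ≤ ((c * r) ^ (-(β : ℝ) / 2)) ^ d * (‖z‖ / r) ^ (-(1 / 2) : ℝ) := by
        gcongr
        have h1 : (‖z‖ / r) ^ (-(β : ℝ) / 2) ≤ (‖z‖ / r) ^ (-(1 / 2) : ℝ) :=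
          Real.rpow_le_rpow_of_exponent_le ht (by linarith)
        have h2 : (‖z‖ / r) ^ (-(β : ℝ) / 2) ≤ 1 :=
          Real.rpow_le_one_of_one_le_of_nonpos ht (by linarith)
        exact (pow_le_of_le_one (by positivity) h2 (by omega)).trans h1
    _ = _ := by
        rw [Real.div_rpow hz0.le hr.le, Real.rpow_neg hr.le, div_inv_eq_mul]; ring

/-- The exponents add up as `1/4` from the logarithm, `-1/2` from the product and `-1` from `1 / z`;
the total `-5/4` is integrable at infinity. -/
lemma exists_norm_keyholeIntegrand_le (hβ : 1 ≤ β) (hd : 1 ≤ d) (p : ℕ) {c r : ℝ} (hc : 0 < c)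
    (hr : 0 < r) : ∃ C : ℝ, 0 < C ∧ ∀ z : ℂ, r ≤ ‖z‖ → (∀ i, c * ‖z‖ ≤ ‖1 - z / (y i : ℂ)‖) →
      ‖keyholeIntegrand β y p z‖ ≤ C * ‖z‖ ^ (-(5 / 4) : ℝ) := by
  obtain ⟨C1, hC1, h1⟩ := exists_norm_keyholeProd_le (β := β) (y := y) hβ hd hc hr
  obtain ⟨C2, hC2, h2⟩ := exists_norm_log_pow_le_of_le_norm p hr
  refine ⟨C2 * C1, by positivity, fun z hz h => ?_⟩
  have hz0 : 0 < ‖z‖ := hr.trans_le hz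
  rw [keyholeIntegrand_eq, norm_div, norm_mul, norm_pow, div_le_iff₀ hz0]
  calc ‖Complex.log z‖ ^ p * ‖keyholeProd β y z‖
      ≤ (C2 * ‖z‖ ^ (1 / 4 : ℝ)) * (C1 * ‖z‖ ^ (-(1 / 2) : ℝ)) := by
        gcongr
        · exact h2 z hz
        · exact h1 z hz h
    _ = C2 * C1 * (‖z‖ ^ (1 / 4 : ℝ) * ‖z‖ ^ (-(1 / 2) : ℝ)) := by ring
    _ = C2 * C1 * ‖z‖ ^ (-(5 / 4) : ℝ) * ‖z‖ := by
        rw [← Real.rpow_add hz0, mul_assoc (C2 * C1), ← Real.rpow_add_one hz0.ne']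
        norm_num

/-- Decay of the integrand away from the cuts. -/
lemma exists_norm_keyholeIntegrand_le' (hβ : 1 ≤ β) (hd : 1 ≤ d) (hy : ∀ i, 0 < y i) (p : ℕ)
    {η : ℝ} (hη : 0 < η) : ∃ C R : ℝ, 0 < C ∧ 0 < R ∧ ∀ z : ℂ,
      (η ≤ z.im ∨ R ≤ ‖z‖ ∨ (z.re ≤ 0 ∧ η ≤ ‖z‖)) →
      ‖keyholeIntegrand β y p z‖ ≤ C * ‖z‖ ^ (-(5 / 4) : ℝ) := by
  have : Nonempty (Fin d) := ⟨⟨0, hd⟩⟩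
  obtain ⟨i0, hi0⟩ := Finite.exists_max y
  -- The slope `1 / (2 yᵢ)` serves when `‖z‖ ≥ 2 yᵢ` or `Re z ≤ 0`. The slope `η / (2 yᵢ ^ 2)`
  -- serves for smaller `z` at height at least `η`, where the imaginary part keeps the factor away
  -- from 0.
  obtain ⟨i1, hi1⟩ := Finite.exists_min fun i => min (1 / (2 * y i)) (η / (2 * y i ^ 2))
  have hy0 := hy i0
  have hc : 0 < min (1 / (2 * y i1)) (η / (2 * y i1 ^ 2)) := by have := hy i1; positivity
  obtain ⟨C, hC, h⟩ := exists_norm_keyholeIntegrand_le (β := β) (y := y) hβ hd p hc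
    (show 0 < min η (2 * y i0) by positivity)
  refine ⟨C, 2 * y i0, hC, by positivity, fun z hz => h z ?_ fun i => ?_⟩
  · rcases hz with hz | hz | ⟨-, hz⟩
    · exact (min_le_left _ _).trans (hz.trans ((le_abs_self _).trans (Complex.abs_im_le_norm z)))
    · exact (min_le_right _ _).trans hz
    · exact (min_le_left _ _).trans hz
  · have hyi := hy i
    refine (mul_le_mul_of_nonneg_right (hi1 i) (norm_nonneg z)).trans ?_
    have hfar : 2 * y i ≤ ‖z‖ → min (1 / (2 * y i)) (η / (2 * y i ^ 2)) * ‖z‖ ≤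
        ‖1 - z / (y i : ℂ)‖ := by
      intro hz
      have h1 : ‖z / (y i : ℂ)‖ - ‖(1 : ℂ)‖ ≤ ‖1 - z / (y i : ℂ)‖ := by
        rw [norm_sub_rev]; exact norm_sub_norm_le _ _
      rw [norm_div, Complex.norm_real, Real.norm_eq_abs, abs_of_pos hyi, norm_one] at h1
      refine (mul_le_mul_of_nonneg_right (min_le_left _ _) (norm_nonneg z)).trans (le_trans ?_ h1)
      have h2 : 1 ≤ 1 / (2 * y i) * ‖z‖ := by
        rw [one_div_mul_eq_div]; exact (one_le_div (by positivity)).2 hz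
      have h3 : ‖z‖ / y i = 1 / (2 * y i) * ‖z‖ + 1 / (2 * y i) * ‖z‖ := by field_simp; ring
      linarith
    rcases hz with hz | hz | ⟨hz, hz'⟩
    · by_cases hzi : 2 * y i ≤ ‖z‖
      · exact hfar hzi
      · push Not at hzi
        refine (mul_le_mul_of_nonneg_right (min_le_right _ _) (norm_nonneg z)).trans ?_
        have h1 : |(1 - z / (y i : ℂ)).im| ≤ ‖1 - z / (y i : ℂ)‖ := Complex.abs_im_le_norm _
        rw [Complex.sub_im, Complex.one_im, Complex.div_ofReal_im, zero_sub, abs_neg,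
          abs_of_nonneg (by have : 0 ≤ z.im := hη.le.trans hz
                            positivity)] at h1
        refine le_trans ?_ h1
        calc η / (2 * y i ^ 2) * ‖z‖ ≤ η / (2 * y i ^ 2) * (2 * y i) := by gcongr
          _ = η / y i := by field_simp
          _ ≤ z.im / y i := by gcongr
    · exact hfar ((mul_le_mul_of_nonneg_left (hi0 i) zero_le_two).trans hz)
    · refine (mul_le_mul_of_nonneg_right (min_le_left _ _) (norm_nonneg z)).trans ?_
      have h1 : 1 / (2 * y i) * ‖z‖ ≤ ‖z / (y i : ℂ)‖ := by
        rw [norm_div, Complex.norm_real, Real.norm_eq_abs, abs_of_pos hyi, one_div_mul_eq_div]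
        gcongr; linarith
      refine h1.trans ?_
      rw [Complex.norm_def, Complex.norm_def]
      refine Real.sqrt_le_sqrt ?_
      have h2 : (z / (y i : ℂ)).re ≤ 0 := by
        rw [Complex.div_ofReal_re]; exact div_nonpos_of_nonpos_of_nonneg hz hyi.le
      rw [Complex.normSq_apply, Complex.normSq_apply, Complex.sub_re, Complex.sub_im,
        Complex.one_re, Complex.one_im]
      nlinarith

lemma differentiableAt_keyholeProd {z : ℂ} (h : ∀ i, 1 - z / (y i : ℂ) ∈ Complex.slitPlane) :
    DifferentiableAt ℂ (keyholeProd β y) z := by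
  unfold keyholeProd
  refine DifferentiableAt.fun_finsetProd fun i _ => ?_
  exact DifferentiableAt.cpow_const (by fun_prop) (h i)

lemma differentiableAt_keyholeIntegrand {p : ℕ} {z : ℂ} (hz : z ∈ Complex.slitPlane)
    (h : ∀ i, 1 - z / (y i : ℂ) ∈ Complex.slitPlane) :
    DifferentiableAt ℂ (keyholeIntegrand β y p) z := by
  have h0 : z ≠ 0 := Complex.slitPlane_ne_zero hz
  have : keyholeIntegrand β y p = fun z => Complex.log z ^ p * keyholeProd β y z / z := rfl
  rw [this]
  exact (((differentiableAt_id.clog hz).pow p).mul (differentiableAt_keyholeProd h)).div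
    differentiableAt_id h0

lemma one_sub_div_mem_slitPlane_of_im_ne_zero (hy : ∀ i, 0 < y i) {z : ℂ} (hz : z.im ≠ 0)
    (i : Fin d) : 1 - z / (y i : ℂ) ∈ Complex.slitPlane := by
  right
  rw [Complex.sub_im, Complex.one_im, Complex.div_ofReal_im, zero_sub, neg_ne_zero]
  exact div_ne_zero hz (hy i).ne'

lemma one_sub_div_mem_slitPlane_of_re_lt (hy : ∀ i, 0 < y i) {z : ℂ} {i : Fin d}
    (hz : z.re < y i) : 1 - z / (y i : ℂ) ∈ Complex.slitPlane := by
  left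
  rw [Complex.sub_re, Complex.one_re, Complex.div_ofReal_re, sub_pos]
  exact (div_lt_one (hy i)).2 hz

lemma differentiableAt_keyholeIntegrand_of_im_ne_zero (hy : ∀ i, 0 < y i) {p : ℕ} {z : ℂ}
    (hz : z.im ≠ 0) : DifferentiableAt ℂ (keyholeIntegrand β y p) z :=
  differentiableAt_keyholeIntegrand (Or.inr hz) (one_sub_div_mem_slitPlane_of_im_ne_zero hy hz)

lemma differentiableAt_keyholeIntegrand_of_re_lt (hy : ∀ i, 0 < y i) {p : ℕ} {z : ℂ}
    (hz0 : 0 < z.re) (hz : ∀ i, z.re < y i) : DifferentiableAt ℂ (keyholeIntegrand β y p) z :=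
  differentiableAt_keyholeIntegrand (Or.inl hz0) fun i =>
    one_sub_div_mem_slitPlane_of_re_lt hy (hz i)

lemma Complex.arg_ne_pi_of_mem_slitPlane {z : ℂ} (hz : z ∈ Complex.slitPlane) :
    z.arg ≠ Real.pi := (Complex.mem_slitPlane_iff_arg.1 hz).1

/-- Principal logarithms and powers with real exponent commute with conjugation off their cuts; this
is why the contour integrals are real. -/
lemma keyholeIntegrand_conj {p : ℕ} {z : ℂ} (hz : z ∈ Complex.slitPlane)
    (h : ∀ i, 1 - z / (y i : ℂ) ∈ Complex.slitPlane) :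
    keyholeIntegrand β y p (starRingEnd ℂ z) = starRingEnd ℂ (keyholeIntegrand β y p z) := by
  rw [keyholeIntegrand, keyholeIntegrand, map_div₀, map_mul, map_pow, map_prod,
    Complex.log_conj _ (Complex.arg_ne_pi_of_mem_slitPlane hz)]
  congr 2
  refine Finset.prod_congr rfl fun i _ => ?_
  have e : 1 - starRingEnd ℂ z / (y i : ℂ) = starRingEnd ℂ (1 - z / (y i : ℂ)) := by
    simp
  rw [e, Complex.conj_cpow _ _ (Complex.arg_ne_pi_of_mem_slitPlane (h i))]
  congr 2
  rw [map_div₀, map_neg, Complex.conj_natCast, map_ofNat]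

end keyhole

/-! ### Deforming the contour in the upper half plane -/

section contour

variable {β d : ℕ} {y : Fin d → ℝ}

lemma abs_re_le_norm_add_mul_I (x t : ℝ) : |x| ≤ ‖(x : ℂ) + t * Complex.I‖ := by
  have := Complex.abs_re_le_norm ((x : ℂ) + t * Complex.I)
  simpa using this

lemma abs_im_le_norm_add_mul_I (x t : ℝ) : |t| ≤ ‖(x : ℂ) + t * Complex.I‖ := by
  have := Complex.abs_im_le_norm ((x : ℂ) + t * Complex.I)
  simpa using this

lemma im_add_mul_I (x t : ℝ) : ((x : ℂ) + t * Complex.I).im = t := by simp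

lemma re_add_mul_I (x t : ℝ) : ((x : ℂ) + t * Complex.I).re = x := by simp

lemma continuous_keyholeIntegrand_line (hy : ∀ i, 0 < y i) (p : ℕ) {η : ℝ} (hη : η ≠ 0) :
    Continuous fun x : ℝ => keyholeIntegrand β y p (x + η * Complex.I) := by
  refine continuous_iff_continuousAt.2 fun x => ?_
  have h : ContinuousAt (keyholeIntegrand β y p) ((x : ℂ) + η * Complex.I) :=
    (differentiableAt_keyholeIntegrand_of_im_ne_zero hy (by rwa [im_add_mul_I])).continuousAt
  exact h.comp_of_eq (f := fun x : ℝ => (x : ℂ) + η * Complex.I)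
    (by fun_prop : Continuous fun x : ℝ => (x : ℂ) + η * Complex.I).continuousAt rfl

lemma integrable_keyholeIntegrand_line (hβ : 1 ≤ β) (hd : 1 ≤ d) (hy : ∀ i, 0 < y i) (p : ℕ)
    {η : ℝ} (hη : 0 < η) :
    Integrable fun x : ℝ => keyholeIntegrand β y p (x + η * Complex.I) := by
  obtain ⟨C, R, hC, hR, h⟩ := exists_norm_keyholeIntegrand_le' (β := β) (y := y) hβ hd hy p hη
  have hint : Integrable fun x : ℝ =>
      C * ((1 + 1 / η) ^ (5 / 4 : ℝ) * (1 + ‖x‖) ^ (-(5 / 4) : ℝ)) :=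
    ((integrable_one_add_norm (by norm_num)).const_mul _).const_mul _
  refine hint.mono' (continuous_keyholeIntegrand_line hy p hη.ne').aestronglyMeasurable
    (Eventually.of_forall fun x => ?_)
  refine (h _ (Or.inl (im_add_mul_I x η).ge)).trans ?_
  gcongr
  have h1 := abs_re_le_norm_add_mul_I x η
  have h2 := abs_im_le_norm_add_mul_I x η
  rw [abs_of_pos hη] at h2
  set n := ‖(x : ℂ) + η * Complex.I‖
  have hn : 0 < n := hη.trans_le h2
  have h3 : 1 + ‖x‖ ≤ (1 + 1 / η) * n := by
    have : 1 ≤ 1 / η * n := by rw [one_div_mul_eq_div]; exact (one_le_div hη).2 h2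
    rw [Real.norm_eq_abs]; linarith
  have h4 : 0 < 1 + ‖x‖ := by positivity
  calc n ^ (-(5 / 4) : ℝ) = (1 + 1 / η) ^ (5 / 4 : ℝ) * ((1 + 1 / η) * n) ^ (-(5 / 4) : ℝ) := by
        rw [Real.mul_rpow (by positivity) hn.le, ← mul_assoc, ← Real.rpow_add (by positivity)]
        norm_num
    _ ≤ _ := by
        refine mul_le_mul_of_nonneg_left ?_ (by positivity)
        exact Real.rpow_le_rpow_of_nonpos h4 h3 (by norm_num)

lemma keyholeIntegrand_rect (hy : ∀ i, 0 < y i) (p : ℕ) {a b η H : ℝ} (hη : 0 < η) (hH : 0 < H) :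
    (∫ x in a..b, keyholeIntegrand β y p (x + η * Complex.I)) -
        (∫ x in a..b, keyholeIntegrand β y p (x + H * Complex.I)) +
        Complex.I * (∫ t in η..H, keyholeIntegrand β y p (b + t * Complex.I)) -
        Complex.I * (∫ t in η..H, keyholeIntegrand β y p (a + t * Complex.I)) = 0 := by
  have := Complex.integral_boundary_rect_eq_zero_of_differentiableOn
    (keyholeIntegrand β y p) ⟨a, η⟩ ⟨b, H⟩ (fun z hz => by
      refine (differentiableAt_keyholeIntegrand_of_im_ne_zero hy ?_).differentiableWithinAt
      have h2 : z.im ∈ Set.uIcc η H := hz.2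
      have := (lt_min hη hH).trans_le h2.1
      exact this.ne')
  simpa only [smul_eq_mul] using this

/-- Close the segment `[-r, r]` at height `η` by the rectangle up to height `r`. On the other three
sides the integrand is `O(r ^ (-5/4))` and their total length is at most `4 r`, so the integral is
`O(r ^ (-1/4))`. -/
lemma integral_keyholeIntegrand_line (hβ : 1 ≤ β) (hd : 1 ≤ d) (hy : ∀ i, 0 < y i) (p : ℕ)
    {η : ℝ} (hη : 0 < η) :
    ∫ x : ℝ, keyholeIntegrand β y p (x + η * Complex.I) = 0 := by
  obtain ⟨C, R, hC, hR, h⟩ := exists_norm_keyholeIntegrand_le' (β := β) (y := y) hβ hd hy p hη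
  have h1 := intervalIntegral_tendsto_integral
    (integrable_keyholeIntegrand_line (β := β) hβ hd hy p hη) tendsto_neg_atTop_atBot tendsto_id
  refine tendsto_nhds_unique h1 ?_
  rw [tendsto_zero_iff_norm_tendsto_zero]
  have hlim : Tendsto (fun r : ℝ => 4 * C * r ^ (-(1 / 4) : ℝ)) atTop (𝓝 0) := by
    have := (tendsto_rpow_neg_atTop (show (0 : ℝ) < 1 / 4 by norm_num)).const_mul (4 * C)
    rwa [mul_zero] at this
  refine squeeze_zero' (Eventually.of_forall fun r => norm_nonneg _) ?_ hlim
  filter_upwards [eventually_gt_atTop η] with r hr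
  have hr0 : 0 < r := hη.trans hr
  have hb : ∀ z : ℂ, η ≤ z.im → r ≤ ‖z‖ → ‖keyholeIntegrand β y p z‖ ≤ C * r ^ (-(5 / 4) : ℝ) := by
    intro z hz hz'
    refine (h z (Or.inl hz)).trans ?_
    refine mul_le_mul_of_nonneg_left ?_ hC.le
    exact Real.rpow_le_rpow_of_nonpos hr0 hz' (by norm_num)
  have hrect := keyholeIntegrand_rect (β := β) hy p (a := -r) (b := r) hη hr0
  have e : (∫ x in (-r)..r, keyholeIntegrand β y p (x + η * Complex.I)) =
      (∫ x in (-r)..r, keyholeIntegrand β y p (x + r * Complex.I)) -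
        Complex.I * (∫ t in η..r, keyholeIntegrand β y p (r + t * Complex.I)) +
        Complex.I * (∫ t in η..r, keyholeIntegrand β y p ((-r : ℝ) + t * Complex.I)) := by
    linear_combination hrect
  simp only [id]
  rw [e]
  have b1 : ‖∫ x in (-r)..r, keyholeIntegrand β y p (x + r * Complex.I)‖ ≤
      C * r ^ (-(5 / 4) : ℝ) * |r - -r| := by
    refine intervalIntegral.norm_integral_le_of_norm_le_const fun x _ => hb _ ?_ ?_
    · rw [im_add_mul_I]; exact hr.le
    · exact (le_abs_self r).trans (abs_im_le_norm_add_mul_I x r)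
  have b2 : ∀ a : ℝ, |a| = r →
      ‖Complex.I * ∫ t in η..r, keyholeIntegrand β y p (a + t * Complex.I)‖ ≤
      C * r ^ (-(5 / 4) : ℝ) * |r - η| := by
    intro a ha
    rw [norm_mul, Complex.norm_I, one_mul]
    refine intervalIntegral.norm_integral_le_of_norm_le_const fun t ht => hb _ ?_ ?_
    · rw [im_add_mul_I]
      rw [Set.uIoc_of_le hr.le] at ht
      exact ht.1.le
    · rw [← ha]; exact abs_re_le_norm_add_mul_I a t
  have c1 := b2 r (abs_of_pos hr0)
  have c2 := b2 (-r) (by rw [abs_neg, abs_of_pos hr0])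
  have hA : 0 ≤ C * r ^ (-(5 / 4) : ℝ) := by positivity
  have c3 : |r - η| ≤ r := by rw [abs_of_pos (by linarith)]; linarith
  have c4 : |r - -r| = 2 * r := by rw [sub_neg_eq_add, abs_of_pos (by linarith)]; ring
  rw [c4] at b1
  have e5 : r ^ (-(1 / 4) : ℝ) = r ^ (-(5 / 4) : ℝ) * r := by
    rw [← Real.rpow_add_one hr0.ne']; norm_num
  rw [e5]
  have c5 := mul_le_mul_of_nonneg_left c3 hA
  refine (norm_add_le _ _).trans ?_
  refine (add_le_add_left (norm_sub_le _ _) _).trans ?_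
  nlinarith

/-- The part of the keyhole contour in the upper half plane. -/
noncomputable def keyholeUpper (β : ℕ) {d : ℕ} (y : Fin d → ℝ) (p : ℕ) (ε η R : ℝ) : ℂ :=
  Complex.I * (∫ t in (0 : ℝ)..η, keyholeIntegrand β y p (R + t * Complex.I))
    - (∫ x in ε..R, keyholeIntegrand β y p (x + η * Complex.I))
    - Complex.I * (∫ t in (0 : ℝ)..η, keyholeIntegrand β y p (ε + t * Complex.I))

/-- The contour from `-∞` at height `η` that descends to the real axis at `ε`. -/
noncomputable def keyholeLeft (β : ℕ) {d : ℕ} (y : Fin d → ℝ) (p : ℕ) (ε η : ℝ) : ℂ :=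
  (∫ x in Set.Iic ε, keyholeIntegrand β y p (x + η * Complex.I))
    - Complex.I * (∫ t in (0 : ℝ)..η, keyholeIntegrand β y p (ε + t * Complex.I))

lemma tendsto_vertical_of_bound {ι : Type*} {l : Filter ι} {f : ℂ → ℂ} {C a b : ℝ} {u : ι → ℝ}
    (hu : Tendsto (fun i => |u i|) l atTop)
    (hf : ∀ᶠ i in l, ∀ t ∈ Set.uIoc a b, ‖f (u i + t * Complex.I)‖ ≤
      C * ‖(u i : ℂ) + t * Complex.I‖ ^ (-(5 / 4) : ℝ)) (hC : 0 < C) :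
    Tendsto (fun i => ∫ t in a..b, f (u i + t * Complex.I)) l (𝓝 0) := by
  rw [tendsto_zero_iff_norm_tendsto_zero]
  have hlim : Tendsto (fun i => C * |u i| ^ (-(5 / 4) : ℝ) * |b - a|) l (𝓝 0) := by
    have := (((tendsto_rpow_neg_atTop (show (0 : ℝ) < 5 / 4 by norm_num)).comp hu).const_mul
      C).mul_const |b - a|
    simpa using this
  refine squeeze_zero' (Eventually.of_forall fun r => norm_nonneg _) ?_ hlim
  filter_upwards [hf, hu.eventually_gt_atTop 0] with i hi hi0
  refine intervalIntegral.norm_integral_le_of_norm_le_const fun t ht => (hi t ht).trans ?_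
  refine mul_le_mul_of_nonneg_left ?_ hC.le
  exact Real.rpow_le_rpow_of_nonpos hi0 (abs_re_le_norm_add_mul_I _ _) (by norm_num)

/-- The vertical side at `R` disappears in the limit. As the whole line integrates to 0, minus its
part to the right of `ε` equals its part to the left. -/
lemma tendsto_keyholeUpper (hβ : 1 ≤ β) (hd : 1 ≤ d) (hy : ∀ i, 0 < y i) (p : ℕ) {ε η : ℝ}
    (hη : 0 < η) :
    Tendsto (keyholeUpper β y p ε η) atTop (𝓝 (keyholeLeft β y p ε η)) := by
  obtain ⟨C, R, hC, hR, h⟩ := exists_norm_keyholeIntegrand_le' (β := β) (y := y) hβ hd hy p hη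
  have h1 : Tendsto (fun r : ℝ => ∫ t in (0 : ℝ)..η, keyholeIntegrand β y p (r + t * Complex.I))
      atTop (𝓝 0) := by
    refine tendsto_vertical_of_bound (u := fun r => r) tendsto_abs_atTop_atTop ?_ hC
    filter_upwards [eventually_ge_atTop R] with r hr t _
    exact h _ (Or.inr (Or.inl (hr.trans ((le_abs_self r).trans (abs_re_le_norm_add_mul_I r t)))))
  have hint := integrable_keyholeIntegrand_line (β := β) hβ hd hy p hη
  have h2 := intervalIntegral_tendsto_integral_Ioi ε hint.integrableOn tendsto_id
  have h3 := ((h1.const_mul Complex.I).sub h2).sub_const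
    (Complex.I * (∫ t in (0 : ℝ)..η, keyholeIntegrand β y p (ε + t * Complex.I)))
  have e := intervalIntegral.integral_Iic_add_Ioi (b := ε) hint.integrableOn hint.integrableOn
  rw [integral_keyholeIntegrand_line hβ hd hy p hη] at e
  have e2 : keyholeLeft β y p ε η = Complex.I * 0 -
      (∫ x in Set.Ioi ε, keyholeIntegrand β y p (x + η * Complex.I)) -
      Complex.I * (∫ t in (0 : ℝ)..η, keyholeIntegrand β y p (ε + t * Complex.I)) := by
    rw [keyholeLeft]; linear_combination e
  rw [e2]
  exact h3

lemma intervalIntegrable_keyholeIntegrand_vertical (hy : ∀ i, 0 < y i) (p : ℕ) {ε : ℝ}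
    (hε : 0 < ε) (hεy : ∀ i, ε < y i) (a b : ℝ) :
    IntervalIntegrable (fun t : ℝ => keyholeIntegrand β y p (ε + t * Complex.I)) volume a b := by
  refine Continuous.intervalIntegrable (continuous_iff_continuousAt.2 fun t => ?_) a b
  have h : ContinuousAt (keyholeIntegrand β y p) ((ε : ℂ) + t * Complex.I) :=
    (differentiableAt_keyholeIntegrand_of_re_lt hy (by rwa [re_add_mul_I])
      (by simpa only [re_add_mul_I] using hεy)).continuousAt
  exact h.comp_of_eq (f := fun t : ℝ => (ε : ℂ) + t * Complex.I)
    (by fun_prop : Continuous fun t : ℝ => (ε : ℂ) + t * Complex.I).continuousAt rfl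

lemma keyholeIntegrand_conj_of_im_ne_zero (hy : ∀ i, 0 < y i) {p : ℕ} (x : ℝ) {t : ℝ}
    (ht : t ≠ 0) : keyholeIntegrand β y p (x - t * Complex.I) =
      starRingEnd ℂ (keyholeIntegrand β y p (x + t * Complex.I)) := by
  have him : ((x : ℂ) + t * Complex.I).im ≠ 0 := by rwa [im_add_mul_I]
  rw [← keyholeIntegrand_conj (Or.inr him) (one_sub_div_mem_slitPlane_of_im_ne_zero hy him)]
  congr 1
  simp [sub_eq_add_neg]

lemma integral_keyholeIntegrand_vertical_neg (hy : ∀ i, 0 < y i) (p : ℕ) (x η : ℝ) (hη : 0 < η) :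
    ∫ t in (-η)..(0 : ℝ), keyholeIntegrand β y p (x + t * Complex.I) =
      starRingEnd ℂ (∫ t in (0 : ℝ)..η, keyholeIntegrand β y p (x + t * Complex.I)) := by
  rw [← intervalIntegral.intervalIntegral_conj]
  have := intervalIntegral.integral_comp_neg (a := 0) (b := η)
    (fun t : ℝ => keyholeIntegrand β y p (x + t * Complex.I))
  rw [neg_zero] at this
  rw [← this]
  refine intervalIntegral.integral_congr_ae (Eventually.of_forall fun t ht => ?_)
  rw [Set.uIoc_of_le hη.le] at ht
  rw [← keyholeIntegrand_conj_of_im_ne_zero hy x ht.1.ne']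
  congr 1
  push_cast; ring

/-- The lower half of the contour contributes minus the conjugate of the upper half, because the
integrand is symmetric under conjugation; `w - conj w = 2 i Im w` absorbs the prefactor. The
crossing at `ε` lies between 0 and all `yᵢ`, hence off the cuts. -/
lemma keyholeIntegral_eq_im (hy : ∀ i, 0 < y i) (p : ℕ) {ε η : ℝ} (R : ℝ)
    (hε : 0 < ε) (hεy : ∀ i, ε < y i) (hη : 0 < η) :
    keyholeIntegral β y p ε η R = (((keyholeUpper β y p ε η R).im / Real.pi : ℝ) : ℂ) := by
  have hsplit := intervalIntegral.integral_add_adjacent_intervals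
    (intervalIntegrable_keyholeIntegrand_vertical (β := β) hy p hε hεy (-η) 0)
    (intervalIntegrable_keyholeIntegrand_vertical (β := β) hy p hε hεy 0 η)
  have hlow : (∫ x in ε..R, keyholeIntegrand β y p (x - η * Complex.I)) =
      starRingEnd ℂ (∫ x in ε..R, keyholeIntegrand β y p (x + η * Complex.I)) := by
    rw [← intervalIntegral.intervalIntegral_conj]
    congr 1; funext x
    exact keyholeIntegrand_conj_of_im_ne_zero hy x hη.ne'
  rw [keyholeIntegral, ← hsplit, hlow, integral_keyholeIntegrand_vertical_neg hy p R η hη,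
    integral_keyholeIntegrand_vertical_neg hy p ε η hη, keyholeUpper]
  set W := ∫ t in (0 : ℝ)..η, keyholeIntegrand β y p (R + t * Complex.I)
  set T := ∫ x in ε..R, keyholeIntegrand β y p (x + η * Complex.I)
  set V := ∫ t in (0 : ℝ)..η, keyholeIntegrand β y p (ε + t * Complex.I)
  have e : Complex.I * W - T - Complex.I * (starRingEnd ℂ V + V) + starRingEnd ℂ T +
      Complex.I * starRingEnd ℂ W =
      (Complex.I * W - T - Complex.I * V) - starRingEnd ℂ (Complex.I * W - T - Complex.I * V) := by
    simp only [map_sub, map_mul, Complex.conj_I]; ring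
  rw [e, Complex.sub_conj]
  have hpi : (Real.pi : ℂ) ≠ 0 := by exact_mod_cast Real.pi_ne_zero
  push_cast
  field_simp

/-- Cauchy's theorem between the heights `δ` and `η`, with the far left side going to infinity.
Independence of the height allows the contour to be lowered to the axis. -/
lemma keyholeLeft_eq (hβ : 1 ≤ β) (hd : 1 ≤ d) (hy : ∀ i, 0 < y i) (p : ℕ) {ε η δ : ℝ}
    (hε : 0 < ε) (hεy : ∀ i, ε < y i) (hδ : 0 < δ) (hη : 0 < η) (hδη : δ ≤ η) :
    keyholeLeft β y p ε δ = keyholeLeft β y p ε η := by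
  obtain ⟨C, R, hC, hR, h⟩ := exists_norm_keyholeIntegrand_le' (β := β) (y := y) hβ hd hy p hδ
  have h1 := intervalIntegral_tendsto_integral_Iic ε
    (integrable_keyholeIntegrand_line (β := β) hβ hd hy p hδ).integrableOn tendsto_neg_atTop_atBot
  have h2 := intervalIntegral_tendsto_integral_Iic ε
    (integrable_keyholeIntegrand_line (β := β) hβ hd hy p hη).integrableOn tendsto_neg_atTop_atBot
  have h3 : Tendsto (fun r : ℝ => ∫ t in δ..η, keyholeIntegrand β y p ((-r : ℝ) + t * Complex.I))
      atTop (𝓝 0) := by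
    refine tendsto_vertical_of_bound (u := fun r => -r) (by simpa using tendsto_abs_atTop_atTop)
      (Eventually.of_forall fun r t ht => h _ (Or.inl ?_)) hC
    rw [Set.uIoc_of_le hδη] at ht
    rw [im_add_mul_I]; exact ht.1.le
  have h4 := ((h1.sub h2).add_const
    (Complex.I * ∫ t in δ..η, keyholeIntegrand β y p (ε + t * Complex.I))).sub
      (h3.const_mul Complex.I)
  have h5 := tendsto_nhds_unique h4 ((tendsto_const_nhds (x := (0 : ℂ))).congr fun r =>
    (keyholeIntegrand_rect (β := β) hy p (a := -r) (b := ε) hδ hη).symm)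
  have hsplit := intervalIntegral.integral_add_adjacent_intervals
    (intervalIntegrable_keyholeIntegrand_vertical (β := β) hy p hε hεy 0 δ)
    (intervalIntegrable_keyholeIntegrand_vertical (β := β) hy p hε hεy δ η)
  rw [keyholeLeft, keyholeLeft, ← hsplit]
  linear_combination h5

end contour

/-! ### Boundary values on the negative axis -/

section boundary

variable {β d : ℕ} {y : Fin d → ℝ}

/-- The keyhole integrand with its singular part at the origin removed to the right of `-1`. -/
noncomputable def keyholeReg (β : ℕ) {d : ℕ} (y : Fin d → ℝ) (p : ℕ) (z : ℂ) : ℂ :=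
  keyholeIntegrand β y p z - if -1 < z.re then Complex.log z ^ p / z else 0

/-- The value of the keyhole integral. -/
noncomputable def keyholeValue (β : ℕ) {d : ℕ} (y : Fin d → ℝ) (p : ℕ) : ℝ :=
  ((∫ x : ℝ in Set.Iic 0, keyholeReg β y p x).im
    - ((Real.pi * Complex.I) ^ (p + 1) / ((p : ℂ) + 1)).im) / Real.pi

lemma measurable_keyholeIntegrand (p : ℕ) : Measurable (keyholeIntegrand β y p) := by
  unfold keyholeIntegrand
  refine Measurable.div (Measurable.mul (Complex.measurable_log.pow_const _) ?_) measurable_id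
  refine Finset.measurable_prod _ fun i _ => ?_
  exact Measurable.pow_const (by fun_prop) _

lemma measurable_keyholeReg (p : ℕ) : Measurable (keyholeReg β y p) := by
  unfold keyholeReg
  refine (measurable_keyholeIntegrand p).sub (Measurable.ite ?_ ?_ measurable_const)
  · exact measurableSet_lt measurable_const Complex.measurable_re
  · exact (Complex.measurable_log.pow_const _).div measurable_id

lemma tendsto_add_mul_I (x : ℝ) :
    Tendsto (fun δ : ℝ => (x : ℂ) + δ * Complex.I) (𝓝[>] 0) (𝓝 x) := by
  have : Continuous fun δ : ℝ => (x : ℂ) + δ * Complex.I := by fun_prop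
  have h := this.tendsto 0
  simp only [Complex.ofReal_zero, zero_mul, add_zero] at h
  exact h.mono_left nhdsWithin_le_nhds

/-- The principal branch has argument `π` on the negative axis itself, so there is no jump when the
axis is approached from above. -/
lemma tendsto_log_add_mul_I {x : ℝ} (hx : x ≠ 0) :
    Tendsto (fun δ : ℝ => Complex.log (x + δ * Complex.I)) (𝓝[>] 0) (𝓝 (Complex.log x)) := by
  rcases lt_or_gt_of_ne hx with h | h
  · have h1 := Complex.continuousWithinAt_log_of_re_neg_of_im_zero (z := (x : ℂ)) (by simpa using h)
      (by simp)
    refine h1.tendsto.comp (tendsto_nhdsWithin_iff.2 ⟨tendsto_add_mul_I x, ?_⟩)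
    filter_upwards [self_mem_nhdsWithin] with δ hδ
    have hδ : 0 < δ := hδ
    simpa using hδ.le
  · exact (continuousAt_clog (Or.inl (by simpa using h))).tendsto.comp (tendsto_add_mul_I x)

lemma tendsto_keyholeReg (hy : ∀ i, 0 < y i) (p : ℕ) {x : ℝ} (hx : x ≠ 0) (hxy : ∀ i, x < y i) :
    Tendsto (fun δ : ℝ => keyholeReg β y p (x + δ * Complex.I)) (𝓝[>] 0)
      (𝓝 (keyholeReg β y p x)) := by
  have hx' : (x : ℂ) ≠ 0 := by exact_mod_cast hx
  have h1 := (tendsto_log_add_mul_I hx).pow p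
  have h2 : Tendsto (fun δ : ℝ => keyholeProd β y (x + δ * Complex.I)) (𝓝[>] 0)
      (𝓝 (keyholeProd β y x)) :=
    (differentiableAt_keyholeProd fun i => one_sub_div_mem_slitPlane_of_re_lt hy
      (by simpa using hxy i)).continuousAt.tendsto.comp (tendsto_add_mul_I x)
  simp only [keyholeReg, re_add_mul_I, Complex.ofReal_re]
  refine ((h1.mul h2).div (tendsto_add_mul_I x) hx').sub ?_
  split_ifs
  · exact h1.div (tendsto_add_mul_I x) hx'
  · exact tendsto_const_nhds

/-- A dominating function for the regularized integrand near the real axis. -/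
lemma exists_bound_keyholeReg (hβ : 1 ≤ β) (hd : 1 ≤ d) (hy : ∀ i, 0 < y i) (p : ℕ) {ε : ℝ}
    (hε : 0 < ε) (hεy : ∀ i, ε < y i) : ∃ B : ℝ → ℝ, IntegrableOn B (Set.Iic ε) ∧
      ∀ x : ℝ, x ≤ ε → x ≠ 0 → ∀ δ : ℝ, 0 ≤ δ → δ ≤ 1 →
        ‖keyholeReg β y p (x + δ * Complex.I)‖ ≤ B x := by
  obtain ⟨C, R, hC, hR, h⟩ := exists_norm_keyholeIntegrand_le' (β := β) (y := y) hβ hd hy p one_pos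
  obtain ⟨C', hC', hlog⟩ := exists_norm_log_pow_le_of_norm_le p (show 0 < 2 + ε by positivity)
  have hS : ∀ z ∈ Set.Icc (-1) ε ×ℂ Set.Icc (0 : ℝ) 1, ∀ i, z.re < y i :=
    fun z hz i => lt_of_le_of_lt hz.1.2 (hεy i)
  -- Near 0 the regularized integrand is `log z ^ p` times the difference quotient of the product at
  -- 0. That quotient is continuous on a compact rectangle, so only the logarithmic singularity
  -- remains.
  obtain ⟨M, hM⟩ : ∃ M, ∀ z ∈ Set.Icc (-1) ε ×ℂ Set.Icc (0 : ℝ) 1,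
      ‖dslope (keyholeProd β y) 0 z‖ ≤ M := by
    have hopen : IsOpen {z : ℂ | ∀ i, z.re < y i} := by
      simp only [Set.ofPred_forall]
      exact isOpen_iInter_of_finite fun i => isOpen_lt Complex.continuous_re continuous_const
    have hdiff : ∀ z : ℂ, (∀ i, z.re < y i) → DifferentiableAt ℂ (keyholeProd β y) z :=
      fun z hz => differentiableAt_keyholeProd fun i => one_sub_div_mem_slitPlane_of_re_lt hy (hz i)
    have hc : ContinuousOn (dslope (keyholeProd β y) 0) {z : ℂ | ∀ i, z.re < y i} := by
      refine (continuousOn_dslope (hopen.mem_nhds ?_)).2 ⟨?_, ?_⟩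
      · simpa using hy
      · exact fun z hz => (hdiff z hz).continuousAt.continuousWithinAt
      · exact hdiff 0 (by simpa using hy)
    exact (isCompact_Icc.reProdIm isCompact_Icc).exists_bound_of_continuousOn (hc.mono hS)
  have hM0 : 0 ≤ M := (norm_nonneg _).trans (hM 0 (by
    refine ⟨⟨?_, ?_⟩, ?_, ?_⟩ <;> simp [hε.le]))
  have i1 : IntegrableOn (fun x : ℝ => C * |x| ^ (-(5 / 4) : ℝ)) (Set.Iic (-1)) := by
    have : IntegrableOn (fun x : ℝ => C * |x| ^ (-(5 / 4) : ℝ)) (Set.Ici (-(-1))) := by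
      rw [integrableOn_Ici_iff_integrableOn_Ioi, neg_neg]
      refine IntegrableOn.congr_fun (f := fun x : ℝ => C * x ^ (-(5 / 4) : ℝ)) ?_ (fun x hx => ?_)
        measurableSet_Ioi
      · exact (integrableOn_Ioi_rpow_of_lt (by norm_num) one_pos).const_mul C
      · simp only [abs_of_pos (one_pos.trans (Set.mem_Ioi.1 hx))]
    simpa only [abs_neg] using this.comp_neg_Iic
  have i2 : IntegrableOn (fun x : ℝ => C' * M * |x| ^ (-(1 / 4) : ℝ)) (Set.Ioc (-1) ε) := by
    have hpos : ∀ r : ℝ, 0 ≤ r → IntervalIntegrable (fun x : ℝ => C' * M * |x| ^ (-(1 / 4) : ℝ))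
        volume 0 r := by
      intro r hr
      have := (intervalIntegral.intervalIntegrable_rpow' (a := 0) (b := r)
        (show (-1 : ℝ) < -(1 / 4) by norm_num)).const_mul (C' * M)
      refine this.congr fun x hx => ?_
      rw [Set.uIoc_of_le hr] at hx
      simp only [abs_of_pos hx.1]
    have hneg := (IntervalIntegrable.iff_comp_neg).1 (hpos 1 zero_le_one)
    simp only [abs_neg, neg_zero] at hneg
    have := hneg.symm.trans (hpos ε hε.le)
    rwa [intervalIntegrable_iff_integrableOn_Ioc_of_le (by linarith)] at this
  refine ⟨fun x => (Set.Iic (-1)).indicator (fun x => C * |x| ^ (-(5 / 4) : ℝ)) x +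
    (Set.Ioc (-1) ε).indicator (fun x => C' * M * |x| ^ (-(1 / 4) : ℝ)) x, ?_, ?_⟩
  · refine (Integrable.integrableOn ?_).add (Integrable.integrableOn ?_)
    · exact (integrable_indicator_iff measurableSet_Iic).2 i1
    · exact (integrable_indicator_iff measurableSet_Ioc).2 i2
  · intro x hx hx0 δ hδ0 hδ1
    have hre := abs_re_le_norm_add_mul_I x δ
    have hx0' : 0 < |x| := abs_pos.2 hx0
    beta_reduce
    by_cases hx1 : -1 < x
    · rw [Set.indicator_of_notMem (show x ∉ Set.Iic (-1) from not_le.2 hx1),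
        Set.indicator_of_mem (show x ∈ Set.Ioc (-1) ε from ⟨hx1, hx⟩), zero_add,
        keyholeReg, re_add_mul_I, if_pos hx1]
      set z := (x : ℂ) + δ * Complex.I with hz
      have hz0 : z ≠ 0 := by
        rw [← norm_pos_iff]; exact hx0'.trans_le hre
      have hzS : z ∈ Set.Icc (-1) ε ×ℂ Set.Icc (0 : ℝ) 1 := by
        refine ⟨?_, ?_⟩
        · simp only [Set.mem_preimage, hz, re_add_mul_I]; exact ⟨hx1.le, hx⟩
        · simp only [Set.mem_preimage, hz, im_add_mul_I]; exact ⟨hδ0, hδ1⟩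
      have h1 : keyholeProd β y 0 = 1 := by simp [keyholeProd]
      have e : keyholeIntegrand β y p z - Complex.log z ^ p / z =
          Complex.log z ^ p * dslope (keyholeProd β y) 0 z := by
        rw [dslope_of_ne _ hz0, slope_def_field, h1, keyholeIntegrand_eq]
        field_simp; ring
      rw [e, norm_mul, norm_pow]
      have hzn : ‖z‖ ≤ 2 + ε := by
        refine (norm_add_le _ _).trans ?_
        rw [norm_mul, Complex.norm_I, mul_one, Complex.norm_real, Complex.norm_real,
          Real.norm_eq_abs, Real.norm_eq_abs, abs_of_nonneg hδ0]
        have : |x| ≤ 1 + ε := abs_le.2 ⟨by linarith, by linarith⟩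
        linarith
      calc ‖Complex.log z‖ ^ p * ‖dslope (keyholeProd β y) 0 z‖
          ≤ C' * ‖z‖ ^ (-(1 / 4) : ℝ) * M := by
            gcongr
            · exact hlog z hz0 hzn
            · exact hM z hzS
        _ = C' * M * ‖z‖ ^ (-(1 / 4) : ℝ) := by ring
        _ ≤ C' * M * |x| ^ (-(1 / 4) : ℝ) := by
            refine mul_le_mul_of_nonneg_left ?_ (by positivity)
            exact Real.rpow_le_rpow_of_nonpos hx0' hre (by norm_num)
    · have hx1' : x ≤ -1 := not_lt.1 hx1
      rw [Set.indicator_of_mem (show x ∈ Set.Iic (-1) from hx1'),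
        Set.indicator_of_notMem (show x ∉ Set.Ioc (-1) ε from fun h => hx1 h.1), add_zero,
        keyholeReg, re_add_mul_I, if_neg hx1, sub_zero]
      have hx2 : 1 ≤ |x| := by rw [abs_of_neg (by linarith)]; linarith
      refine (h _ (Or.inr (Or.inr ⟨?_, hx2.trans hre⟩))).trans ?_
      · rw [re_add_mul_I]; linarith
      · refine mul_le_mul_of_nonneg_left ?_ hC.le
        exact Real.rpow_le_rpow_of_nonpos hx0' hre (by norm_num)

lemma integrableOn_keyholeReg (hβ : 1 ≤ β) (hd : 1 ≤ d) (hy : ∀ i, 0 < y i) (p : ℕ) {ε : ℝ}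
    (hε : 0 < ε) (hεy : ∀ i, ε < y i) {δ : ℝ} (h0 : 0 ≤ δ) (h1 : δ ≤ 1) :
    IntegrableOn (fun x : ℝ => keyholeReg β y p (x + δ * Complex.I)) (Set.Iic ε) := by
  obtain ⟨B, hB, hb⟩ := exists_bound_keyholeReg (β := β) hβ hd hy p hε hεy
  refine Integrable.mono' hB ?_ ?_
  · exact ((measurable_keyholeReg p).comp (by fun_prop)).aestronglyMeasurable
  · rw [ae_restrict_iff' measurableSet_Iic]
    filter_upwards [Measure.ae_ne volume (0 : ℝ)] with x hx hxε
    exact hb x hxε hx δ h0 h1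

lemma tendsto_integral_keyholeReg (hβ : 1 ≤ β) (hd : 1 ≤ d) (hy : ∀ i, 0 < y i) (p : ℕ) {ε : ℝ}
    (hε : 0 < ε) (hεy : ∀ i, ε < y i) :
    Tendsto (fun δ : ℝ => ∫ x in Set.Iic ε, keyholeReg β y p (x + δ * Complex.I)) (𝓝[>] 0)
      (𝓝 (∫ x : ℝ in Set.Iic ε, keyholeReg β y p x)) := by
  obtain ⟨B, hB, hb⟩ := exists_bound_keyholeReg (β := β) hβ hd hy p hε hεy
  refine tendsto_integral_filter_of_dominated_convergence B ?_ ?_ hB ?_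
  · exact Eventually.of_forall fun δ =>
      ((measurable_keyholeReg p).comp (by fun_prop)).aestronglyMeasurable
  · filter_upwards [Ioo_mem_nhdsGT (one_pos (α := ℝ))] with δ hδ
    rw [ae_restrict_iff' measurableSet_Iic]
    filter_upwards [Measure.ae_ne volume (0 : ℝ)] with x hx hxε
    exact hb x hxε hx δ hδ.1.le hδ.2.le
  · rw [ae_restrict_iff' measurableSet_Iic]
    filter_upwards [Measure.ae_ne volume (0 : ℝ)] with x hx hxε
    exact tendsto_keyholeReg hy p hx fun i => lt_of_le_of_lt hxε (hεy i)

/-- The part removed from the integrand has the primitive `log ^ (p + 1) / (p + 1)`, so it is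
restored exactly. -/
lemma integral_log_pow_div (p : ℕ) {ε δ : ℝ} (hε : 0 < ε) (hδ : 0 < δ) :
    IntegrableOn (fun x : ℝ => if -1 < x then Complex.log (x + δ * Complex.I) ^ p /
        (x + δ * Complex.I) else 0) (Set.Iic ε) ∧
      ∫ x in Set.Iic ε, (if -1 < x then Complex.log (x + δ * Complex.I) ^ p /
        (x + δ * Complex.I) else 0) =
      (Complex.log (ε + δ * Complex.I) ^ (p + 1) - Complex.log ((-1 : ℝ) + δ * Complex.I) ^ (p + 1))
        / ((p : ℂ) + 1) := by
  have hs : ∀ x : ℝ, (x : ℂ) + δ * Complex.I ∈ Complex.slitPlane := fun x =>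
    Or.inr (by rw [im_add_mul_I]; exact hδ.ne')
  have hp : ((p : ℂ) + 1) ≠ 0 := by exact_mod_cast Nat.succ_ne_zero p
  have hder : ∀ x : ℝ, HasDerivAt
      (fun x : ℝ => Complex.log (x + δ * Complex.I) ^ (p + 1) / ((p : ℂ) + 1))
      (Complex.log (x + δ * Complex.I) ^ p / (x + δ * Complex.I)) x := by
    intro x
    have h1 : HasDerivAt (fun x : ℝ => (x : ℂ) + δ * Complex.I) 1 x :=
      (Complex.ofRealCLM.hasDerivAt (x := x)).add_const _
    have h2 := ((h1.clog_real (hs x)).pow (p + 1)).div_const ((p : ℂ) + 1)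
    refine h2.congr_deriv ?_
    push_cast
    field_simp
  have hcont : Continuous fun x : ℝ =>
        Complex.log (x + δ * Complex.I) ^ p / (x + δ * Complex.I) := by
    refine Continuous.div ?_ (by fun_prop) fun x => Complex.slitPlane_ne_zero (hs x)
    exact (Continuous.clog (by fun_prop) hs).pow p
  have e : (fun x : ℝ => if -1 < x then Complex.log (x + δ * Complex.I) ^ p /
        (x + δ * Complex.I) else 0) = (Set.Ioi (-1)).indicator
        fun x : ℝ => Complex.log (x + δ * Complex.I) ^ p / (x + δ * Complex.I) := by
    funext x; simp [Set.indicator_apply]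
  have hinter : Set.Iic ε ∩ Set.Ioi (-1) = Set.Ioc (-1) ε := by
    rw [Set.inter_comm]; rfl
  rw [e]
  constructor
  · rw [IntegrableOn, integrable_indicator_iff measurableSet_Ioi, IntegrableOn,
      Measure.restrict_restrict measurableSet_Ioi, Set.inter_comm, hinter]
    exact (hcont.intervalIntegrable (-1) ε).1
  · rw [setIntegral_indicator measurableSet_Ioi, hinter,
      ← intervalIntegral.integral_of_le (by linarith),
      intervalIntegral.integral_eq_sub_of_hasDerivAt (fun x _ => hder x)
        (hcont.intervalIntegrable _ _), sub_div]

/-- As the height tends to 0, dominated convergence treats the regularized part, the primitive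
treats the singular part, and the vertical side at `ε` shrinks to a point. -/
lemma tendsto_keyholeLeft (hβ : 1 ≤ β) (hd : 1 ≤ d) (hy : ∀ i, 0 < y i) (p : ℕ) {ε : ℝ}
    (hε : 0 < ε) (hεy : ∀ i, ε < y i) :
    Tendsto (keyholeLeft β y p ε) (𝓝[>] 0)
      (𝓝 ((∫ x : ℝ in Set.Iic ε, keyholeReg β y p x) +
        (Complex.log ε ^ (p + 1) - Complex.log (-1 : ℝ) ^ (p + 1)) / ((p : ℂ) + 1) -
        Complex.I * 0)) := by
  have h1 := tendsto_integral_keyholeReg (β := β) hβ hd hy p hε hεy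
  have h2 := (((tendsto_log_add_mul_I hε.ne').pow (p + 1)).sub
    ((tendsto_log_add_mul_I (x := -1) (by norm_num)).pow (p + 1))).div_const ((p : ℂ) + 1)
  have h3 : Tendsto (fun δ : ℝ => ∫ t in (0 : ℝ)..δ, keyholeIntegrand β y p (ε + t * Complex.I))
      (𝓝[>] 0) (𝓝 0) := by
    have := (intervalIntegral.continuous_primitive
      (intervalIntegrable_keyholeIntegrand_vertical (β := β) hy p hε hεy) 0).tendsto 0
    rw [intervalIntegral.integral_same] at this
    exact this.mono_left nhdsWithin_le_nhds
  refine ((h1.add h2).sub (h3.const_mul Complex.I)).congr' ?_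
  filter_upwards [Ioo_mem_nhdsGT (one_pos (α := ℝ))] with δ hδ
  rw [keyholeLeft]
  congr 1
  obtain ⟨i4, e4⟩ := integral_log_pow_div p hε hδ.1
  rw [← e4, ← integral_add (integrableOn_keyholeReg hβ hd hy p hε hεy hδ.1.le hδ.2.le) i4]
  refine integral_congr_ae (Eventually.of_forall fun x => ?_)
  simp only [keyholeReg, re_add_mul_I, sub_add_cancel]

/-- On `(0, ε)` the regularized integrand is real, and so is `log ε`; the imaginary part therefore
forgets `ε`. The other end `-1` of the singular part leaves `-(π i) ^ (p + 1) / (p + 1)`. -/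
lemma keyholeLeft_im (hβ : 1 ≤ β) (hd : 1 ≤ d) (hy : ∀ i, 0 < y i) (p : ℕ) {ε η : ℝ}
    (hε : 0 < ε) (hεy : ∀ i, ε < y i) (hη : 0 < η) :
    (keyholeLeft β y p ε η).im / Real.pi = keyholeValue β y p := by
  have h1 := tendsto_keyholeLeft (β := β) hβ hd hy p hε hεy
  have h2 : Tendsto (keyholeLeft β y p ε) (𝓝[>] 0) (𝓝 (keyholeLeft β y p ε η)) := by
    refine tendsto_const_nhds.congr' ?_
    filter_upwards [Ioo_mem_nhdsGT hη] with δ hδ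
    exact (keyholeLeft_eq hβ hd hy p hε hεy hδ.1 hη hδ.2.le).symm
  rw [tendsto_nhds_unique h2 h1, keyholeValue]
  congr 1
  have hint : IntegrableOn (fun x : ℝ => keyholeReg β y p x) (Set.Iic ε) := by
    simpa using integrableOn_keyholeReg (β := β) hβ hd hy p hε hεy le_rfl zero_le_one
  rw [← Set.Iic_union_Ioc_eq_Iic hε.le, setIntegral_union (Set.Iic_disjoint_Ioc le_rfl)
    measurableSet_Ioc (hint.mono_set (Set.Iic_subset_Iic.2 hε.le))
    (hint.mono_set Set.Ioc_subset_Iic_self)]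
  have hreal : (∫ x : ℝ in Set.Ioc 0 ε, keyholeReg β y p x).im = 0 := by
    have hi := integral_im (𝕜 := ℂ) (hint.mono_set (Set.Ioc_subset_Iic_self : Set.Ioc 0 ε ⊆ _))
    simp only [RCLike.im_eq_complex_im] at hi
    rw [← hi]
    refine setIntegral_eq_zero_of_forall_eq_zero fun x hx => ?_
    have hx0 : 0 < x := hx.1
    have hs : (x : ℂ) ∈ Complex.slitPlane := Or.inl (by simpa using hx0)
    rw [keyholeReg, if_pos (by simp; linarith), Complex.sub_im]
    have h3 : (keyholeIntegrand β y p x).im = 0 := by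
      rw [← Complex.conj_eq_iff_im, ← keyholeIntegrand_conj hs fun i =>
        one_sub_div_mem_slitPlane_of_re_lt hy (by simpa using lt_of_le_of_lt hx.2 (hεy i)),
        Complex.conj_ofReal]
    rw [h3, ← Complex.ofReal_log hx0.le, ← Complex.ofReal_pow, ← Complex.ofReal_div,
      Complex.ofReal_im, sub_zero]
  have hlog : Complex.log ((-1 : ℝ) : ℂ) = Real.pi * Complex.I := by
    push_cast; exact Complex.log_neg_one
  have hlogε : (Complex.log ε ^ (p + 1) / ((p : ℂ) + 1)).im = 0 := by
    rw [← Complex.ofReal_log hε.le, ← Complex.ofReal_pow]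
    have : ((p : ℂ) + 1) = ((p + 1 : ℝ) : ℂ) := by push_cast; rfl
    rw [this, ← Complex.ofReal_div, Complex.ofReal_im]
  rw [mul_zero, sub_zero, sub_div, Complex.add_im, Complex.add_im, Complex.sub_im, hreal,
    hlogε, hlog]
  ring

/-- The keyhole integral tends to its value as the endpoint goes to infinity. -/
theorem tendsto_keyholeIntegral (hβ : 1 ≤ β) (hd : 1 ≤ d) (hy : ∀ i, 0 < y i) (p : ℕ) {ε η : ℝ}
    (hε : 0 < ε) (hεy : ∀ i, ε < y i) (hη : 0 < η) :
    Tendsto (fun R : ℝ => keyholeIntegral β y p ε η R) atTop (𝓝 (keyholeValue β y p : ℂ)) := by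
  rw [← keyholeLeft_im hβ hd hy p hε hεy hη]
  simp only [keyholeIntegral_eq_im hy p _ hε hεy hη]
  have h := tendsto_keyholeUpper (β := β) (ε := ε) hβ hd hy p hη
  exact (Complex.continuous_ofReal.tendsto _).comp
    (((Complex.continuous_im.tendsto _).comp h).div_const _)

/-- At `z = -t` the cutoff `-1 < Re z` becomes `t < 1`, and the sign of `1 / z = -1 / t` reverses
the difference of product and indicator. -/
lemma keyholeReg_neg (hy : ∀ i, 0 < y i) (p : ℕ) {t : ℝ} (ht : 0 < t) :
    keyholeReg β y p ((-t : ℝ) : ℂ) =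
      (Real.log t + Real.pi * Complex.I) ^ p * ((cutoffDiff β y t / t : ℝ) : ℂ) := by
  have hlog : Complex.log ((-t : ℝ) : ℂ) = Real.log t + Real.pi * Complex.I := by
    rw [Complex.log, Complex.norm_real, Complex.arg_ofReal_of_neg (by linarith), norm_neg,
      Real.norm_eq_abs, abs_of_pos ht]
  have hprod : keyholeProd β y ((-t : ℝ) : ℂ) =
      ((∏ i, (1 + t / y i) ^ (-(β : ℝ) / 2) : ℝ) : ℂ) := by
    rw [keyholeProd, Complex.ofReal_prod]
    refine Finset.prod_congr rfl fun i _ => ?_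
    have := hy i
    rw [Complex.ofReal_cpow (by positivity)]
    push_cast
    congr 1
    ring
  have ht' : (t : ℂ) ≠ 0 := by exact_mod_cast ht.ne'
  rw [keyholeReg, keyholeIntegrand_eq, hlog, hprod, Complex.ofReal_re]
  by_cases h1 : t < 1
  · rw [if_pos (by linarith), cutoffDiff, Set.indicator_of_mem (show t ∈ Set.Ioo 0 1 from ⟨ht, h1⟩)]
    push_cast
    simp only [Pi.one_apply, Complex.ofReal_one]
    field_simp
    ring
  · rw [if_neg (by linarith), cutoffDiff, 
      Set.indicator_of_notMem (show t ∉ Set.Ioo 0 1 from fun h => h1 h.2)]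
    push_cast
    field_simp
    ring

lemma im_integral_keyholeReg (hβ : 1 ≤ β) (hd : 1 ≤ d) (hy : ∀ i, 0 < y i) (p : ℕ) :
    (∫ x : ℝ in Set.Iic 0, keyholeReg β y p x).im = ∫ t in Set.Ioi (0 : ℝ),
      ((Real.log t + Real.pi * Complex.I) ^ p).im * (cutoffDiff β y t / t) := by
  obtain ⟨ε, hε, hεy⟩ : ∃ ε : ℝ, 0 < ε ∧ ∀ i, ε < y i := by
    have : Nonempty (Fin d) := ⟨⟨0, hd⟩⟩
    obtain ⟨i0, hi0⟩ := Finite.exists_min y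
    have := hy i0
    exact ⟨y i0 / 2, by positivity, fun i => by linarith [hi0 i]⟩
  have hint : IntegrableOn (fun x : ℝ => keyholeReg β y p x) (Set.Iic 0) := by
    have : IntegrableOn (fun x : ℝ => keyholeReg β y p x) (Set.Iic ε) := by
      simpa using integrableOn_keyholeReg (β := β) hβ hd hy p hε hεy le_rfl zero_le_one
    exact this.mono_set (Set.Iic_subset_Iic.2 hε.le)
  have hi := integral_im (𝕜 := ℂ) hint
  simp only [RCLike.im_eq_complex_im] at hi
  rw [← hi]
  have := integral_comp_neg_Ioi (0 : ℝ) fun x : ℝ => (keyholeReg β y p x).im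
  rw [neg_zero] at this
  rw [← this]
  refine setIntegral_congr_fun measurableSet_Ioi fun t ht => ?_
  rw [keyholeReg_neg hy p ht, Complex.im_mul_ofReal]

/-- Here `(π i) ^ 2 / 2` is real and `Im (log t + π i) = π`. -/
lemma keyholeValue_one (hβ : 1 ≤ β) (hd : 1 ≤ d) (hy : ∀ i, 0 < y i) :
    keyholeValue β y 1 = ∫ x in Set.Ioi (0 : ℝ), cutoffDiff β y x / x := by
  rw [keyholeValue, im_integral_keyholeReg hβ hd hy]
  have e : ((Real.pi * Complex.I) ^ (1 + 1) / ((1 : ℕ) + 1 : ℂ)).im = 0 := by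
    have : ((Real.pi * Complex.I) ^ (1 + 1) / ((1 : ℕ) + 1 : ℂ)) =
        ((-Real.pi ^ 2 / 2 : ℝ) : ℂ) := by
      push_cast; rw [mul_pow, Complex.I_sq]; ring
    rw [this, Complex.ofReal_im]
  rw [e, sub_zero]
  simp only [pow_one, Complex.add_im, Complex.ofReal_im, zero_add,
    Complex.im_ofReal_mul, Complex.I_im, mul_one]
  rw [integral_const_mul]
  field_simp

/-- The square of `log t + π i` has imaginary part `2 π log t`, and `-(π i) ^ 3 / 3` is responsible
for the extra `π ^ 2 / 3`. -/
lemma keyholeValue_two (hβ : 1 ≤ β) (hd : 1 ≤ d) (hy : ∀ i, 0 < y i) :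
    keyholeValue β y 2 = 2 * (∫ x in Set.Ioi (0 : ℝ), cutoffDiff β y x * (Real.log x / x)) +
      Real.pi ^ 2 / 3 := by
  rw [keyholeValue, im_integral_keyholeReg hβ hd hy]
  have e : ((Real.pi * Complex.I) ^ (2 + 1) / ((2 : ℕ) + 1 : ℂ)).im = -(Real.pi ^ 3 / 3) := by
    have : ((Real.pi * Complex.I) ^ (2 + 1) / ((2 : ℕ) + 1 : ℂ)) =
        ((-(Real.pi ^ 3 / 3) : ℝ) : ℂ) * Complex.I := by
      push_cast; rw [mul_pow, pow_succ Complex.I, Complex.I_sq]; ring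
    rw [this, Complex.im_ofReal_mul, Complex.I_im, mul_one]
  have e2 : ∀ t : ℝ, ((Real.log t + Real.pi * Complex.I) ^ 2).im * (cutoffDiff β y t / t) =
      2 * Real.pi * (cutoffDiff β y t * (Real.log t / t)) := by
    intro t
    simp only [sq, Complex.mul_im, Complex.add_im, Complex.add_re, Complex.ofReal_im,
      Complex.ofReal_re, Complex.I_im, Complex.I_re, Complex.mul_re]
    ring
  simp only [e, e2]
  rw [integral_const_mul]
  field_simp
  ring

end boundary

/-! ### Independence of the endpoint when `β d` is even -/

section even

variable {β d : ℕ} {y : Fin d → ℝ}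

lemma Complex.neg_cpow_of_im_pos {u : ℂ} (hu : 0 < u.im) (a : ℂ) :
    (-u) ^ a = Complex.exp (-(Real.pi * Complex.I * a)) * u ^ a := by
  have h0 : u ≠ 0 := fun h => by simp [h] at hu
  have hlog : Complex.log (-u) = Complex.log u - Real.pi * Complex.I := by
    rw [Complex.log, Complex.log, norm_neg, Complex.arg_neg_eq_arg_sub_pi_of_im_pos hu]
    push_cast; ring
  rw [Complex.cpow_def_of_ne_zero (neg_ne_zero.2 h0), Complex.cpow_def_of_ne_zero h0, hlog,
    ← Complex.exp_add]
  congr 1; ring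

/-- The continuation of the keyhole integrand from the upper half plane to the right of all `yᵢ`. -/
noncomputable def keyholeCont (β : ℕ) {d : ℕ} (y : Fin d → ℝ) (p : ℕ) (z : ℂ) : ℂ :=
  Complex.log z ^ p * (Complex.exp (Real.pi * Complex.I * (β / 2)) ^ d *
    ∏ i, (z / (y i : ℂ) - 1) ^ (-(β : ℂ) / 2)) / z

lemma keyholeCont_eq (hy : ∀ i, 0 < y i) (p : ℕ) {z : ℂ} (hz : 0 < z.im) :
    keyholeIntegrand β y p z = keyholeCont β y p z := by
  rw [keyholeIntegrand, keyholeCont]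
  congr 2
  have : Complex.exp (Real.pi * Complex.I * (β / 2)) ^ d =
      ∏ _i : Fin d, Complex.exp (Real.pi * Complex.I * (β / 2)) := by
    rw [Finset.prod_const, Finset.card_univ, Fintype.card_fin]
  rw [this, ← Finset.prod_mul_distrib]
  refine Finset.prod_congr rfl fun i _ => ?_
  rw [← neg_sub, Complex.neg_cpow_of_im_pos]
  · congr 2; ring
  · rw [Complex.sub_im, Complex.one_im, Complex.div_ofReal_im, sub_zero]
    exact div_pos hz (hy i)

lemma differentiableAt_keyholeCont (hd : 1 ≤ d) (hy : ∀ i, 0 < y i) (p : ℕ) {z : ℂ}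
    (hz : ∀ i, y i < z.re) : DifferentiableAt ℂ (keyholeCont β y p) z := by
  have hz0 : 0 < z.re := (hy ⟨0, hd⟩).trans (hz _)
  have hs : z ∈ Complex.slitPlane := Or.inl hz0
  unfold keyholeCont
  refine DifferentiableAt.div (((differentiableAt_id.clog hs).pow p).mul
    (DifferentiableAt.const_mul ?_ _)) differentiableAt_id (Complex.slitPlane_ne_zero hs)
  refine DifferentiableAt.fun_finsetProd fun i _ => ?_
  refine DifferentiableAt.cpow_const (by fun_prop) (Or.inl ?_)
  rw [Complex.sub_re, Complex.one_re, Complex.div_ofReal_re, sub_pos]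
  exact (one_lt_div (hy i)).2 (hz i)

lemma im_keyholeCont_ofReal (hd : 1 ≤ d) (hy : ∀ i, 0 < y i) (heven : Even (β * d)) (p : ℕ) {x : ℝ}
    (hx : ∀ i, y i < x) : (keyholeCont β y p x).im = 0 := by
  have hx0 : 0 < x := (hy ⟨0, hd⟩).trans (hx _)
  obtain ⟨k, hk⟩ := heven
  have hk' : (β : ℂ) * d = k + k := by exact_mod_cast hk
  -- The total phase is `exp (π i β d / 2)`, a sign because `β d / 2` is an integer.
  have e1 : Complex.exp (Real.pi * Complex.I * (β / 2)) ^ d = (((-1) ^ k : ℝ) : ℂ) := by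
    rw [← Complex.exp_nat_mul]
    have : (d : ℂ) * (Real.pi * Complex.I * (β / 2)) = k * (Real.pi * Complex.I) := by
      linear_combination (Real.pi * Complex.I / 2) * hk'
    rw [this, Complex.exp_nat_mul, Complex.exp_pi_mul_I]
    push_cast; rfl
  have e2 : ∏ i, ((x : ℂ) / (y i : ℂ) - 1) ^ (-(β : ℂ) / 2) =
      ((∏ i, (x / y i - 1) ^ (-(β : ℝ) / 2) : ℝ) : ℂ) := by
    rw [Complex.ofReal_prod]
    refine Finset.prod_congr rfl fun i _ => ?_
    have : 0 ≤ x / y i - 1 := by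
      rw [sub_nonneg]; exact ((one_lt_div (hy i)).2 (hx i)).le
    rw [Complex.ofReal_cpow this]
    push_cast; rfl
  rw [keyholeCont, e1, e2, ← Complex.ofReal_log hx0.le, ← Complex.ofReal_pow, ← Complex.ofReal_mul,
    ← Complex.ofReal_mul, ← Complex.ofReal_div, Complex.ofReal_im]

/-- Cauchy's theorem for the continuation on `[R, R'] × [0, η]`: the difference of the two contours
is the bottom side, where the continued integrand is real. -/
lemma keyholeUpper_im_eq_of_even (hd : 1 ≤ d) (hy : ∀ i, 0 < y i) (heven : Even (β * d)) (p : ℕ)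
    {ε η R R' : ℝ} (hη : 0 < η) (hR : ∀ i, y i < R) (hRR : R ≤ R') :
    (keyholeUpper β y p ε η R').im = (keyholeUpper β y p ε η R).im := by
  have hrect := Complex.integral_boundary_rect_eq_zero_of_differentiableOn
    (keyholeCont β y p) ⟨R, 0⟩ ⟨R', η⟩ (fun z hz => by
      refine (differentiableAt_keyholeCont hd hy p fun i => ?_).differentiableWithinAt
      have h2 : z.re ∈ Set.uIcc R R' := hz.1
      rw [Set.uIcc_of_le hRR] at h2
      exact (hR i).trans_le h2.1)
  simp only [smul_eq_mul] at hrect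
  have hvert : ∀ a : ℝ, ∫ t in (0 : ℝ)..η, keyholeCont β y p (a + t * Complex.I) =
      ∫ t in (0 : ℝ)..η, keyholeIntegrand β y p (a + t * Complex.I) := by
    intro a
    refine intervalIntegral.integral_congr_ae (Eventually.of_forall fun t ht => ?_)
    rw [Set.uIoc_of_le hη.le] at ht
    exact (keyholeCont_eq hy p (by rw [im_add_mul_I]; exact ht.1)).symm
  have htop : ∫ x in R..R', keyholeCont β y p (x + η * Complex.I) =
      ∫ x in R..R', keyholeIntegrand β y p (x + η * Complex.I) := by
    congr 1; funext x
    exact (keyholeCont_eq hy p (by rw [im_add_mul_I]; exact hη)).symm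
  rw [hvert, hvert, htop] at hrect
  have hbot : (∫ x in R..R', keyholeCont β y p (x + (0 : ℝ) * Complex.I)).im = 0 := by
    have hint : IntervalIntegrable (fun x : ℝ => keyholeCont β y p (x + (0 : ℝ) * Complex.I))
        volume R R' := by
      refine ContinuousOn.intervalIntegrable fun x hx => ?_
      rw [Set.uIcc_of_le hRR] at hx
      have h : ContinuousAt (keyholeCont β y p) ((x : ℂ) + (0 : ℝ) * Complex.I) :=
        (differentiableAt_keyholeCont hd hy p
          (by simpa using fun i => (hR i).trans_le hx.1)).continuousAt
      exact (h.comp_of_eq (f := fun x : ℝ => (x : ℂ) + (0 : ℝ) * Complex.I)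
        (by fun_prop : Continuous fun x : ℝ => (x : ℂ) + (0 : ℝ) * Complex.I).continuousAt
        rfl).continuousWithinAt
    rw [intervalIntegral.integral_of_le hRR]
    have hi := integral_im (𝕜 := ℂ) hint.1
    simp only [RCLike.im_eq_complex_im] at hi
    rw [← hi]
    refine setIntegral_eq_zero_of_forall_eq_zero fun x hx => ?_
    simpa using im_keyholeCont_ofReal hd hy heven p fun i => (hR i).trans hx.1
  have hcont := continuous_keyholeIntegrand_line (β := β) hy p hη.ne'
  have hadd := intervalIntegral.integral_add_adjacent_intervals
    (hcont.intervalIntegrable (μ := volume) ε R) (hcont.intervalIntegrable (μ := volume) R R')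
  have e : keyholeUpper β y p ε η R' - keyholeUpper β y p ε η R =
      -∫ x in R..R', keyholeCont β y p (x + (0 : ℝ) * Complex.I) := by
    rw [keyholeUpper, keyholeUpper, ← hadd]
    linear_combination hrect
  have e' := congrArg Complex.im e
  rw [Complex.sub_im, Complex.neg_im, hbot] at e'
  linarith

/-- For `β d` even the keyhole integral does not depend on the endpoint. -/
theorem keyholeIntegral_eq_of_even (hβ : 1 ≤ β) (hd : 1 ≤ d) (hy : ∀ i, 0 < y i)
    (heven : Even (β * d)) (p : ℕ) {ε η R : ℝ} (hε : 0 < ε) (hεy : ∀ i, ε < y i) (hη : 0 < η)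
    (hR : ∀ i, y i < R) : keyholeIntegral β y p ε η R = (keyholeValue β y p : ℂ) := by
  refine tendsto_nhds_unique (tendsto_const_nhds.congr' ?_)
    (tendsto_keyholeIntegral hβ hd hy p hε hεy hη)
  filter_upwards [eventually_ge_atTop R] with R' hR'
  rw [keyholeIntegral_eq_im hy p _ hε hεy hη, keyholeIntegral_eq_im hy p _ hε hεy hη,
    keyholeUpper_im_eq_of_even hd hy heven p hη hR hR']

end even

/-! ### Gaussian vectors and their quadratic forms -/

section gaussian

/-- A map with an isometric adjoint sends a standard Gaussian vector to a standard one. -/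
lemma map_pi_gaussianReal {ι κ : Type*} [Fintype ι] [Fintype κ] (v : ℝ≥0)
    {L : (ι → ℝ) → (κ → ℝ)} (hL : Measurable L) (L' : (κ → ℝ) → (ι → ℝ))
    (hadj : ∀ x t, ∑ k, L x k * t k = ∑ i, x i * L' t i)
    (hnorm : ∀ t, ∑ i, L' t i ^ 2 = ∑ k, t k ^ 2) :
    (Measure.pi fun _ : ι => gaussianReal 0 v).map L =
      Measure.pi fun _ : κ => gaussianReal 0 v := by
  have : IsProbabilityMeasure ((Measure.pi fun _ : ι => gaussianReal 0 v).map L) :=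
    Measure.isProbabilityMeasure_map hL.aemeasurable
  -- The characteristic function of the image at `t` is that of the source at `L' t`, and it depends
  -- on `t` only through `‖L' t‖ = ‖t‖`.
  rw [← charFun_eq_pi_iff]
  intro t
  have h1 := charFun_pi (μ := fun _ : ι => gaussianReal 0 v) (WithLp.toLp 2 (L' t.ofLp))
  rw [Measure.map_map (by fun_prop) hL, charFun_apply, integral_map (by fun_prop) (by fun_prop)]
  rw [charFun_apply, integral_map (by fun_prop) (by fun_prop)] at h1
  have e : ∀ x : ι → ℝ, inner ℝ ((WithLp.toLp 2 ∘ L) x) t =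
      inner ℝ (WithLp.toLp 2 x) (WithLp.toLp 2 (L' t.ofLp)) := by
    intro x
    simp only [Function.comp, PiLp.inner_apply, RCLike.inner_apply, conj_trivial]
    have := hadj x t.ofLp
    simp only [mul_comm (t.ofLp _), mul_comm (L' t.ofLp _)]
    exact this
  simp only [e]
  rw [h1]
  simp only [charFun_gaussianReal, ← Complex.exp_sum]
  congr 1
  have h2 := hnorm t.ofLp
  have h3 : ∑ i, (L' t.ofLp i : ℂ) ^ 2 = ∑ k, (t.ofLp k : ℂ) ^ 2 := by exact_mod_cast h2
  simp only [Complex.ofReal_zero, mul_zero, zero_mul, zero_sub]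
  simp only [Finset.sum_neg_distrib, ← Finset.sum_div, ← Finset.mul_sum]
  rw [h3]

lemma integral_exp_neg_mul_sq_gaussianReal {v : ℝ≥0} (hv : v ≠ 0) {s : ℝ} (hs : 0 ≤ s) :
    ∫ z, Real.exp (-(s * z ^ 2)) ∂(gaussianReal 0 v) = (1 + 2 * v * s) ^ (-(1 / 2) : ℝ) := by
  have hv' : (0 : ℝ) < v := by exact_mod_cast pos_iff_ne_zero.2 hv
  rw [integral_gaussianReal_eq_integral_smul hv]
  have e : ∀ z : ℝ, gaussianPDFReal 0 v z • Real.exp (-(s * z ^ 2)) =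
      (√(2 * Real.pi * v))⁻¹ * Real.exp (-((1 + 2 * v * s) / (2 * v)) * z ^ 2) := by
    intro z
    rw [gaussianPDFReal, smul_eq_mul, mul_assoc, ← Real.exp_add]
    congr 2
    field_simp
    ring
  simp only [e]
  rw [integral_const_mul, integral_gaussian, ← Real.sqrt_inv, ← Real.sqrt_mul (by positivity)]
  have h1 : (2 * Real.pi * v)⁻¹ * (Real.pi / ((1 + 2 * v * s) / (2 * v))) = (1 + 2 * v * s)⁻¹ := by
    have : (1 + 2 * (v : ℝ) * s) ≠ 0 := by positivity
    have := Real.pi_ne_zero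
    field_simp
  rw [h1, Real.sqrt_eq_rpow, Real.inv_rpow (by positivity), Real.rpow_neg (by positivity)]

variable {β d : ℕ} {y : Fin d → ℝ}

/-- Dividing by `2 v` normalizes each coordinate to the transform `(1 + x / yᵢ) ^ (-1/2)`; the `β`
independent coordinates sharing `yᵢ` raise the exponent to `-β / 2`. -/
lemma integral_exp_neg_sum_sq {v : ℝ≥0} (hv : v ≠ 0) (hy : ∀ i, 0 < y i) {x : ℝ} (hx : 0 < x) :
    ∫ z, Real.exp (-((∑ k : Fin d × Fin β, z k ^ 2 / (2 * v * y k.1)) * x))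
      ∂(Measure.pi fun _ : Fin d × Fin β => gaussianReal 0 v) =
      ∏ i, (1 + x / y i) ^ (-(β : ℝ) / 2) := by
  have hv' : (0 : ℝ) < v := by exact_mod_cast pos_iff_ne_zero.2 hv
  have e : ∀ z : Fin d × Fin β → ℝ,
      Real.exp (-((∑ k : Fin d × Fin β, z k ^ 2 / (2 * v * y k.1)) * x)) =
      ∏ k : Fin d × Fin β, Real.exp (-(x / (2 * v * y k.1) * z k ^ 2)) := by
    intro z
    rw [← Real.exp_sum, Finset.sum_neg_distrib, Finset.sum_mul]
    congr 2
    refine Finset.sum_congr rfl fun k _ => by ring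
  simp only [e]
  rw [integral_fintype_prod_eq_prod (𝕜 := ℝ)
    (fun (k : Fin d × Fin β) z => Real.exp (-(x / (2 * v * y k.1) * z ^ 2)))]
  rw [Fintype.prod_prod_type]
  refine Finset.prod_congr rfl fun i _ => ?_
  have hyi := hy i
  simp only
  rw [integral_exp_neg_mul_sq_gaussianReal hv (by positivity), Finset.prod_const, Finset.card_univ,
    Fintype.card_fin, ← Real.rpow_natCast, ← Real.rpow_mul (by positivity)]
  congr 1
  · field_simp
  · ring

lemma ae_pi_gaussianReal_ne_zero {κ : Type*} [Fintype κ] {v : ℝ≥0} (hv : v ≠ 0) (k : κ) :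
    ∀ᵐ z ∂(Measure.pi fun _ : κ => gaussianReal 0 v), z k ≠ 0 := by
  have h := measurePreserving_eval (fun _ : κ => gaussianReal 0 v) k
  have h2 : ∀ᵐ t ∂(gaussianReal 0 v), t ≠ 0 := by
    have : NullSingletonClass (gaussianReal 0 v) := nullSingletonClass_gaussianReal hv
    exact Measure.ae_ne _ 0
  exact h.quasiMeasurePreserving.ae h2

lemma integrable_sq_eval_pi_gaussianReal {κ : Type*} [Fintype κ] (v : ℝ≥0) (k : κ) :
    Integrable (fun z : κ → ℝ => z k ^ 2) (Measure.pi fun _ : κ => gaussianReal 0 v) := by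
  have h := measurePreserving_eval (fun _ : κ => gaussianReal 0 v) k
  have h2 : Integrable (fun t : ℝ => t ^ 2) (gaussianReal 0 v) := by
    have := (memLp_id_gaussianReal (μ := 0) (v := v) 2)
    exact_mod_cast this.integrable_sq
  exact h.integrable_comp_of_integrable h2

/-- The logarithm of a positive definite quadratic form in Gaussian variables. -/
theorem variance_log_sum_sq {v : ℝ≥0} (hv : v ≠ 0) (hβ : 1 ≤ β) (hd : 1 ≤ d)
    (hy : ∀ i, 0 < y i) :
    MemLp (fun z : Fin d × Fin β → ℝ => Real.log (∑ k, z k ^ 2 / y k.1)) 2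
        (Measure.pi fun _ => gaussianReal 0 v) ∧
      Var[fun z : Fin d × Fin β → ℝ => Real.log (∑ k, z k ^ 2 / y k.1);
          Measure.pi fun _ => gaussianReal 0 v] =
        -2 * (∫ x in Set.Ioi (0 : ℝ), cutoffDiff β y x * (Real.log x / x))
          - (∫ x in Set.Ioi (0 : ℝ), cutoffDiff β y x / x) ^ 2 - Real.pi ^ 2 / 6 := by
  set μ := Measure.pi fun _ : Fin d × Fin β => gaussianReal 0 v
  have hv' : (0 : ℝ) < v := by exact_mod_cast pos_iff_ne_zero.2 hv
  have k0 : Fin d × Fin β := (⟨0, hd⟩, ⟨0, hβ⟩)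
  have hpos : ∀ᵐ z ∂μ, 0 < ∑ k : Fin d × Fin β, z k ^ 2 / y k.1 := by
    filter_upwards [ae_pi_gaussianReal_ne_zero hv k0] with z hz
    refine Finset.sum_pos' (fun k _ => ?_) ⟨k0, Finset.mem_univ _, ?_⟩
    · have := hy k.1; positivity
    · have := hy k0.1; positivity
  have hX : ∀ z : Fin d × Fin β → ℝ, ∑ k : Fin d × Fin β, z k ^ 2 / (2 * v * y k.1) =
      (2 * v : ℝ)⁻¹ * ∑ k : Fin d × Fin β, z k ^ 2 / y k.1 := by
    intro z
    rw [Finset.mul_sum]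
    refine Finset.sum_congr rfl fun k _ => ?_
    have := (hy k.1).ne'
    field_simp
  have hpos' : ∀ᵐ z ∂μ, 0 < ∑ k : Fin d × Fin β, z k ^ 2 / (2 * v * y k.1) := by
    filter_upwards [hpos] with z hz
    rw [hX]; positivity
  -- The normalization by `2 v` only shifts the logarithm by a constant, so the variance does not
  -- see it.
  have hlog : (fun z : Fin d × Fin β → ℝ => Real.log (∑ k, z k ^ 2 / y k.1)) =ᵐ[μ]
      fun z => Real.log (∑ k, z k ^ 2 / (2 * v * y k.1)) + Real.log (2 * v) := by
    filter_upwards [hpos] with z hz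
    rw [hX, Real.log_mul (by positivity) hz.ne', Real.log_inv]; ring
  have hmeas : Measurable fun z : Fin d × Fin β → ℝ =>
      ∑ k : Fin d × Fin β, z k ^ 2 / (2 * v * y k.1) := by fun_prop
  obtain ⟨h1, h2⟩ := variance_log_of_laplace (P := μ) hβ hd hy hmeas hpos'
    (integrable_finsetSum _ fun k _ => (integrable_sq_eval_pi_gaussianReal v k).div_const _)
    (fun x hx => integral_exp_neg_sum_sq hv hy hx)
  refine ⟨(memLp_congr_ae hlog).2 (h1.add (memLp_const _)), ?_⟩
  rw [variance_congr hlog, variance_add_const h1.aestronglyMeasurable, h2]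

/-- The case `β = d = 1`, `y = 1` of the preceding theorem. -/
lemma memLp_log_sq_gaussian {v : ℝ≥0} (hv : v ≠ 0) :
    MemLp (fun t : ℝ => Real.log (t ^ 2)) 2 (gaussianReal 0 v) := by
  have h := (variance_log_sum_sq (y := fun _ : Fin 1 => 1) hv le_rfl le_rfl
    fun _ => one_pos).1
  have h1 := measurePreserving_eval (fun _ : Fin 1 × Fin 1 => gaussianReal 0 v) (0, 0)
  rw [← h1.map_eq, memLp_map_measure_iff]
  · refine h.ae_eq (Eventually.of_forall fun z => ?_)
    simp [Fintype.sum_prod_type]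
  · exact (Real.measurable_log.comp (by fun_prop)).aestronglyMeasurable
  · exact h1.measurable.aemeasurable

end gaussian

/-! ### Independence and comparison of variances -/

section prob

variable {Ω : Type*} [MeasurableSpace Ω] {P : Measure Ω} [IsProbabilityMeasure P]

/-- If the law of `f x Y` does not depend on `x`, then `f X Y` is independent of `X` for `X`
independent of `Y`. -/
lemma indepFun_of_law_const {α γ δ : Type*} [MeasurableSpace α] [MeasurableSpace γ]
    [MeasurableSpace δ] {X : Ω → α} {Y : Ω → γ} (h : IndepFun X Y P) (hX : Measurable X)
    (hY : Measurable Y) {f : α → γ → δ} (hf : Measurable (Function.uncurry f)) {ν : Measure δ}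
    (hν : ∀ x, (P.map Y).map (f x) = ν) :
    IndepFun X (fun ω => f (X ω) (Y ω)) P ∧ P.map (fun ω => f (X ω) (Y ω)) = ν := by
  have : IsProbabilityMeasure (P.map X) := Measure.isProbabilityMeasure_map hX.aemeasurable
  have : IsProbabilityMeasure (P.map Y) := Measure.isProbabilityMeasure_map hY.aemeasurable
  have hfx : ∀ x, Measurable (f x) := fun x => hf.comp measurable_prodMk_left
  obtain ⟨ω0⟩ : Nonempty Ω := nonempty_of_isProbabilityMeasure P
  have : IsProbabilityMeasure ν := by
    rw [← hν (X ω0)]; exact Measure.isProbabilityMeasure_map (hfx _).aemeasurable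
  have hZ : Measurable fun ω => f (X ω) (Y ω) := hf.comp (hX.prodMk hY)
  have hjoint := (indepFun_iff_map_prod_eq_prod_map_map hX.aemeasurable hY.aemeasurable).1 h
  have hprod : P.map (fun ω => (X ω, f (X ω) (Y ω))) = (P.map X).prod ν := by
    symm
    refine Measure.prod_eq fun s t hs ht => ?_
    have e : (fun ω => (X ω, f (X ω) (Y ω))) =
        (fun q : α × γ => (q.1, f q.1 q.2)) ∘ fun ω => (X ω, Y ω) := rfl
    have hm : Measurable fun q : α × γ => (q.1, f q.1 q.2) := measurable_fst.prodMk hf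
    rw [e, ← Measure.map_map hm (hX.prodMk hY), hjoint, Measure.map_apply hm (hs.prod ht),
      Measure.prod_apply (hm (hs.prod ht))]
    -- Slicing a rectangle at `x` gives an event of measure `ν t` for `x ∈ s` and the empty set
    -- otherwise; this is where the constancy of the law enters.
    have e2 : ∀ x, (P.map Y) (Prod.mk x ⁻¹' ((fun q : α × γ => (q.1, f q.1 q.2)) ⁻¹' s ×ˢ t)) =
        s.indicator (fun _ => ν t) x := by
      intro x
      by_cases hx : x ∈ s
      · rw [Set.indicator_of_mem hx, ← hν x, Measure.map_apply (hfx x) ht]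
        congr 1; ext z; simp [hx]
      · rw [Set.indicator_of_notMem hx]
        convert measure_empty (μ := P.map Y) using 2
        ext z; simp [hx]
    simp only [e2]
    rw [lintegral_indicator hs, setLIntegral_const, mul_comm]
  have hlaw : P.map (fun ω => f (X ω) (Y ω)) = ν := by
    have := congrArg (fun m => Measure.map Prod.snd m) hprod
    rw [Measure.map_map measurable_snd (hX.prodMk hZ), Measure.map_snd_prod, measure_univ,
      one_smul] at this
    exact this
  refine ⟨?_, hlaw⟩
  rw [indepFun_iff_map_prod_eq_prod_map_map hX.aemeasurable hZ.aemeasurable, hprod, hlaw]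

/-- Nonnegativity of the variances of `a T + D` and `-a T + D` bounds the covariance on both sides.
-/
lemma abs_variance_add_sub_le {T D : Ω → ℝ} (hT : MemLp T 2 P) (hD : MemLp D 2 P) {a : ℝ}
    (ha : 0 < a) : |Var[T + D; P] - Var[T; P]| ≤ a * Var[T; P] + Var[D; P] / a + Var[D; P] := by
  have h1 := variance_add hT hD
  have h2 : ∀ c : ℝ, 0 ≤ c ^ 2 * Var[T; P] + 2 * (c * cov[T, D; P]) + Var[D; P] := by
    intro c
    have h3 := variance_add (hT.const_smul c) hD
    rw [variance_smul, covariance_smul_left] at h3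
    rw [← h3]
    exact variance_nonneg _ _
  have h4 := h2 a
  have h5 := h2 (-a)
  rw [h1]
  have h6 : a * (a * Var[T; P] + Var[D; P] / a) = a ^ 2 * Var[T; P] + Var[D; P] := by
    field_simp
  have hDn := variance_nonneg D P
  have h7 : 2 * cov[T, D; P] ≤ a * Var[T; P] + Var[D; P] / a := by
    refine le_of_mul_le_mul_left ?_ ha
    rw [h6]; nlinarith
  have h8 : -(a * Var[T; P] + Var[D; P] / a) ≤ 2 * cov[T, D; P] := by
    refine le_of_mul_le_mul_left ?_ ha
    rw [mul_neg, h6]; nlinarith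
  rw [abs_le]
  constructor <;> linarith

/-- A bounded perturbation does not change the asymptotic variance. -/
lemma tendsto_variance_div {T D : ℕ → Ω → ℝ} {V C : ℝ} (hT : ∀ n, MemLp (T n) 2 P)
    (hD : ∀ n, MemLp (D n) 2 P) (hV : ∀ n, Var[T n; P] = n * V) (hC : ∀ n, Var[D n; P] ≤ C) :
    Tendsto (fun n : ℕ => Var[T n + D n; P] / n) atTop (𝓝 V) := by
  have hlim : Tendsto (fun n : ℕ => V / √(n : ℝ) + C / √(n : ℝ) + C / (n : ℝ)) atTop (𝓝 0) := by
    have h1 : Tendsto (fun n : ℕ => √(n : ℝ)) atTop atTop :=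
      Real.tendsto_sqrt_atTop.comp tendsto_natCast_atTop_atTop
    simpa using ((h1.const_div_atTop V).add (h1.const_div_atTop C)).add
      (tendsto_natCast_atTop_atTop.const_div_atTop C)
  rw [tendsto_iff_dist_tendsto_zero]
  refine squeeze_zero' (Eventually.of_forall fun _ => dist_nonneg) ?_ hlim
  filter_upwards [eventually_gt_atTop 0] with n hn
  have hn' : (0 : ℝ) < n := by exact_mod_cast hn
  have hs : 0 < √(n : ℝ) := Real.sqrt_pos.2 hn'
  have hss : √(n : ℝ) * √(n : ℝ) = n := Real.mul_self_sqrt hn'.le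
  -- The choice `a = 1 / √n` balances `a n V` against `C / a`: both are of order `√n`, hence
  -- negligible after division by `n`.
  have h := abs_variance_add_sub_le (hT n) (hD n) (inv_pos.2 hs)
  rw [hV n] at h
  have e : Var[T n + D n; P] / n - V = (Var[T n + D n; P] - n * V) / n := by field_simp
  rw [Real.dist_eq, e, abs_div, abs_of_pos hn', div_le_iff₀ hn']
  refine h.trans ?_
  have hc := hC n
  calc (√(n : ℝ))⁻¹ * (n * V) + Var[D n; P] / (√(n : ℝ))⁻¹ + Var[D n; P]
      ≤ (√(n : ℝ))⁻¹ * (n * V) + C / (√(n : ℝ))⁻¹ + C := by gcongr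
    _ = _ := by
        have e1 : C / √(n : ℝ) * n = C / (√(n : ℝ))⁻¹ := by
          rw [div_inv_eq_mul, div_mul_eq_mul_div, div_eq_iff hs.ne', mul_assoc, hss]
        rw [add_mul, add_mul, e1]
        field_simp

end prob

/-! ### Orbits of products of random operators -/

section randomProduct

variable {ι κ : Type*} [Fintype κ]

/-- The product of the operators `S * Γ (z n)`, `n < N`, with later factors on the left. -/
noncomputable def opProd (S : EuclideanSpace ℝ κ →L[ℝ] EuclideanSpace ℝ κ)
    (Γ : (ι → ℝ) →ₗ[ℝ] (EuclideanSpace ℝ κ →L[ℝ] EuclideanSpace ℝ κ))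
    (z : ℕ × ι → ℝ) :
    ℕ → (EuclideanSpace ℝ κ →L[ℝ] EuclideanSpace ℝ κ)
  | 0 => 1
  | N + 1 => (S * Γ fun i => z (N, i)) * opProd S Γ z N

variable {S : EuclideanSpace ℝ κ →L[ℝ] EuclideanSpace ℝ κ}
  {Γ : (ι → ℝ) →ₗ[ℝ] (EuclideanSpace ℝ κ →L[ℝ] EuclideanSpace ℝ κ)}

lemma opProd_congr {z z' : ℕ × ι → ℝ} {N : ℕ} (h : ∀ n < N, ∀ i, z (n, i) = z' (n, i)) :
    opProd S Γ z N = opProd S Γ z' N := by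
  induction N with
  | zero => rfl
  | succ N ih =>
    rw [opProd, opProd, ih fun n hn => h n (by omega)]
    congr 3
    funext i
    exact h N (by omega) i

/-- Peeling off the first factor on the right, instead of the last on the left, is what the
comparison of the norm with an orbit requires. -/
lemma opProd_succ' (z : ℕ × ι → ℝ) (N : ℕ) :
    opProd S Γ z (N + 1) =
      opProd S Γ (fun k => z (k.1 + 1, k.2)) N * (S * Γ fun i => z (0, i)) := by
  induction N with
  | zero => simp [opProd]
  | succ N ih =>
    rw [opProd, ih, opProd]
    simp only [mul_assoc]

variable [Fintype ι]

lemma measurable_opProd (N : ℕ) : Measurable fun z : ℕ × ι → ℝ => opProd S Γ z N := by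
  have hΓ : Continuous Γ := Γ.continuous_of_finiteDimensional
  induction N with
  | zero => exact measurable_const
  | succ N ih =>
    have : Measurable fun z : ℕ × ι → ℝ => Γ fun i => z (N, i) :=
      hΓ.measurable.comp (by fun_prop)
    exact (measurable_const.mul this).mul ih

variable {Ω : Type*} [MeasurableSpace Ω] {P : Measure Ω}
  {g : ℕ × ι → Ω → ℝ} {v : ℝ≥0}

/-- The reindexing `j` covers two uses: `j = id` with `n = N` for the past against the next factor,
and the shift with `n = 0` for the later factors against the first. -/
lemma indepFun_opProd (hg : iIndepFun g P) (hm : ∀ k, Measurable (g k)) (N : ℕ) (j : ℕ × ι → ℕ × ι)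
    (n : ℕ) (hj : ∀ k : ℕ × ι, k.1 < N → (j k).1 ≠ n) :
    IndepFun (fun ω => opProd S Γ (fun k => g (j k) ω) N) (fun ω i => g (n, i) ω) P := by
  classical
  set A : Finset (ℕ × ι) := (Finset.range N ×ˢ Finset.univ).image j
  set B : Finset (ℕ × ι) := {n} ×ˢ Finset.univ
  have hdisj : Disjoint A B := by
    rw [Finset.disjoint_left]
    intro k hk hkB
    obtain ⟨l, hl, rfl⟩ := Finset.mem_image.1 hk
    simp only [Finset.mem_product, Finset.mem_range, Finset.mem_univ, and_true] at hl
    simp only [B, Finset.mem_product, Finset.mem_singleton, Finset.mem_univ, and_true] at hkB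
    exact hj l hl hkB
  have h := hg.indepFun_finset A B hdisj hm
  -- Padding by 0 outside `A` is harmless, since the product of `N` factors reads only indices that
  -- `j` sends into `A`.
  set ext : (A → ℝ) → ℕ × ι → ℝ := fun f k => if hk : j k ∈ A then f ⟨j k, hk⟩ else 0
  have hext : Measurable ext := by
    refine measurable_pi_lambda _ fun k => ?_
    by_cases hk : j k ∈ A
    · simp only [ext, hk, dite_true]; fun_prop
    · simp only [ext, hk, dite_false]; exact measurable_const
  have h2 := h.comp (φ := fun f => opProd S Γ (ext f) N)
    (ψ := fun (f : B → ℝ) i => f ⟨(n, i), by simp [B]⟩)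
    ((measurable_opProd N).comp hext) (by fun_prop)
  refine h2.congr (Eventually.of_forall fun ω => ?_) (Eventually.of_forall fun ω => rfl)
  refine opProd_congr fun m hm' i => ?_
  have hmem : j (m, i) ∈ A := Finset.mem_image_of_mem _ (by simp [hm'])
  simp only [ext, hmem, dite_true]

lemma map_block_eq (hg : iIndepFun g P) (hlaw : ∀ k, HasLaw (g k) (gaussianReal 0 v) P) (n : ℕ) :
    P.map (fun ω i => g (n, i) ω) = Measure.pi fun _ : ι => gaussianReal 0 v := by
  have h1 : iIndepFun (fun i => g (n, i)) P :=
    hg.precomp (g := fun i : ι => (n, i)) (fun a b h => by simpa using h)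
  exact (iIndepFun.hasLaw_pi (fun i => hlaw (n, i)) h1).map_eq

variable [IsProbabilityMeasure P]

/-- The normalization of a vector, with a default value at zero. -/
noncomputable def unitOr (e w : EuclideanSpace ℝ κ) : EuclideanSpace ℝ κ :=
  if w = 0 then e else ‖w‖⁻¹ • w

/-- The default direction keeps the result a unit vector even at 0, so the law of the next increment
is known for every value of the past, without an exceptional set. -/
lemma norm_unitOr {e : EuclideanSpace ℝ κ} (he : ‖e‖ = 1) (w : EuclideanSpace ℝ κ) :
    ‖unitOr e w‖ = 1 := by
  unfold unitOr
  split_ifs with h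
  · exact he
  · rw [norm_smul, norm_inv, norm_norm, inv_mul_cancel₀ (norm_ne_zero_iff.2 h)]

lemma norm_smul_unitOr {e w : EuclideanSpace ℝ κ} (hw : w ≠ 0) : ‖w‖ • unitOr e w = w := by
  rw [unitOr, if_neg hw, smul_smul, mul_inv_cancel₀ (norm_ne_zero_iff.2 hw), one_smul]

lemma measurable_unitOr (e : EuclideanSpace ℝ κ) : Measurable (unitOr e) := by
  unfold unitOr
  refine Measurable.ite (measurableSet_singleton 0) measurable_const ?_
  exact measurable_norm.inv.smul measurable_id

/-- `Γ` turns a Gaussian array into a random operator sending unit vectors to standard Gaussians. -/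
def IsGaussianOp (Γ : (ι → ℝ) →ₗ[ℝ] (EuclideanSpace ℝ κ →L[ℝ] EuclideanSpace ℝ κ))
    (v : ℝ≥0) : Prop :=
  ∀ w : EuclideanSpace ℝ κ, ‖w‖ = 1 →
    (Measure.pi fun _ : ι => gaussianReal 0 v).map (fun z => (Γ z w).ofLp) =
    Measure.pi fun _ : κ => gaussianReal 0 v

lemma measurable_apply_op :
    Measurable fun q : EuclideanSpace ℝ κ × (ι → ℝ) => (Γ q.2 q.1).ofLp := by
  have hΓ : Continuous Γ := Γ.continuous_of_finiteDimensional
  have h1 : Continuous fun q : EuclideanSpace ℝ κ × (ι → ℝ) => Γ q.2 q.1 :=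
    (hΓ.comp continuous_snd).clm_apply continuous_fst
  exact (by fun_prop : Continuous fun q : EuclideanSpace ℝ κ × (ι → ℝ) =>
    (Γ q.2 q.1).ofLp).measurable

/-- The normalized increments along an orbit are standard Gaussian and independent of the past. -/
lemma orbit_increment (hΓ : IsGaussianOp Γ v) (hg : iIndepFun g P) (hm : ∀ k, Measurable (g k))
    (hlaw : ∀ k, HasLaw (g k) (gaussianReal 0 v) P) {e : EuclideanSpace ℝ κ} (he : ‖e‖ = 1)
    (N : ℕ) :
    IndepFun (fun ω => opProd S Γ (fun k => g k ω) N e)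
        (fun ω => (Γ (fun i => g (N, i) ω)
          (unitOr e (opProd S Γ (fun k => g k ω) N e))).ofLp) P ∧
      P.map (fun ω => (Γ (fun i => g (N, i) ω)
          (unitOr e (opProd S Γ (fun k => g k ω) N e))).ofLp) =
        Measure.pi fun _ : κ => gaussianReal 0 v := by
  have h1 := indepFun_opProd (S := S) (Γ := Γ) hg hm N id N fun k hk => hk.ne
  have hev : Measurable fun A : EuclideanSpace ℝ κ →L[ℝ] EuclideanSpace ℝ κ => A e :=
    (ContinuousLinearMap.apply ℝ (EuclideanSpace ℝ κ) e).continuous.measurable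
  have h2 : IndepFun (fun ω => opProd S Γ (fun k => g k ω) N e) (fun ω i => g (N, i) ω) P :=
    h1.comp hev measurable_id
  have hmP : Measurable fun ω => opProd S Γ (fun k => g k ω) N e :=
    hev.comp ((measurable_opProd N).comp (measurable_pi_lambda _ fun k => hm k))
  refine indepFun_of_law_const (f := fun w z => (Γ z (unitOr e w)).ofLp) h2 hmP
    (measurable_pi_lambda _ fun i => hm _) ?_ fun w => ?_
  · exact measurable_apply_op.comp
      (((measurable_unitOr e).comp measurable_fst).prodMk measurable_snd)
  · rw [map_block_eq hg hlaw]
    exact hΓ _ (norm_unitOr he w)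

variable [Nonempty κ]

lemma ae_pi_toLp_ne_zero (hv : v ≠ 0) :
    ∀ᵐ x ∂(Measure.pi fun _ : κ => gaussianReal 0 v),
      (WithLp.toLp 2 x : EuclideanSpace ℝ κ) ≠ 0 := by
  obtain ⟨k⟩ := ‹Nonempty κ›
  filter_upwards [ae_pi_gaussianReal_ne_zero hv k] with x hx h
  exact hx (by simpa using congrArg (fun w : EuclideanSpace ℝ κ => w k) h)

/-- By induction: the increment is a Gaussian vector, almost surely nonzero, and `S` is injective.
Homogeneity then splits off the norm of the past. -/
lemma orbit_ne_zero (hv : v ≠ 0) (hΓ : IsGaussianOp Γ v) (hS : Function.Injective S)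
    (hg : iIndepFun g P) (hm : ∀ k, Measurable (g k))
    (hlaw : ∀ k, HasLaw (g k) (gaussianReal 0 v) P) {e : EuclideanSpace ℝ κ} (he : ‖e‖ = 1)
    (N : ℕ) :
    (∀ᵐ ω ∂P, opProd S Γ (fun k => g k ω) N e ≠ 0) ∧
      ∀ᵐ ω ∂P, Real.log ‖opProd S Γ (fun k => g k ω) (N + 1) e‖ =
        Real.log ‖opProd S Γ (fun k => g k ω) N e‖ +
          Real.log ‖S (Γ (fun i => g (N, i) ω) (unitOr e (opProd S Γ (fun k => g k ω) N e)))‖ := by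
  have hne : ∀ N, ∀ᵐ ω ∂P,
      S (Γ (fun i => g (N, i) ω) (unitOr e (opProd S Γ (fun k => g k ω) N e))) ≠ 0 := by
    intro N
    have h := (orbit_increment (S := S) hΓ hg hm hlaw he N).2
    have h0 := ae_pi_toLp_ne_zero (κ := κ) hv
    rw [← h] at h0
    -- The push-forward along a map that is not a.e. measurable is 0, whereas here it is a
    -- probability measure.
    have hmeas : AEMeasurable (fun ω => (Γ (fun i => g (N, i) ω)
          (unitOr e (opProd S Γ (fun k => g k ω) N e))).ofLp) P := by
      by_contra hcon
      have hz := Measure.map_of_not_aemeasurable hcon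
      rw [h] at hz
      exact (IsProbabilityMeasure.ne_zero _) hz
    filter_upwards [ae_of_ae_map hmeas h0] with ω hω h1
    exact hω (hS (by simpa using h1))
  have hfac : ∀ N ω, opProd S Γ (fun k => g k ω) N e ≠ 0 →
      opProd S Γ (fun k => g k ω) (N + 1) e = ‖opProd S Γ (fun k => g k ω) N e‖ •
        S (Γ (fun i => g (N, i) ω) (unitOr e (opProd S Γ (fun k => g k ω) N e))) := by
    intro N ω hω
    rw [← map_smul, ← map_smul, norm_smul_unitOr hω]
    rfl
  have hP : ∀ N, ∀ᵐ ω ∂P, opProd S Γ (fun k => g k ω) N e ≠ 0 := by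
    intro N
    induction N with
    | zero =>
      refine Eventually.of_forall fun ω h => ?_
      have : e = 0 := h
      rw [this, norm_zero] at he
      exact zero_ne_one he
    | succ N ih =>
      filter_upwards [ih, hne N] with ω h1 h2
      rw [hfac N ω h1]
      exact smul_ne_zero (norm_ne_zero_iff.2 h1) h2
  refine ⟨hP N, ?_⟩
  filter_upwards [hP N, hne N] with ω h1 h2
  rw [hfac N ω h1, norm_smul, norm_norm,
    Real.log_mul (norm_ne_zero_iff.2 h1) (norm_ne_zero_iff.2 h2)]

/-- The logarithm of the norm along an orbit has variance exactly linear in the time. -/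
lemma variance_log_orbit (hv : v ≠ 0) (hΓ : IsGaussianOp Γ v) (hS : Function.Injective S)
    (hg : iIndepFun g P) (hm : ∀ k, Measurable (g k))
    (hlaw : ∀ k, HasLaw (g k) (gaussianReal 0 v) P)
    (hL : MemLp (fun x : κ → ℝ => Real.log ‖S (WithLp.toLp 2 x)‖) 2
      (Measure.pi fun _ => gaussianReal 0 v)) {e : EuclideanSpace ℝ κ} (he : ‖e‖ = 1) (N : ℕ) :
    MemLp (fun ω => Real.log ‖opProd S Γ (fun k => g k ω) N e‖) 2 P ∧
      Var[fun ω => Real.log ‖opProd S Γ (fun k => g k ω) N e‖; P] =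
        N * Var[fun x : κ → ℝ => Real.log ‖S (WithLp.toLp 2 x)‖;
          Measure.pi fun _ => gaussianReal 0 v] := by
  induction N with
  | zero =>
    have : (fun ω => Real.log ‖opProd S Γ (fun k => g k ω) 0 e‖) = fun _ => (0 : ℝ) := by
      funext ω
      have : opProd S Γ (fun k => g k ω) 0 e = e := rfl
      rw [this, he, Real.log_one]
    rw [this]
    refine ⟨memLp_const _, ?_⟩
    rw [Nat.cast_zero, zero_mul]
    exact variance_zero P
  | succ N ih =>
    obtain ⟨ih1, ih2⟩ := ih
    obtain ⟨hind, hmap⟩ := orbit_increment (S := S) hΓ hg hm hlaw he N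
    set ξ : Ω → κ → ℝ := fun ω => (Γ (fun i => g (N, i) ω)
          (unitOr e (opProd S Γ (fun k => g k ω) N e))).ofLp with hξ
    have hmeas : AEMeasurable ξ P := by
      by_contra hcon
      have hz := Measure.map_of_not_aemeasurable hcon
      rw [hmap] at hz
      exact (IsProbabilityMeasure.ne_zero _) hz
    have hlogm : Measurable fun x : κ → ℝ => Real.log ‖S (WithLp.toLp 2 x)‖ := by
      refine Real.measurable_log.comp ?_
      exact (by fun_prop : Continuous fun x : κ → ℝ => ‖S (WithLp.toLp 2 x)‖).measurable
    have hI : MemLp (fun ω => Real.log ‖S (WithLp.toLp 2 (ξ ω))‖) 2 P := by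
      rw [← hmap] at hL
      exact (memLp_map_measure_iff hlogm.aestronglyMeasurable hmeas).1 hL
    have hIV : Var[fun ω => Real.log ‖S (WithLp.toLp 2 (ξ ω))‖; P] =
        Var[fun x : κ → ℝ => Real.log ‖S (WithLp.toLp 2 x)‖;
          Measure.pi fun _ => gaussianReal 0 v] := by
      rw [← hmap, variance_map hlogm.aemeasurable hmeas]
      rfl
    have hsum : (fun ω => Real.log ‖opProd S Γ (fun k => g k ω) (N + 1) e‖) =ᵐ[P]
        (fun ω => Real.log ‖opProd S Γ (fun k => g k ω) N e‖) +
          fun ω => Real.log ‖S (WithLp.toLp 2 (ξ ω))‖ :=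
      (orbit_ne_zero hv hΓ hS hg hm hlaw he N).2
    have hind' : IndepFun (fun ω => Real.log ‖opProd S Γ (fun k => g k ω) N e‖)
        (fun ω => Real.log ‖S (WithLp.toLp 2 (ξ ω))‖) P :=
      hind.comp (Real.measurable_log.comp measurable_norm) hlogm
    refine ⟨(memLp_congr_ae hsum).2 (ih1.add hI), ?_⟩
    rw [variance_congr hsum, hind'.variance_add ih1 hI, ih2, hIV]
    push_cast; ring

end randomProduct

/-! ### The operator norm compared with an orbit -/

section operatorNorm

variable {ι κ : Type*} [Fintype ι] [Fintype κ]

lemma map_sum_mul_pi_gaussianReal (v : ℝ≥0) {u : κ → ℝ} (hu : ∑ k, u k ^ 2 = 1) :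
    (Measure.pi fun _ : κ => gaussianReal 0 v).map (fun x => ∑ k, x k * u k) =
      gaussianReal 0 v := by
  have h := map_pi_gaussianReal (ι := κ) (κ := Fin 1) v (L := fun x _ => ∑ k, x k * u k)
    (by fun_prop) (fun t k => t 0 * u k)
    (fun x t => by
      rw [Fin.sum_univ_one, Finset.sum_mul]
      exact Finset.sum_congr rfl fun k _ => by ring)
    (fun t => by
      rw [Fin.sum_univ_one]
      simp only [mul_pow]
      rw [← Finset.mul_sum, hu, mul_one])
  have h1 := (measurePreserving_eval (fun _ : Fin 1 => gaussianReal 0 v) 0).map_eq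
  rw [← h, Measure.map_map (measurable_pi_apply 0) (by fun_prop)] at h1
  exact h1

variable {S : EuclideanSpace ℝ κ →L[ℝ] EuclideanSpace ℝ κ}
  {Γ : (ι → ℝ) →ₗ[ℝ] (EuclideanSpace ℝ κ →L[ℝ] EuclideanSpace ℝ κ)} {v : ℝ≥0}

lemma integrable_sq_norm_gaussianOp :
    Integrable (fun z => ‖Γ z‖ ^ 2) (Measure.pi fun _ : ι => gaussianReal 0 v) := by
  have hΓ : Continuous Γ := Γ.continuous_of_finiteDimensional
  set K := ‖(LinearMap.toContinuousLinearMap Γ)‖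
  refine Integrable.mono' (g := fun z : ι → ℝ => K ^ 2 * ∑ i, z i ^ 2)
    ((integrable_finsetSum _ fun i _ => integrable_sq_eval_pi_gaussianReal v i).const_mul _)
    (by fun_prop : Continuous fun z => ‖Γ z‖ ^ 2).aestronglyMeasurable
    (Eventually.of_forall fun z => ?_)
  rw [Real.norm_of_nonneg (by positivity)]
  have h1 : ‖Γ z‖ ≤ K * ‖z‖ := (LinearMap.toContinuousLinearMap Γ).le_opNorm z
  have h2 : ‖z‖ ≤ √(∑ i, z i ^ 2) := by
    rw [pi_norm_le_iff_of_nonneg (Real.sqrt_nonneg _)]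
    intro i
    refine Real.le_sqrt_of_sq_le ?_
    rw [Real.norm_eq_abs, sq_abs]
    exact Finset.single_le_sum (f := fun i => z i ^ 2) (fun i _ => sq_nonneg _) (Finset.mem_univ i)
  have h3 : ‖z‖ ^ 2 ≤ ∑ i, z i ^ 2 := by
    calc ‖z‖ ^ 2 ≤ √(∑ i, z i ^ 2) ^ 2 := by gcongr
      _ = _ := Real.sq_sqrt (Finset.sum_nonneg fun i _ => sq_nonneg _)
  calc ‖Γ z‖ ^ 2 ≤ (K * ‖z‖) ^ 2 := by gcongr
    _ = K ^ 2 * ‖z‖ ^ 2 := by ring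
    _ ≤ _ := by gcongr

/-- An operator nearly attains its norm in a direction that it maps to from a fixed direction. -/
lemma exists_unit_inner_le_norm_apply {E : Type*} [NormedAddCommGroup E] [InnerProductSpace ℝ E]
    [CompleteSpace E] {M : E →L[ℝ] E} (hM : M ≠ 0) :
    ∃ u : E, ‖u‖ = 1 ∧ ∀ w, ‖M‖ / 2 * |inner ℝ u w| ≤ ‖M w‖ := by
  have hpos : 0 < ‖M‖ := norm_pos_iff.2 hM
  -- The direction is `M* a` normalized, for `a` in the unit ball with `‖M* a‖ > ‖M‖ / 2`; giving
  -- away a factor 2 avoids asking for a vector that attains the norm.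
  have hlt : ‖M‖ / 2 < ‖ContinuousLinearMap.adjoint M‖ := by
    rw [LinearIsometryEquiv.norm_map]; linarith
  obtain ⟨a, ha, ha'⟩ := ContinuousLinearMap.exists_lt_apply_of_lt_opNorm _ hlt
  set w₀ := ContinuousLinearMap.adjoint M a
  have hw₀ : 0 < ‖w₀‖ := by linarith
  refine ⟨‖w₀‖⁻¹ • w₀, by
    rw [norm_smul, norm_inv, norm_norm, inv_mul_cancel₀ hw₀.ne'], fun w => ?_⟩
  have h1 : ‖w₀‖ * inner ℝ (‖w₀‖⁻¹ • w₀) w = inner ℝ a (M w) := by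
    rw [real_inner_smul_left, ← mul_assoc, mul_inv_cancel₀ hw₀.ne', one_mul,
      ContinuousLinearMap.adjoint_inner_left]
  calc ‖M‖ / 2 * |inner ℝ (‖w₀‖⁻¹ • w₀) w| ≤ ‖w₀‖ * |inner ℝ (‖w₀‖⁻¹ • w₀) w| := by gcongr
    _ = |inner ℝ a (M w)| := by rw [← h1, abs_mul, abs_of_pos hw₀]
    _ ≤ ‖a‖ * ‖M w‖ := abs_real_inner_le_norm _ _
    _ ≤ 1 * ‖M w‖ := by gcongr
    _ = ‖M w‖ := one_mul _

/-- The ratio of the norm of `M A` to the length of `M A e`. -/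
lemma sq_log_norm_sub_le {E : Type*} [NormedAddCommGroup E] [InnerProductSpace ℝ E]
    {M A : E →L[ℝ] E} {u e : E} (hM : M ≠ 0) (he : ‖e‖ = 1)
    (hu : ∀ w, ‖M‖ / 2 * |inner ℝ u w| ≤ ‖M w‖) (hne : inner ℝ u (A e) ≠ 0) :
    (Real.log ‖M * A‖ - Real.log ‖(M * A) e‖) ^ 2 ≤
      8 * ‖A‖ ^ 2 + 2 * Real.log (inner ℝ u (A e) ^ 2) ^ 2 := by
  have hpos : 0 < ‖M‖ := norm_pos_iff.2 hM
  set s : ℝ := inner ℝ u (A e)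
  have hs : 0 < |s| := abs_pos.2 hne
  have h1 : ‖M‖ / 2 * |s| ≤ ‖(M * A) e‖ := hu (A e)
  have h2 : ‖(M * A) e‖ ≤ ‖M * A‖ := by
    simpa [he] using (M * A).le_opNorm e
  have h3 : ‖M * A‖ ≤ ‖M‖ * ‖A‖ := norm_mul_le _ _
  have h4 : 0 < ‖(M * A) e‖ := lt_of_lt_of_le (by positivity) h1
  have h5 : 0 < ‖A‖ := by
    by_contra hcon
    have : ‖A‖ = 0 := le_antisymm (not_lt.1 hcon) (norm_nonneg _)
    rw [this, mul_zero] at h3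
    linarith
  have l1 : Real.log ‖(M * A) e‖ ≤ Real.log ‖M * A‖ := Real.log_le_log h4 h2
  have l2 : Real.log ‖M * A‖ ≤ Real.log ‖M‖ + Real.log ‖A‖ := by
    rw [← Real.log_mul hpos.ne' h5.ne']
    exact Real.log_le_log (by linarith) h3
  have l3 : Real.log ‖M‖ - Real.log 2 + Real.log |s| ≤ Real.log ‖(M * A) e‖ := by
    rw [← Real.log_div hpos.ne' two_ne_zero, ← Real.log_mul (by positivity) hs.ne']
    exact Real.log_le_log (by positivity) h1
  have l4 : Real.log (s ^ 2) = 2 * Real.log |s| := by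
    rw [← sq_abs, Real.log_pow]; norm_num
  -- With this the nonnegative difference of logarithms is at most `2 ‖A‖ + |r|`.
  have l5 : Real.log ‖A‖ + Real.log 2 ≤ 2 * ‖A‖ := by
    rw [← Real.log_mul h5.ne' two_ne_zero]
    have := Real.log_le_sub_one_of_pos (show 0 < ‖A‖ * 2 by positivity)
    linarith
  rw [l4]
  generalize Real.log |s| = r at l3 ⊢
  have l6 := neg_abs_le r
  have h6 : (Real.log ‖M * A‖ - Real.log ‖(M * A) e‖) ^ 2 ≤ (2 * ‖A‖ + |r|) ^ 2 :=
    pow_le_pow_left₀ (by linarith) (by linarith) 2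
  have h7 : |r| ^ 2 = r ^ 2 := sq_abs r
  nlinarith [sq_nonneg (2 * ‖A‖ - |r|), sq_nonneg r]

/-- The vector `u` depends only on `M`, and `⟨u, Γ z e⟩` is a centred scalar Gaussian of variance
`v` for each unit `u`, so the bound does not involve `M`. That is the source of uniformity in `N`.
-/
lemma lintegral_sq_log_norm_sub_le (hv : v ≠ 0) (hΓ : IsGaussianOp Γ v)
    (M : EuclideanSpace ℝ κ →L[ℝ] EuclideanSpace ℝ κ) {e : EuclideanSpace ℝ κ} (he : ‖e‖ = 1) :
    ∫⁻ z, ENNReal.ofReal ((Real.log ‖M * Γ z‖ - Real.log ‖(M * Γ z) e‖) ^ 2)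
        ∂(Measure.pi fun _ : ι => gaussianReal 0 v) ≤
      ENNReal.ofReal (8 * (∫ z, ‖Γ z‖ ^ 2 ∂(Measure.pi fun _ : ι => gaussianReal 0 v)) +
        2 * ∫ t, Real.log (t ^ 2) ^ 2 ∂(gaussianReal 0 v)) := by
  -- For `M = 0` both logarithms are 0 by the convention `log 0 = 0`.
  by_cases hM : M = 0
  · simp [hM]
  obtain ⟨u, hu1, hu⟩ := exists_unit_inner_le_norm_apply hM
  set μ := Measure.pi fun _ : ι => gaussianReal 0 v
  have hsum : ∑ k, u.ofLp k ^ 2 = 1 := by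
    have := EuclideanSpace.real_norm_sq_eq u
    rw [hu1] at this
    simpa using this.symm
  have hΓc : Continuous Γ := Γ.continuous_of_finiteDimensional
  have hcont : Continuous fun z => Γ z e := hΓc.clm_apply continuous_const
  have hm1 : Measurable fun z => (Γ z e).ofLp :=
    (by fun_prop : Continuous fun z => (Γ z e).ofLp).measurable
  have hmap : μ.map (fun z => inner ℝ u (Γ z e)) = gaussianReal 0 v := by
    rw [← map_sum_mul_pi_gaussianReal v hsum, ← hΓ e he, Measure.map_map (by fun_prop) hm1]
    rfl
  have hm : Measurable fun z => inner ℝ u (Γ z e) :=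
    (by fun_prop : Continuous fun z => inner ℝ u (Γ z e)).measurable
  have hlogm : AEStronglyMeasurable (fun t : ℝ => Real.log (t ^ 2) ^ 2) (gaussianReal 0 v) :=
    ((Real.measurable_log.comp (measurable_id.pow_const 2)).pow_const 2).aestronglyMeasurable
  have hI2 : Integrable (fun z => Real.log (inner ℝ u (Γ z e) ^ 2) ^ 2) μ := by
    have h := (memLp_log_sq_gaussian hv).integrable_sq
    rw [← hmap] at h hlogm
    exact (integrable_map_measure hlogm hm.aemeasurable).1 h
  have hE2 : ∫ z, Real.log (inner ℝ u (Γ z e) ^ 2) ^ 2 ∂μ =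
      ∫ t, Real.log (t ^ 2) ^ 2 ∂(gaussianReal 0 v) := by
    rw [← hmap] at hlogm ⊢
    rw [integral_map hm.aemeasurable hlogm]
  have hI1 : Integrable (fun z => ‖Γ z‖ ^ 2) μ := integrable_sq_norm_gaussianOp
  have hne : ∀ᵐ z ∂μ, inner ℝ u (Γ z e) ≠ 0 := by
    have : NullSingletonClass (gaussianReal 0 v) := nullSingletonClass_gaussianReal hv
    have h0 : ∀ᵐ t ∂(gaussianReal 0 v), t ≠ 0 := Measure.ae_ne _ 0
    rw [← hmap] at h0
    exact ae_of_ae_map hm.aemeasurable h0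
  have hI : Integrable (fun z => 8 * ‖Γ z‖ ^ 2 + 2 * Real.log (inner ℝ u (Γ z e) ^ 2) ^ 2) μ :=
    (hI1.const_mul _).add (hI2.const_mul _)
  rw [← hE2, ← integral_const_mul, ← integral_const_mul, ← integral_add (hI1.const_mul _)
    (hI2.const_mul _), ofReal_integral_eq_lintegral_ofReal hI
    (Eventually.of_forall fun z => by simp only [Pi.zero_apply]; positivity)]
  refine lintegral_mono_ae ?_
  filter_upwards [hne] with z hz
  exact ENNReal.ofReal_le_ofReal (sq_log_norm_sub_le hM he hu hz)

variable {Ω : Type*} [MeasurableSpace Ω] {P : Measure Ω} [IsProbabilityMeasure P]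
  {g : ℕ × ι → Ω → ℝ}

/-- The norm of the product stays within bounded mean square logarithmic distance of an orbit. -/
lemma exists_bound_log_norm_sub_orbit (hv : v ≠ 0) (hΓ : IsGaussianOp Γ v)
    (hg : iIndepFun g P) (hm : ∀ k, Measurable (g k))
    (hlaw : ∀ k, HasLaw (g k) (gaussianReal 0 v) P) {e : EuclideanSpace ℝ κ} (he : ‖e‖ = 1) :
    ∃ C : ℝ, ∀ N, MemLp (fun ω => Real.log ‖opProd S Γ (fun k => g k ω) N‖ -
        Real.log ‖opProd S Γ (fun k => g k ω) N e‖) 2 P ∧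
      Var[fun ω => Real.log ‖opProd S Γ (fun k => g k ω) N‖ -
        Real.log ‖opProd S Γ (fun k => g k ω) N e‖; P] ≤ C := by
  set C₀ : ℝ := 8 * (∫ z, ‖Γ z‖ ^ 2 ∂(Measure.pi fun _ : ι => gaussianReal 0 v)) +
        2 * ∫ t, Real.log (t ^ 2) ^ 2 ∂(gaussianReal 0 v) with hC₀
  have hC₀n : 0 ≤ C₀ := add_nonneg
    (mul_nonneg (by norm_num) (integral_nonneg fun z => by positivity))
    (mul_nonneg (by norm_num) (integral_nonneg fun z => by positivity))
  refine ⟨C₀, fun N => ?_⟩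
  have hmD : Measurable fun ω => Real.log ‖opProd S Γ (fun k => g k ω) N‖ -
        Real.log ‖opProd S Γ (fun k => g k ω) N e‖ := by
    have h : Measurable fun ω => opProd S Γ (fun k => g k ω) N :=
      (measurable_opProd N).comp (measurable_pi_lambda _ fun k => hm k)
    exact (Real.measurable_log.comp h.norm).sub (Real.measurable_log.comp
      ((ContinuousLinearMap.apply ℝ (EuclideanSpace ℝ κ) e).continuous.measurable.comp h).norm)
  have key : ∫⁻ ω, ENNReal.ofReal ((Real.log ‖opProd S Γ (fun k => g k ω) N‖ -
        Real.log ‖opProd S Γ (fun k => g k ω) N e‖) ^ 2) ∂P ≤ ENNReal.ofReal C₀ := by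
    cases N with
    | zero =>
      have hnt : Nontrivial (EuclideanSpace ℝ κ) :=
        ⟨e, 0, fun h => by rw [h, norm_zero] at he; exact zero_ne_one he⟩
      have h1 : ‖(1 : EuclideanSpace ℝ κ →L[ℝ] EuclideanSpace ℝ κ)‖ = 1 := norm_one
      simp [opProd, h1, he]
    | succ N =>
      -- The first factor is isolated: given the later ones, the bound above applies to `M = Q S`.
      have hind := indepFun_opProd (S := S) (Γ := Γ) hg hm N (fun k => (k.1 + 1, k.2)) 0
        fun k _ => Nat.succ_ne_zero _
      set Q : Ω → EuclideanSpace ℝ κ →L[ℝ] EuclideanSpace ℝ κ :=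
        fun ω => opProd S Γ (fun k : ℕ × ι => g (k.1 + 1, k.2) ω) N
      set Z : Ω → ι → ℝ := fun ω i => g (0, i) ω
      have hQ : Measurable Q := (measurable_opProd N).comp (measurable_pi_lambda _ fun k => hm _)
      have hZ : Measurable Z := measurable_pi_lambda _ fun k => hm _
      have hlawQZ := (indepFun_iff_map_prod_eq_prod_map_map hQ.aemeasurable hZ.aemeasurable).1 hind
      set F : (EuclideanSpace ℝ κ →L[ℝ] EuclideanSpace ℝ κ) × (ι → ℝ) → ENNReal := fun q =>
        ENNReal.ofReal ((Real.log ‖q.1 * S * Γ q.2‖ - Real.log ‖(q.1 * S * Γ q.2) e‖) ^ 2) with hF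
      have hΓc : Continuous Γ := Γ.continuous_of_finiteDimensional
      have hFm : Measurable F := by
        have h : Measurable fun q : (EuclideanSpace ℝ κ →L[ℝ] EuclideanSpace ℝ κ) × (ι → ℝ) =>
            q.1 * S * Γ q.2 :=
          (by fun_prop : Continuous fun q : (EuclideanSpace ℝ κ →L[ℝ] EuclideanSpace ℝ κ) ×
            (ι → ℝ) => q.1 * S * Γ q.2).measurable
        exact (((Real.measurable_log.comp h.norm).sub (Real.measurable_log.comp
          ((ContinuousLinearMap.apply ℝ
            (EuclideanSpace ℝ κ) e).continuous.measurable.comp h).norm)).pow_const 2).ennreal_ofReal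
      have h1 : ∀ ω, ENNReal.ofReal ((Real.log ‖opProd S Γ (fun k => g k ω) (N + 1)‖ -
          Real.log ‖opProd S Γ (fun k => g k ω) (N + 1) e‖) ^ 2) = F (Q ω, Z ω) := by
        intro ω
        rw [opProd_succ', ← mul_assoc]
      simp only [h1]
      rw [← lintegral_map hFm (hQ.prodMk hZ), hlawQZ, map_block_eq hg hlaw,
        lintegral_prod _ hFm.aemeasurable]
      have : IsProbabilityMeasure (P.map Q) := Measure.isProbabilityMeasure_map hQ.aemeasurable
      calc _ ≤ ∫⁻ _, ENNReal.ofReal C₀ ∂(P.map Q) :=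
            lintegral_mono fun M => lintegral_sq_log_norm_sub_le hv hΓ (M * S) he
        _ = ENNReal.ofReal C₀ := by rw [lintegral_const, measure_univ, mul_one]
  have hsq : Integrable (fun ω => (Real.log ‖opProd S Γ (fun k => g k ω) N‖ -
        Real.log ‖opProd S Γ (fun k => g k ω) N e‖) ^ 2) P := by
    refine ⟨(hmD.pow_const 2).aestronglyMeasurable, ?_⟩
    rw [hasFiniteIntegral_iff_ofReal (Eventually.of_forall fun ω => by
      simp only [Pi.zero_apply]; positivity)]
    exact key.trans_lt ENNReal.ofReal_lt_top
  refine ⟨(memLp_two_iff_integrable_sq hmD.aestronglyMeasurable).2 hsq,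
    (variance_le_expectation_sq hmD.aestronglyMeasurable).trans ?_⟩
  rw [← ofReal_integral_eq_lintegral_ofReal hsq (Eventually.of_forall fun ω => by
      simp only [Pi.zero_apply]; positivity)] at key
  exact (ENNReal.ofReal_le_ofReal_iff hC₀n).1 key

/-- The variance of the logarithm of the norm of a product of random operators. -/
theorem tendsto_variance_log_norm_opProd [Nonempty κ] (hv : v ≠ 0) (hΓ : IsGaussianOp Γ v)
    (hS : Function.Injective S) (hg : iIndepFun g P) (hm : ∀ k, Measurable (g k))
    (hlaw : ∀ k, HasLaw (g k) (gaussianReal 0 v) P)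
    (hL : MemLp (fun x : κ → ℝ => Real.log ‖S (WithLp.toLp 2 x)‖) 2
      (Measure.pi fun _ => gaussianReal 0 v)) :
    (∀ N, MemLp (fun ω => Real.log ‖opProd S Γ (fun k => g k ω) N‖) 2 P) ∧
      Tendsto (fun N : ℕ => Var[fun ω => Real.log ‖opProd S Γ (fun k => g k ω) N‖; P] / N) atTop
        (𝓝 Var[fun x : κ → ℝ => Real.log ‖S (WithLp.toLp 2 x)‖;
          Measure.pi fun _ => gaussianReal 0 v]) := by
  classical
  obtain ⟨k⟩ := ‹Nonempty κ›
  have : Nonempty κ := ⟨k⟩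
  have he : ‖EuclideanSpace.single k (1 : ℝ)‖ = 1 := by simp
  set e := EuclideanSpace.single k (1 : ℝ)
  obtain ⟨C, hC⟩ := exists_bound_log_norm_sub_orbit (S := S) hv hΓ hg hm hlaw he
  have hT := variance_log_orbit hv hΓ hS hg hm hlaw hL he
  have hsum : ∀ N, (fun ω => Real.log ‖opProd S Γ (fun k => g k ω) N‖) =
      (fun ω => Real.log ‖opProd S Γ (fun k => g k ω) N e‖) +
        fun ω => Real.log ‖opProd S Γ (fun k => g k ω) N‖ -
          Real.log ‖opProd S Γ (fun k => g k ω) N e‖ := by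
    intro N; funext ω; simp
  refine ⟨fun N => ?_, ?_⟩
  · rw [hsum]; exact (hT N).1.add (hC N).1
  · have h := tendsto_variance_div (fun N => (hT N).1) (fun N => (hC N).1) (fun N => (hT N).2)
      fun N => (hC N).2
    simpa only [← hsum] using h

end operatorNorm

/-! ### Real, complex and quaternion matrices as real operators -/

namespace GaussClass

lemma one_le_beta (b : GaussClass) : 1 ≤ b.beta := by cases b <;> decide

/-- The real components of a scalar. -/
noncomputable def components : (b : GaussClass) → b.Scalar ≃ₗ[ℝ] (Fin b.beta → ℝ)
  | real =>
    { toFun := fun (x : ℝ) (_ : Fin 1) => x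
      invFun := ofComponents real
      map_add' := fun _ _ => rfl
      map_smul' := fun _ _ => rfl
      left_inv := fun _ => rfl
      right_inv := fun c => by
        funext i
        fin_cases i
        rfl }
  | complex =>
    { toFun := fun z : ℂ => (![z.re, z.im] : Fin 2 → ℝ)
      invFun := ofComponents complex
      map_add' := fun z w => by
        funext i
        fin_cases i
        · exact Complex.add_re z w
        · exact Complex.add_im z w
      map_smul' := fun r z => by
        funext i
        fin_cases i
        · exact Complex.smul_re r z
        · exact Complex.smul_im r z
      left_inv := fun z => Complex.ext rfl rfl
      right_inv := fun c => by
        funext i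
        fin_cases i <;> rfl }
  | quaternion =>
    { toFun := fun q : Quaternion ℝ => (![q.re, q.imI, q.imJ, q.imK] : Fin 4 → ℝ)
      invFun := ofComponents quaternion
      map_add' := fun z w => by
        funext i
        fin_cases i <;> rfl
      map_smul' := fun r z => by
        funext i
        fin_cases i <;> rfl
      left_inv := fun q => rfl
      right_inv := fun c => by
        funext i
        fin_cases i <;> rfl }

variable {b : GaussClass} {d : ℕ}

lemma components_ofComponents (c : Fin b.beta → ℝ) : b.components (b.ofComponents c) = c := by
  cases b
  · exact (components real).right_inv c
  · exact (components complex).right_inv c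
  · exact (components quaternion).right_inv c

lemma components_symm_apply (c : Fin b.beta → ℝ) : b.components.symm c = b.ofComponents c := by
  rw [LinearEquiv.symm_apply_eq, components_ofComponents]

/-- The real part as a linear map. -/
noncomputable def reLinear : (b : GaussClass) → b.Scalar →ₗ[ℝ] ℝ
  | real => (LinearMap.id : ℝ →ₗ[ℝ] ℝ)
  | complex => Complex.reLm
  | quaternion => (QuaternionAlgebra.reₗ _ _ _ : Quaternion ℝ →ₗ[ℝ] ℝ)

lemma reLinear_apply (a : b.Scalar) : b.reLinear a = b.re a := by
  cases b <;> rfl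

/-- The remnant of commutativity available for quaternions; it lets a scalar be moved cyclically
when an adjoint is computed. -/
lemma re_mul_comm (x y : b.Scalar) : b.re (x * y) = b.re (y * x) := by
  cases b
  · exact mul_comm (G := ℝ) x y
  · exact congrArg Complex.re (mul_comm (G := ℂ) x y)
  · exact (by intro x y; simp; ring :
      ∀ x y : Quaternion ℝ, (x * y).re = (y * x).re) x y

lemma sum_components_mul (x y : b.Scalar) :
    ∑ c, b.components x c * b.components y c = b.re (star x * y) := by
  cases b
  · exact (Fin.sum_univ_one _).trans rfl
  · refine (Fin.sum_univ_two _).trans ?_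
    exact (by intro x y; simp : ∀ x y : ℂ, x.re * y.re + x.im * y.im = (star x * y).re) x y
  · refine (Fin.sum_univ_four _).trans ?_
    exact (by intro x y; simp : ∀ x y : Quaternion ℝ,
      x.re * y.re + x.imI * y.imI + x.imJ * y.imJ + x.imK * y.imK = (star x * y).re) x y

/-- The square of the absolute value is multiplicative. -/
lemma re_star_mul_self_mul (x y : b.Scalar) :
    b.re (star (x * y) * (x * y)) = b.re (star x * x) * b.re (star y * y) := by
  cases b
  · exact (by intro x y; simp; ring :
      ∀ x y : ℝ, star (x * y) * (x * y) = (star x * x) * (star y * y)) x y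
  · exact (by intro x y; simp; ring : ∀ x y : ℂ,
      (star (x * y) * (x * y)).re = (star x * x).re * (star y * y).re) x y
  · exact (by intro x y; simp; ring : ∀ x y : Quaternion ℝ,
      (star (x * y) * (x * y)).re = (star x * x).re * (star y * y).re) x y

lemma re_one : b.re 1 = 1 := by
  cases b
  · rfl
  · exact Complex.one_re
  · exact Quaternion.re_one

lemma re_sum {ι : Type*} (s : Finset ι) (f : ι → b.Scalar) :
    b.re (∑ i ∈ s, f i) = ∑ i ∈ s, b.re (f i) := by
  simp only [← reLinear_apply, map_sum]

lemma re_smul (r : ℝ) (x : b.Scalar) : b.re (r • x) = r * b.re x := by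
  simp only [← reLinear_apply, map_smul, smul_eq_mul]

/-- Vectors over the scalars as a real Euclidean space. -/
noncomputable def vecEquiv : (Fin d → b.Scalar) ≃ₗ[ℝ] EuclideanSpace ℝ (Fin d × Fin b.beta) :=
  (LinearEquiv.piCongrRight fun _ : Fin d => b.components).trans
    ((LinearEquiv.curry ℝ ℝ (Fin d) (Fin b.beta)).symm.trans
      (WithLp.linearEquiv 2 ℝ (Fin d × Fin b.beta → ℝ)).symm)

lemma vecEquiv_apply (v : Fin d → b.Scalar) (k : Fin d × Fin b.beta) :
    (vecEquiv v).ofLp k = b.components (v k.1) k.2 := rfl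

lemma inner_vecEquiv (v w : Fin d → b.Scalar) :
    inner ℝ (vecEquiv v) (vecEquiv w) = b.re (star v ⬝ᵥ w) := by
  rw [PiLp.inner_apply, Fintype.sum_prod_type, dotProduct, re_sum]
  refine Finset.sum_congr rfl fun i _ => ?_
  rw [Pi.star_apply, ← sum_components_mul]
  refine Finset.sum_congr rfl fun c _ => ?_
  simp [vecEquiv_apply, mul_comm]

/-- A matrix as an operator on the real Euclidean space. -/
noncomputable def toOp : Matrix (Fin d) (Fin d) b.Scalar →ₗ[ℝ]
    (EuclideanSpace ℝ (Fin d × Fin b.beta) →L[ℝ] EuclideanSpace ℝ (Fin d × Fin b.beta)) where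
  toFun M := LinearMap.toContinuousLinearMap
    { toFun := fun w => vecEquiv (M *ᵥ vecEquiv.symm w)
      map_add' := fun x y => by rw [map_add, Matrix.mulVec_add, map_add]
      map_smul' := fun r x => by
        rw [map_smul, Matrix.mulVec_smul, map_smul, RingHom.id_apply] }
  map_add' M N := by
    ext1 w
    simp [Matrix.add_mulVec]
  map_smul' r M := by
    ext1 w
    simp [Matrix.smul_mulVec]

lemma toOp_apply (M : Matrix (Fin d) (Fin d) b.Scalar)
    (w : EuclideanSpace ℝ (Fin d × Fin b.beta)) :
    toOp M w = vecEquiv (M *ᵥ vecEquiv.symm w) := rfl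

lemma toOp_vecEquiv (M : Matrix (Fin d) (Fin d) b.Scalar) (v : Fin d → b.Scalar) :
    toOp M (vecEquiv v) = vecEquiv (M *ᵥ v) := by
  rw [toOp_apply, LinearEquiv.symm_apply_apply]

lemma toOp_mul (M N : Matrix (Fin d) (Fin d) b.Scalar) : toOp (M * N) = toOp M * toOp N := by
  ext1 w
  rw [mul_apply_eq_comp, toOp_apply N, toOp_vecEquiv, toOp_apply, Matrix.mulVec_mulVec]

lemma toOp_one : toOp (1 : Matrix (Fin d) (Fin d) b.Scalar) = 1 := by
  ext1 w
  rw [toOp_apply, Matrix.one_mulVec, LinearEquiv.apply_symm_apply]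
  rfl

lemma inner_toOp_left (M : Matrix (Fin d) (Fin d) b.Scalar)
    (x w : EuclideanSpace ℝ (Fin d × Fin b.beta)) :
    inner ℝ (toOp M x) w = inner ℝ x (toOp Mᴴ w) := by
  obtain ⟨v, rfl⟩ := vecEquiv.surjective x
  obtain ⟨u, rfl⟩ := vecEquiv.surjective w
  rw [toOp_vecEquiv, toOp_vecEquiv, inner_vecEquiv, inner_vecEquiv, Matrix.star_mulVec,
    Matrix.dotProduct_mulVec]

lemma quadForm_eq_inner (M : Matrix (Fin d) (Fin d) b.Scalar) (v : Fin d → b.Scalar) :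
    quadForm M v = inner ℝ (vecEquiv v) (toOp M (vecEquiv v)) := by
  rw [toOp_vecEquiv, inner_vecEquiv, quadForm]

/-- The largest eigenvalue of `M† M` is the squared operator norm of `M`. -/
lemma maxEigenvalue_conjTranspose_mul_self (hd : 1 ≤ d) (M : Matrix (Fin d) (Fin d) b.Scalar) :
    maxEigenvalue (Mᴴ * M) = ‖toOp M‖ ^ 2 := by
  have hnt : Nontrivial (EuclideanSpace ℝ (Fin d × Fin b.beta)) := by
    have : Nonempty (Fin d × Fin b.beta) := ⟨(⟨0, hd⟩, ⟨0, b.one_le_beta⟩)⟩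
    infer_instance
  set T : EuclideanSpace ℝ (Fin d × Fin b.beta) →ₗ[ℝ] EuclideanSpace ℝ (Fin d × Fin b.beta) :=
    (toOp (Mᴴ * M)).toLinearMap with hTdef
  have hinner : ∀ x, inner ℝ (T x) x = ‖toOp M x‖ ^ 2 := by
    intro x
    rw [← real_inner_self_eq_norm_sq, real_inner_comm, inner_toOp_left, hTdef,
      ContinuousLinearMap.coe_coe, toOp_mul]
    rfl
  have hT : T.IsSymmetric := by
    intro x w
    have h := inner_toOp_left (Mᴴ * M) x w
    rwa [Matrix.conjTranspose_mul, Matrix.conjTranspose_conjTranspose] at h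
  have hle : ∀ x : EuclideanSpace ℝ (Fin d × Fin b.beta),
      ‖toOp M x‖ ^ 2 ≤ ‖toOp M‖ ^ 2 * ‖x‖ ^ 2 := by
    intro x
    rw [← mul_pow]
    exact pow_le_pow_left₀ (norm_nonneg _) ((toOp M).le_opNorm x) 2
  have hmem : ∀ t : ℝ, (∃ v : Fin d → b.Scalar, v ≠ 0 ∧ (Mᴴ * M) *ᵥ v = t • v) ↔
      Module.End.HasEigenvalue T t := by
    intro t
    constructor
    · rintro ⟨v, hv, h⟩
      refine Module.End.hasEigenvalue_of_hasEigenvector (x := vecEquiv v) ⟨?_, by simpa using hv⟩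
      rw [Module.End.mem_eigenspace_iff]
      change toOp (Mᴴ * M) (vecEquiv v) = _
      rw [toOp_vecEquiv, h, map_smul]
    · intro h
      obtain ⟨x, hx, hx0⟩ := h.exists_hasEigenvector
      rw [Module.End.mem_eigenspace_iff] at hx
      refine ⟨vecEquiv.symm x, by simpa using hx0, ?_⟩
      apply vecEquiv.injective
      rw [map_smul, LinearEquiv.apply_symm_apply]
      exact hx
  have hub : ∀ t, Module.End.HasEigenvalue T t → t ≤ ‖toOp M‖ ^ 2 := by
    intro t h
    obtain ⟨x, hx, hx0⟩ := h.exists_hasEigenvector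
    rw [Module.End.mem_eigenspace_iff] at hx
    have h1 := hinner x
    rw [hx, real_inner_smul_left, real_inner_self_eq_norm_sq] at h1
    have h2 : 0 < ‖x‖ ^ 2 := by have := norm_pos_iff.2 hx0; positivity
    have h3 := hle x
    rw [← h1] at h3
    exact le_of_mul_le_mul_right h3 h2
  have hset : {t : ℝ | ∃ v : Fin d → b.Scalar, v ≠ 0 ∧ (Mᴴ * M) *ᵥ v = t • v} =
      {t | Module.End.HasEigenvalue T t} := Set.ext hmem
  -- In finite dimension the supremum of the Rayleigh quotient is an eigenvalue. As `⟨T x, x⟩ = ‖M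
  -- x‖ ^ 2`, that supremum is the squared operator norm.
  have htop := hT.hasEigenvalue_iSup_of_finiteDimensional
  set s : ℝ := ⨆ x : {x : EuclideanSpace ℝ (Fin d × Fin b.beta) // x ≠ 0},
    RCLike.re (inner ℝ (T x) x) / ‖(x : EuclideanSpace ℝ (Fin d × Fin b.beta))‖ ^ 2 with hs
  have hbdd : BddAbove (Set.range fun x : {x : EuclideanSpace ℝ (Fin d × Fin b.beta) // x ≠ 0} =>
      RCLike.re (inner ℝ (T x) x) / ‖(x : EuclideanSpace ℝ (Fin d × Fin b.beta))‖ ^ 2) := by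
    refine ⟨‖toOp M‖ ^ 2, ?_⟩
    rintro _ ⟨x, rfl⟩
    have h2 : 0 < ‖(x : EuclideanSpace ℝ (Fin d × Fin b.beta))‖ ^ 2 := by
      have := norm_pos_iff.2 x.2; positivity
    change RCLike.re (inner ℝ (T x) x) / _ ≤ _
    rw [div_le_iff₀ h2, hinner]
    exact hle x
  have hlow : ∀ x, ‖toOp M x‖ ^ 2 ≤ s * ‖x‖ ^ 2 := by
    intro x
    by_cases hx : x = 0
    · simp [hx]
    have h2 : 0 < ‖x‖ ^ 2 := by have := norm_pos_iff.2 hx; positivity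
    have h := le_ciSup hbdd ⟨x, hx⟩
    rw [div_le_iff₀ h2, hinner] at h
    exact h
  have hs0 : 0 ≤ s := by
    obtain ⟨x, hx⟩ := exists_ne (0 : EuclideanSpace ℝ (Fin d × Fin b.beta))
    have h2 : 0 < ‖x‖ ^ 2 := by have := norm_pos_iff.2 hx; positivity
    by_contra hcon
    have := hlow x
    nlinarith [sq_nonneg ‖toOp M x‖]
  have hnorm : ‖toOp M‖ ^ 2 ≤ s := by
    have h : ‖toOp M‖ ≤ √s := by
      refine (toOp M).opNorm_le_bound (Real.sqrt_nonneg _) fun x => ?_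
      refine le_of_sq_le_sq ?_ (by positivity)
      rw [mul_pow, Real.sq_sqrt hs0]
      exact hlow x
    calc ‖toOp M‖ ^ 2 ≤ √s ^ 2 := pow_le_pow_left₀ (norm_nonneg _) h 2
      _ = s := Real.sq_sqrt hs0
  rw [maxEigenvalue, hset]
  refine IsGreatest.csSup_eq ⟨?_, fun t ht => hub t ht⟩
  have : s = ‖toOp M‖ ^ 2 := le_antisymm (hub s htop) hnorm
  rw [← this]
  exact htop

/-- The operator of the matrix with given real components. -/
noncomputable def arrayOp : (Fin d × Fin d × Fin b.beta → ℝ) →ₗ[ℝ]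
    (EuclideanSpace ℝ (Fin d × Fin b.beta) →L[ℝ] EuclideanSpace ℝ (Fin d × Fin b.beta)) :=
  toOp ∘ₗ
    { toFun := fun z => Matrix.of fun i j => b.components.symm fun c => z (i, j, c)
      map_add' := fun x y => by
        ext i j
        simp only [Matrix.of_apply, Matrix.add_apply, ← map_add]
        rfl
      map_smul' := fun r x => by
        ext i j
        simp only [Matrix.of_apply, Matrix.smul_apply, ← map_smul]
        rfl }

lemma arrayOp_apply (z : Fin d × Fin d × Fin b.beta → ℝ) :
    arrayOp z = toOp (Matrix.of fun i j => b.ofComponents fun c => z (i, j, c)) := by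
  simp only [← components_symm_apply]
  rfl

/-- For fixed `u` the adjoint of `z ↦ Γ z u` is `t ↦ t u†`. It is isometric when `‖u‖ = 1`, because
the absolute value is multiplicative on all three scalar rings. -/
lemma isGaussianOp_arrayOp (v : ℝ≥0) :
    IsGaussianOp (arrayOp : (Fin d × Fin d × Fin b.beta → ℝ) →ₗ[ℝ]
      (EuclideanSpace ℝ (Fin d × Fin b.beta) →L[ℝ] EuclideanSpace ℝ (Fin d × Fin b.beta))) v := by
  intro w hw
  obtain ⟨u, rfl⟩ := vecEquiv.surjective w
  have hu : ∑ j, b.re (star (u j) * u j) = 1 := by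
    have h := real_inner_self_eq_norm_sq (vecEquiv u)
    rw [hw, inner_vecEquiv, dotProduct, re_sum] at h
    simpa using h
  have hΓc : Continuous (arrayOp : (Fin d × Fin d × Fin b.beta → ℝ) →ₗ[ℝ]
      (EuclideanSpace ℝ (Fin d × Fin b.beta) →L[ℝ] EuclideanSpace ℝ (Fin d × Fin b.beta))) :=
    LinearMap.continuous_of_finiteDimensional _
  -- The adjoint array has entries `tᵢ star(uⱼ)`, in this order since the scalars need not commute.
  refine map_pi_gaussianReal v
    (by fun_prop : Continuous fun z => (arrayOp z (vecEquiv u)).ofLp).measurable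
    (fun t k => b.components (vecEquiv.symm (WithLp.toLp 2 t) k.1 * star (u k.2.1)) k.2.2) ?_ ?_
  · intro x t
    obtain ⟨s, hs⟩ := vecEquiv.surjective (WithLp.toLp 2 t)
    rw [← hs, LinearEquiv.symm_apply_apply]
    have h1 : ∑ k, (arrayOp x (vecEquiv u)).ofLp k * t k =
        inner ℝ (arrayOp x (vecEquiv u)) (vecEquiv s) := by
      rw [hs, PiLp.inner_apply]
      exact Finset.sum_congr rfl fun k _ => by simp [mul_comm]
    rw [h1, arrayOp_apply, toOp_vecEquiv, inner_vecEquiv, dotProduct, re_sum,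
      Fintype.sum_prod_type]
    refine Finset.sum_congr rfl fun i _ => ?_
    rw [Pi.star_apply, Matrix.mulVec, dotProduct, star_sum, Finset.sum_mul, re_sum,
      Fintype.sum_prod_type]
    refine Finset.sum_congr rfl fun j _ => ?_
    have h2 := sum_components_mul (b.ofComponents fun c => x (i, j, c)) (s i * star (u j))
    rw [components_ofComponents] at h2
    rw [h2, Matrix.of_apply, star_mul, mul_assoc, re_mul_comm, mul_assoc]
  · intro t
    obtain ⟨s, hs⟩ := vecEquiv.surjective (WithLp.toLp 2 t)
    rw [← hs, LinearEquiv.symm_apply_apply]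
    have h1 : ∑ k, t k ^ 2 = ∑ i, b.re (star (s i) * s i) := by
      have h := inner_vecEquiv s s
      rw [hs, dotProduct, re_sum, PiLp.inner_apply] at h
      refine Eq.trans (Finset.sum_congr rfl fun k _ => ?_) h
      simp [sq]
    rw [h1, Fintype.sum_prod_type]
    refine Finset.sum_congr rfl fun i _ => ?_
    rw [Fintype.sum_prod_type]
    have h2 : ∀ j, ∑ c, b.components (s i * star (u j)) c ^ 2 =
        b.re (star (s i) * s i) * b.re (star (u j) * u j) := by
      intro j
      simp only [sq]
      rw [sum_components_mul, re_star_mul_self_mul, star_star, re_mul_comm (u j)]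
    simp only [h2]
    rw [← Finset.mul_sum, hu, mul_one]

lemma toOp_prodMatrix {Ω : Type*} (S : Matrix (Fin d) (Fin d) b.Scalar)
    (g : ℕ × Fin d × Fin d × Fin b.beta → Ω → ℝ) (N : ℕ) (ω : Ω) :
    toOp (prodMatrix S g N ω) = opProd (toOp S) arrayOp (fun k => g k ω) N := by
  induction N with
  | zero => exact toOp_one
  | succ N ih =>
    rw [prodMatrix, toOp_mul, toOp_mul, ih, opProd, arrayOp_apply]
    rfl

end GaussClass

/-! ### Gaussian vectors in an orthonormal eigenbasis -/

section orthonormalCoordinates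

variable {κ : Type*} [Fintype κ]

/-- Taking coordinates has the adjoint `t ↦ ∑ tₖ Bₖ`, an isometry by Parseval. -/
lemma map_orthonormalBasis_pi_gaussianReal (v : ℝ≥0)
    (B : OrthonormalBasis κ ℝ (EuclideanSpace ℝ κ)) :
    (Measure.pi fun _ : κ => gaussianReal 0 v).map
      (fun x k => inner ℝ (B k) (WithLp.toLp 2 x)) = Measure.pi fun _ : κ => gaussianReal 0 v := by
  refine map_pi_gaussianReal v
    (by fun_prop : Continuous fun (x : κ → ℝ) k => inner ℝ (B k) (WithLp.toLp 2 x)).measurable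
    (fun t => (∑ k, t k • B k).ofLp) (fun x t => ?_) fun t => ?_
  · have h : inner ℝ (∑ k, t k • B k) (WithLp.toLp 2 x) =
        ∑ i, x i * (∑ k, t k • B k).ofLp i := by
      rw [PiLp.inner_apply]
      exact Finset.sum_congr rfl fun i _ => by simp
    rw [← h, sum_inner]
    exact Finset.sum_congr rfl fun k _ => by rw [real_inner_smul_left, mul_comm]
  · have h := B.sum_sq_norm_inner_right (∑ k, t k • B k)
    rw [EuclideanSpace.real_norm_sq_eq] at h
    rw [← h]
    refine Finset.sum_congr rfl fun k _ => ?_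
    rw [B.orthonormal.inner_right_fintype, Real.norm_eq_abs, sq_abs]

variable {β d : ℕ} {y : Fin d → ℝ}

/-- The logarithm of the length of a Gaussian vector under an operator that is diagonalized, in
squared length, by an orthonormal basis. -/
lemma variance_log_norm_of_diagonal {v : ℝ≥0} (hv : v ≠ 0) (hβ : 1 ≤ β) (hd : 1 ≤ d)
    (hy : ∀ i, 0 < y i)
    {S : EuclideanSpace ℝ (Fin d × Fin β) →L[ℝ] EuclideanSpace ℝ (Fin d × Fin β)}
    (B : OrthonormalBasis (Fin d × Fin β) ℝ (EuclideanSpace ℝ (Fin d × Fin β)))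
    (hS : ∀ x, ‖S x‖ ^ 2 = ∑ k, inner ℝ (B k) x ^ 2 / y k.1) :
    MemLp (fun x : Fin d × Fin β → ℝ => Real.log ‖S (WithLp.toLp 2 x)‖) 2
        (Measure.pi fun _ => gaussianReal 0 v) ∧
      Var[fun x : Fin d × Fin β → ℝ => Real.log ‖S (WithLp.toLp 2 x)‖;
          Measure.pi fun _ => gaussianReal 0 v] =
        1 / 4 * (Real.pi ^ 2 / 6 - keyholeValue β y 2 - keyholeValue β y 1 ^ 2) := by
  obtain ⟨h1, h2⟩ := variance_log_sum_sq (v := v) hv hβ hd hy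
  have hmap := map_orthonormalBasis_pi_gaussianReal v B
  have hm : Measurable fun (x : Fin d × Fin β → ℝ) k => inner ℝ (B k) (WithLp.toLp 2 x) :=
    (by fun_prop : Continuous fun (x : Fin d × Fin β → ℝ) k =>
      inner ℝ (B k) (WithLp.toLp 2 x)).measurable
  have hlogm : Measurable fun z : Fin d × Fin β → ℝ => Real.log (∑ k, z k ^ 2 / y k.1) :=
    Real.measurable_log.comp (by fun_prop)
  have e : (fun x : Fin d × Fin β → ℝ => Real.log ‖S (WithLp.toLp 2 x)‖) = fun x =>
      (1 / 2 : ℝ) * ((fun z : Fin d × Fin β → ℝ => Real.log (∑ k, z k ^ 2 / y k.1)) ∘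
        fun x k => inner ℝ (B k) (WithLp.toLp 2 x)) x := by
    funext x
    simp only [Function.comp]
    rw [← hS, Real.log_pow]
    push_cast; ring
  have hvar := variance_map (μ := Measure.pi fun _ : Fin d × Fin β => gaussianReal 0 v)
    hlogm.aemeasurable hm.aemeasurable
  rw [hmap, h2] at hvar
  rw [e]
  constructor
  · refine MemLp.const_mul ?_ _
    refine (memLp_map_measure_iff hlogm.aestronglyMeasurable hm.aemeasurable).1 ?_
    rw [hmap]
    exact h1
  -- The factor `1/4` is the square of the `1/2` from the square root; the `π ^ 2 / 3` inside `J₂`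
  -- turns `-π ^ 2 / 6` into `+π ^ 2 / 6`.
  · rw [variance_const_mul, ← hvar, keyholeValue_one hβ hd hy, keyholeValue_two hβ hd hy]
    ring

end orthonormalCoordinates

/-! ### Spectral data of the covariance matrix -/

namespace GaussClass

variable {b : GaussClass} {d : ℕ}

lemma inner_vecEquiv_self_pos {v : Fin d → b.Scalar} (hv : v ≠ 0) : 0 < b.re (star v ⬝ᵥ v) := by
  rw [← inner_vecEquiv, real_inner_self_eq_norm_sq]
  have : 0 < ‖(vecEquiv v : EuclideanSpace ℝ (Fin d × Fin b.beta))‖ :=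
    norm_pos_iff.2 (by simpa using hv)
  positivity

lemma PosDef.mulVec_injective {M : Matrix (Fin d) (Fin d) b.Scalar} (hM : PosDef M) :
    Function.Injective fun v => M *ᵥ v := by
  intro v w h
  by_contra hne
  have h1 := hM.2 (v - w) (sub_ne_zero.2 hne)
  have h2 : M *ᵥ (v - w) = 0 := by rw [Matrix.mulVec_sub, sub_eq_zero]; exact h
  rw [quadForm, h2, dotProduct_zero, ← reLinear_apply, map_zero] at h1
  exact lt_irrefl _ h1

lemma PosDef.toOp_injective {M : Matrix (Fin d) (Fin d) b.Scalar} (hM : PosDef M) :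
    Function.Injective (toOp M) := by
  intro x w h
  rw [toOp_apply, toOp_apply] at h
  exact vecEquiv.symm.injective (hM.mulVec_injective (vecEquiv.injective h))

/-- Injectivity of the real operator gives surjectivity by dimension. Solving for the unit vectors
builds a right inverse column by column, and injectivity makes it two-sided; no commutativity of the
scalars is used. -/
lemma PosDef.isUnit {M : Matrix (Fin d) (Fin d) b.Scalar} (hM : PosDef M) : IsUnit M := by
  have hsurj : Function.Surjective (toOp M) :=
    (LinearMap.injective_iff_surjective (f := (toOp M).toLinearMap)).1 hM.toOp_injective
  have hcol : ∀ j : Fin d, ∃ v : Fin d → b.Scalar, M *ᵥ v = Pi.single j 1 := by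
    intro j
    obtain ⟨x, hx⟩ := hsurj (vecEquiv (Pi.single j 1))
    exact ⟨vecEquiv.symm x, vecEquiv.injective hx⟩
  choose f hf using hcol
  set N : Matrix (Fin d) (Fin d) b.Scalar := Matrix.of fun i j => f j i
  have hMN : M * N = 1 := by
    ext i j
    have h := congrFun (hf j) i
    rw [Matrix.one_apply, Matrix.mul_apply]
    rw [Matrix.mulVec, dotProduct, Pi.single_apply] at h
    exact h
  have hNM : N * M = 1 := by
    apply Matrix.ext_of_mulVec_single
    intro j
    apply hM.mulVec_injective
    simp only [Matrix.mulVec_mulVec]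
    rw [← mul_assoc, hMN, one_mul, mul_one]
  exact ⟨⟨M, N, hMN, hNM⟩, rfl⟩

/-- Each `yᵢ` has positive multiplicity, hence an eigenvector `v`, and then `v† v = yᵢ v† M v` with
both forms positive. -/
lemma HasEigenvalues.pos {M : Matrix (Fin d) (Fin d) b.Scalar} (hM : PosDef M) {y : Fin d → ℝ}
    (hy : HasEigenvalues (Ring.inverse M) y) (i : Fin d) : 0 < y i := by
  have h : 0 < Module.finrank ℝ (eigenspace (Ring.inverse M) (y i)) := by
    rw [hy (y i)]
    have : Nonempty {j : Fin d // y j = y i} := ⟨⟨i, rfl⟩⟩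
    exact Nat.mul_pos b.one_le_beta Nat.card_pos
  have hnt := Module.nontrivial_of_finrank_pos h
  obtain ⟨⟨v, hv⟩, hne⟩ := exists_ne (0 : eigenspace (Ring.inverse M) (y i))
  have hv0 : v ≠ 0 := fun h0 => hne (Subtype.ext h0)
  have hv' : Ring.inverse M *ᵥ v = y i • v := hv
  have h1 : v = y i • (M *ᵥ v) := by
    rw [← Matrix.mulVec_smul, ← hv', Matrix.mulVec_mulVec, Ring.mul_inverse_cancel _ hM.isUnit,
      Matrix.one_mulVec]
  have h2 : b.re (star v ⬝ᵥ v) = y i * quadForm M v := by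
    calc b.re (star v ⬝ᵥ v) = b.re (star v ⬝ᵥ (y i • (M *ᵥ v))) := by rw [← h1]
      _ = y i * quadForm M v := by rw [dotProduct_smul, re_smul, quadForm]
  have h3 := inner_vecEquiv_self_pos hv0
  rw [h2] at h3
  exact (pos_iff_pos_of_mul_pos h3).2 (hM.2 v hv0)

/-- The inverse of a positive definite matrix is diagonalized by an orthonormal basis, in which
every listed eigenvalue occurs `β` times. -/
lemma exists_orthonormalBasis_inverse {M : Matrix (Fin d) (Fin d) b.Scalar} (hM : PosDef M)
    {y : Fin d → ℝ} (hy : HasEigenvalues (Ring.inverse M) y) :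
    ∃ B : OrthonormalBasis (Fin d × Fin b.beta) ℝ (EuclideanSpace ℝ (Fin d × Fin b.beta)),
      ∀ k, toOp (Ring.inverse M) (B k) = y k.1 • B k := by
  set I := Ring.inverse M
  have hIM : I * M = 1 := Ring.inverse_mul_cancel _ hM.isUnit
  have hMI : M * I = 1 := Ring.mul_inverse_cancel _ hM.isUnit
  have hherm : Iᴴ = I := by
    have h : Iᴴ * M = 1 := by
      have := congrArg Matrix.conjTranspose hMI
      rwa [Matrix.conjTranspose_mul, hM.1.eq, Matrix.conjTranspose_one] at this
    calc Iᴴ = Iᴴ * (M * I) := by rw [hMI, mul_one]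
      _ = I := by rw [← mul_assoc, h, one_mul]
  set T := (toOp I).toLinearMap with hTdef
  have hT : T.IsSymmetric := by
    intro x w
    have h := inner_toOp_left I x w
    rwa [hherm] at h
  have hn : Module.finrank ℝ (EuclideanSpace ℝ (Fin d × Fin b.beta)) = d * b.beta := by simp
  -- The real symmetric operator has each eigenvalue as often as `(i, c) ↦ yᵢ` takes it, so the
  -- fibres can be matched by a bijection that relabels its eigenbasis.
  have hcard : ∀ t : ℝ, Nat.card {i // hT.eigenvalues hn i = t} =
      Nat.card {k : Fin d × Fin b.beta // y k.1 = t} := by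
    intro t
    have h1 := hT.card_filter_eigenvalues_eq hn t
    have h2 : Module.finrank ℝ (Module.End.eigenspace T t) = Module.finrank ℝ (eigenspace I t) := by
      refine (LinearEquiv.finrank_eq (LinearEquiv.ofSubmodules vecEquiv _ _ ?_)).symm
      ext x
      rw [Submodule.mem_map_equiv, Module.End.mem_eigenspace_iff]
      constructor
      · intro h
        have := congrArg vecEquiv (show I *ᵥ vecEquiv.symm x = t • vecEquiv.symm x from h)
        rw [map_smul, LinearEquiv.apply_symm_apply] at this
        exact this
      · intro h
        apply vecEquiv.injective
        rw [map_smul, LinearEquiv.apply_symm_apply]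
        exact h
    rw [Nat.card_eq_fintype_card, Fintype.card_subtype]
    refine h1.trans (h2.trans ((hy t).trans ?_))
    rw [mul_comm]
    have e : {k : Fin d × Fin b.beta // y k.1 = t} ≃ {i : Fin d // y i = t} × Fin b.beta :=
      { toFun := fun k => (⟨k.1.1, k.2⟩, k.1.2)
        invFun := fun q => ⟨(q.1.1, q.2), q.1.2⟩
        left_inv := fun _ => rfl
        right_inv := fun _ => rfl }
    rw [Nat.card_congr e, Nat.card_prod, Nat.card_fin]
  have hequiv : ∀ t : ℝ, Nonempty ({i // hT.eigenvalues hn i = t} ≃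
      {k : Fin d × Fin b.beta // y k.1 = t}) := fun t => by
    rw [← Finite.card_eq]
    exact hcard t
  set σ := Equiv.ofFiberEquiv (f := hT.eigenvalues hn)
    (g := fun k : Fin d × Fin b.beta => y k.1) fun t => (hequiv t).some
  have hσ : ∀ i, y (σ i).1 = hT.eigenvalues hn i := fun i => Equiv.ofFiberEquiv_map
    (g := fun k : Fin d × Fin b.beta => y k.1) (fun t => (hequiv t).some) i
  refine ⟨(hT.eigenvectorBasis hn).reindex σ, fun k => ?_⟩
  have h := hT.apply_eigenvectorBasis hn (σ.symm k)
  rw [← hσ, Equiv.apply_symm_apply] at h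
  rw [OrthonormalBasis.reindex_apply]
  exact h

lemma norm_sq_toOp_of_mul_self {M S : Matrix (Fin d) (Fin d) b.Scalar} (hS : S.IsHermitian)
    (hSS : S * S = M) (x : EuclideanSpace ℝ (Fin d × Fin b.beta)) :
    ‖toOp S x‖ ^ 2 = inner ℝ x (toOp M x) := by
  rw [← real_inner_self_eq_norm_sq, inner_toOp_left, hS.eq, ← hSS, toOp_mul]
  rfl

/-- The basis also diagonalizes `M`, with eigenvalues `1 / yᵢ`; the rest is Parseval for `⟨x, M x⟩`.
-/
lemma norm_sq_toOp_eq_sum {M S : Matrix (Fin d) (Fin d) b.Scalar} (hM : PosDef M)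
    (hS : S.IsHermitian) (hSS : S * S = M) {y : Fin d → ℝ}
    (hy : HasEigenvalues (Ring.inverse M) y)
    {B : OrthonormalBasis (Fin d × Fin b.beta) ℝ (EuclideanSpace ℝ (Fin d × Fin b.beta))}
    (hB : ∀ k, toOp (Ring.inverse M) (B k) = y k.1 • B k)
    (x : EuclideanSpace ℝ (Fin d × Fin b.beta)) :
    ‖toOp S x‖ ^ 2 = ∑ k, inner ℝ (B k) x ^ 2 / y k.1 := by
  rw [norm_sq_toOp_of_mul_self hS hSS, ← B.sum_inner_mul_inner x (toOp M x)]
  refine Finset.sum_congr rfl fun k _ => ?_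
  have h0 := (hy.pos hM k.1).ne'
  have h1 : toOp M (B k) = (y k.1)⁻¹ • B k := by
    have h : toOp M (toOp (Ring.inverse M) (B k)) = B k := by
      rw [← mul_apply_eq_comp, ← toOp_mul, Ring.mul_inverse_cancel _ hM.isUnit, toOp_one]
      rfl
    rw [hB, map_smul] at h
    rw [← h, smul_smul, h, inv_mul_cancel₀ h0, one_smul]
  have h2 : inner ℝ (B k) (toOp M x) = (y k.1)⁻¹ * inner ℝ (B k) x := by
    have h := inner_toOp_left M (B k) x
    rw [hM.1.eq] at h
    rw [← h, h1, real_inner_smul_left]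
  rw [h2, real_inner_comm]
  field_simp

end GaussClass

/-! ### Assembly of the theorem -/

theorem proposition2p3 (b : GaussClass) (d : ℕ) (hd : 1 ≤ d)
    -- `Sig` is positive definite, `S` is its positive definite square root
    (Sig S : Matrix (Fin d) (Fin d) b.Scalar)
    (hSig : GaussClass.PosDef Sig) (hS : GaussClass.PosDef S) (hSS : S * S = Sig)
    (y : Fin d → ℝ) (hy : GaussClass.HasEigenvalues (Ring.inverse Sig) y)
    {Ω : Type*} [MeasurableSpace Ω] (P : Measure Ω) [IsProbabilityMeasure P]
    (g : ℕ × Fin d × Fin d × Fin b.beta → Ω → ℝ) (hg : GaussClass.IsStandardGaussian P g) :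
    ∃ J : ℕ → ℝ,
      -- the contour integrals `J p`, as the endpoint `R` of the contour tends to infinity
      (∀ (p : ℕ) (ε η : ℝ), 0 < ε → (∀ i, ε < y i) → 0 < η →
        Tendsto (fun R : ℝ => keyholeIntegral b.beta y p ε η R) atTop (𝓝 (J p : ℂ))) ∧
      -- if `β d` is even, every `R` beyond the `y i` gives the same value
      (Even (b.beta * d) → ∀ (p : ℕ) (ε η R : ℝ), 0 < ε → (∀ i, ε < y i) → 0 < η →
        (∀ i, y i < R) → keyholeIntegral b.beta y p ε η R = (J p : ℂ)) ∧
      -- the variance of the largest finite-`N` Lyapunov exponent, to leading order in `1 / N`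
      (∀ N : ℕ, 1 ≤ N → MemLp (GaussClass.lyapunov₁ S g N) 2 P) ∧
      Tendsto (fun N : ℕ => (N : ℝ) * Var[GaussClass.lyapunov₁ S g N; P]) atTop
        (𝓝 (1 / 4 * (Real.pi ^ 2 / 6 - J 2 - J 1 ^ 2))) ∧
      -- the variance of `log (x† Sig x) ^ (1 / 2)` for a column `x` of a factor `G`
      (∀ (n : ℕ) (j : Fin d),
        MemLp (fun ω => Real.log (Real.sqrt
          (GaussClass.quadForm Sig fun i => GaussClass.gaussMatrix g n ω i j))) 2 P ∧
        Var[fun ω => Real.log (Real.sqrt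
          (GaussClass.quadForm Sig fun i => GaussClass.gaussMatrix g n ω i j)); P] =
          1 / 4 * (Real.pi ^ 2 / 6 - J 2 - J 1 ^ 2)) ∧
      -- the real integrals
      IntegrableOn (fun x => cutoffDiff b.beta y x / x) (Set.Ioi 0) ∧
      J 1 = ∫ x in Set.Ioi (0 : ℝ), cutoffDiff b.beta y x / x ∧
      IntegrableOn (fun x => cutoffDiff b.beta y x * (Real.log x / x)) (Set.Ioi 0) ∧
      J 2 = 2 * (∫ x in Set.Ioi (0 : ℝ), cutoffDiff b.beta y x * (Real.log x / x))
        + Real.pi ^ 2 / 3 := by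
  have hβ := b.one_le_beta
  have hypos : ∀ i, 0 < y i := hy.pos hSig
  obtain ⟨hind, hlaw⟩ := hg
  set v : ℝ≥0 := 1 / (b.beta : ℝ≥0) with hvdef
  have hv : v ≠ 0 := by
    rw [hvdef]
    have : (b.beta : ℝ≥0) ≠ 0 := by exact_mod_cast (by omega : b.beta ≠ 0)
    positivity
  obtain ⟨B, hB⟩ := GaussClass.exists_orthonormalBasis_inverse hSig hy
  obtain ⟨hL, hLV⟩ := variance_log_norm_of_diagonal hv hβ hd hypos B
    (GaussClass.norm_sq_toOp_eq_sum hSig hS.1 hSS hy hB)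
  have hΓ := GaussClass.isGaussianOp_arrayOp (b := b) (d := d) v
  have hlyap : ∀ N ω, GaussClass.lyapunov₁ S g N ω =
      (N : ℝ)⁻¹ * Real.log ‖opProd (GaussClass.toOp S) GaussClass.arrayOp (fun k => g k ω) N‖ := by
    intro N ω
    rw [GaussClass.lyapunov₁, GaussClass.maxEigenvalue_conjTranspose_mul_self hd,
      GaussClass.toOp_prodMatrix, Real.log_pow]
    rcases eq_or_ne (N : ℝ) 0 with h | h
    · simp [h]
    · field_simp
      push_cast; ring
  have hne : Nonempty (Fin d × Fin b.beta) := ⟨(⟨0, hd⟩, ⟨0, hβ⟩)⟩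
  have hlim : (∀ N, MemLp (fun ω => Real.log
        ‖opProd (GaussClass.toOp S) GaussClass.arrayOp (fun k => g k ω) N‖) 2 P) ∧
      Tendsto (fun N : ℕ => Var[fun ω => Real.log
        ‖opProd (GaussClass.toOp S) GaussClass.arrayOp (fun k => g k ω) N‖; P] / N) atTop
        (𝓝 (1 / 4 *
          (Real.pi ^ 2 / 6 - keyholeValue b.beta y 2 - keyholeValue b.beta y 1 ^ 2))) := by
    -- The hypothesis on laws gives only a.e. measurability. Countably many entries can be replaced
    -- by measurable versions outside one null set.
    set g' : ℕ × Fin d × Fin d × Fin b.beta → Ω → ℝ := fun k => (hlaw k).aemeasurable.mk (g k)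
    have hgg' : ∀ k, g k =ᵐ[P] g' k := fun k => (hlaw k).aemeasurable.ae_eq_mk
    have hall : ∀ᵐ ω ∂P, ∀ k, g k ω = g' k ω := ae_all_iff.2 hgg'
    have h := tendsto_variance_log_norm_opProd (P := P) (g := g') hv hΓ hS.toOp_injective
      (hind.congr hgg') (fun k => (hlaw k).aemeasurable.measurable_mk)
      (fun k => (hlaw k).congr (hgg' k).symm) hL
    have hcongr : ∀ N, (fun ω => Real.log
          ‖opProd (GaussClass.toOp S) GaussClass.arrayOp (fun k => g k ω) N‖) =ᵐ[P] fun ω =>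
        Real.log ‖opProd (GaussClass.toOp S) GaussClass.arrayOp (fun k => g' k ω) N‖ := by
      intro N
      filter_upwards [hall] with ω hω
      simp only [hω]
    refine ⟨fun N => (memLp_congr_ae (hcongr N)).2 (h.1 N), ?_⟩
    rw [← hLV]
    simp only [fun N => variance_congr (hcongr N)]
    exact h.2
  refine ⟨keyholeValue b.beta y, fun p ε η hε hεy hη =>
      tendsto_keyholeIntegral hβ hd hypos p hε hεy hη,
    fun heven p ε η R hε hεy hη hR => keyholeIntegral_eq_of_even hβ hd hypos heven p hε hεy hη hR,
    fun N _ => ?_, ?_, fun n j => ?_, integrableOn_cutoffDiff_div hβ hd hypos,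
    keyholeValue_one hβ hd hypos, integrableOn_cutoffDiff_mul_log_div hβ hd hypos,
    keyholeValue_two hβ hd hypos⟩
  · rw [funext (hlyap N)]
    exact (hlim.1 N).const_mul _
  · refine hlim.2.congr fun N => ?_
    rw [funext (hlyap N), variance_const_mul]
    rcases eq_or_ne (N : ℝ) 0 with h | h
    · simp [h]
    · field_simp
  -- Applied to the `j`-th unit vector the Gaussian operator returns the `j`-th column, so a column
  -- has the same law as one orbit increment.
  · set e : EuclideanSpace ℝ (Fin d × Fin b.beta) := GaussClass.vecEquiv (Pi.single j 1)
    have he : ‖e‖ = 1 := by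
      have h := real_inner_self_eq_norm_sq e
      rw [GaussClass.inner_vecEquiv, dotProduct_single, Pi.star_apply, Pi.single_eq_same, star_one,
        mul_one, GaussClass.re_one] at h
      exact (pow_eq_one_iff_of_nonneg (norm_nonneg e) two_ne_zero).1 h.symm
    have hfun : (fun ω => Real.log (Real.sqrt
          (GaussClass.quadForm Sig fun i => GaussClass.gaussMatrix g n ω i j))) = fun ω =>
        (fun x : Fin d × Fin b.beta → ℝ => Real.log ‖GaussClass.toOp S (WithLp.toLp 2 x)‖)
          (GaussClass.arrayOp (fun i => g (n, i) ω) e).ofLp := by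
      funext ω
      have hcol : GaussClass.arrayOp (fun i => g (n, i) ω) e =
          GaussClass.vecEquiv fun i => GaussClass.gaussMatrix g n ω i j := by
        rw [GaussClass.arrayOp_apply, GaussClass.toOp_vecEquiv, Matrix.mulVec_single_one]
        rfl
      simp only [hcol]
      rw [GaussClass.quadForm_eq_inner, ← GaussClass.norm_sq_toOp_of_mul_self hS.1 hSS,
        Real.sqrt_sq (norm_nonneg _)]
    have hZ : AEMeasurable (fun ω i => g (n, i) ω) P :=
      aemeasurable_pi_lambda _ fun i => (hlaw (n, i)).aemeasurable
    have hΓc : Continuous (GaussClass.arrayOp : (Fin d × Fin d × Fin b.beta → ℝ) →ₗ[ℝ] _) :=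
      LinearMap.continuous_of_finiteDimensional _
    have hop : Measurable fun z : Fin d × Fin d × Fin b.beta → ℝ =>
        (GaussClass.arrayOp z e).ofLp :=
      (by fun_prop : Continuous fun z => (GaussClass.arrayOp z e).ofLp).measurable
    have hmap : P.map (fun ω => (GaussClass.arrayOp (fun i => g (n, i) ω) e).ofLp) =
        Measure.pi fun _ => gaussianReal 0 v := by
      rw [← hΓ e he, ← map_block_eq hind hlaw n, AEMeasurable.map_map_of_aemeasurable
        hop.aemeasurable hZ]
      rfl
    have hX : AEMeasurable (fun ω => (GaussClass.arrayOp (fun i => g (n, i) ω) e).ofLp) P :=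
      hop.comp_aemeasurable hZ
    have hlogm : Measurable fun x : Fin d × Fin b.beta → ℝ =>
        Real.log ‖GaussClass.toOp S (WithLp.toLp 2 x)‖ :=
      Real.measurable_log.comp
        (by fun_prop : Continuous fun x : Fin d × Fin b.beta → ℝ =>
          ‖GaussClass.toOp S (WithLp.toLp 2 x)‖).measurable
    rw [hfun, ← hLV]
    rw [← hmap] at hL ⊢
    exact ⟨(memLp_map_measure_iff hlogm.aestronglyMeasurable hX).1 hL,
      (variance_map hlogm.aemeasurable hX).symm⟩
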